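/- Proposition 5.22. Let $0<\alpha<1$ and let $\{(x_j,w_j)\}$ be a Poisson point process on $\mathbb R\times(0,\infty)$ with intensity $dx\,\alpha w^{-1-\alpha}\,dw$ (the locations and sizes of the jumps of an $\alpha$-stable subordinator). Let $\gamma=(\gamma_1,\gamma_2,\dots)$ be the sizes $w_j$ of the jumps with location $x_j\in[0,1]$, listed in decreasing order. Given $\gamma$, let $Y$ be the K-process with parameters $\gamma$ and $c=0$ started at $\infty$. That is, let $N^{(x)}$, $x\in\mathbb N^*=\{1,2,\dots\}$, be independent Poisson processes of rate $1$ with event times $\sigma^{(x)}_1<\sigma^{(x)}_2<\cdots$, let $T^{(x)}_i$, $x\in\mathbb N^*$, $i\ge1$, be i.i.d. exponential random variables of rate $1$ independent of them (all independent of $\gamma$), and let $\Gamma(s)=\sum_{x}\gamma_x\sum_{i=1}^{N^{(x)}_s}T^{(x)}_i$; then $Y(t)=x$ if $\Gamma(\sigma^{(x)}_j-)\le t<\Gamma(\sigma^{(x)}_j)$ for some $j\ge1$, and $Y(t)=\infty$ if there is no such $x\in\mathbb N^*$. For $t>0$ and $\theta\ge0$ put $$\Lambda_t(\theta)=\mathbb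 P\big(Y(s)=Y(t)\text{ for all }s\in[t,t+\theta t]\,\big|\,\gamma\big).$$ Then for almost every realization of $\gamma$ the following holds. Suppose that for Lebesgue-almost every $\theta\ge0$, $\Lambda_t(\theta)$ converges to some limit $\Lambda(\theta)$ as $t\downarrow0$. Then $\Lambda(\theta)=\Lambda^0(\theta)$ for almost every $\theta\ge0$, and more precisely for every $\theta\ge0$ at which $\Lambda_t(\theta)\to\Lambda(\theta)$, where $$\Lambda^0(\theta)=\frac{\sin(\pi\alpha)}{\pi}\int_{\theta/(1+\theta)}^1 s^{-\alpha}(1-s)^{\alpha-1}\,ds.$$ -/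

import Mathlib

open MeasureTheory ProbabilityTheory Filter Topology Set
open scoped ENNReal

namespace KProc

noncomputable section

/-! ### Poisson point processes and the random environment -/

/-- The counting measure `∑ⱼ δ_{ξⱼ}` of a sequence of points. -/
def pointMeasure {S : Type*} [MeasurableSpace S] (ξ : ℕ → S) : Measure S :=
  Measure.sum fun j => Measure.dirac (ξ j)

/-- The random points `ξ 0, ξ 1, …` form a Poisson point process with intensity measure `μ`:
the number of points in a measurable set of finite intensity `μ B` has the Poisson law with
parameter `μ B`, and the numbers of points in finitely many pairwise disjoint measurable sets are
independent. -/
structure IsPoissonPointProcess {Ω S : Type*} [MeasurableSpace Ω] [MeasurableSpace S]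
    (ξ : ℕ → Ω → S) (μ : Measure S) (P : Measure Ω) : Prop where
  measurable : ∀ j, Measurable (ξ j)
  hasLaw_count : ∀ B : Set S, MeasurableSet B → μ B < ∞ →
    HasLaw (fun ω => pointMeasure (fun j => ξ j ω) B)
      ((poissonMeasure (μ B).toNNReal).map (Nat.cast : ℕ → ℝ≥0∞)) P
  iIndepFun_count : ∀ (n : ℕ) (B : Fin n → Set S), (∀ i, MeasurableSet (B i)) →
    Pairwise (fun i k => Disjoint (B i) (B k)) →
    iIndepFun (fun i ω => pointMeasure (fun j => ξ j ω) (B i)) P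

/-- The measure `dx ⊗ α w ^ (-1 - α) dw` on `ℝ × (0, ∞)` (extended by zero to `ℝ × ℝ`): the
intensity of the point process of jumps (location `x`, size `w`) of the `α`-stable
subordinator. -/
def stableIntensity (α : ℝ) : Measure (ℝ × ℝ) :=
  (volume : Measure ℝ).prod
    ((volume.restrict (Ioi (0 : ℝ))).withDensity fun w => ENNReal.ofReal (α * w ^ (-1 - α)))

/-- Given the jumps `p j = (xⱼ, wⱼ)` of the subordinator, `jumpWeight p i` is the `i`-th largest
of the jump sizes `wⱼ` among the jumps with location `xⱼ ∈ [0, 1]`, for `i = 1, 2, …`; that is, the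
largest `r > 0` such that at least `i` of these jumps have size at least `r`. -/
def jumpWeight (p : ℕ → ℝ × ℝ) (i : ℕ+) : ℝ :=
  sSup {r : ℝ | 0 < r ∧ ((i : ℕ) : ℝ≥0∞) ≤ pointMeasure p (Icc (0 : ℝ) 1 ×ˢ Ici r)}

/-! ### The K-process with parameters `γ` and `c = 0`, started at `∞` -/

/-- The random variables `E x j`, `T x j` (`x = 1, 2, …`, `j = 0, 1, …`) are i.i.d. exponential of
rate `1`. The `E x j` are the interarrival times of independent Poisson processes of rate `1`
indexed by `x`, and the `T x j` are the (unscaled) holding times. -/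
structure IsDrivingFamily {Ω : Type*} [MeasurableSpace Ω] (E T : ℕ+ → ℕ → Ω → ℝ)
    (P : Measure Ω) : Prop where
  hasLaw_E : ∀ x j, HasLaw (E x j) (expMeasure 1) P
  hasLaw_T : ∀ x j, HasLaw (T x j) (expMeasure 1) P
  indep : iIndepFun
    (Sum.elim (fun q : ℕ+ × ℕ => E q.1 q.2) (fun q : ℕ+ × ℕ => T q.1 q.2)) P

/-- The time of the event number `j` (counted from `0`) of the `x`-th Poisson process, whose
interarrival times are `e x 0, e x 1, …`. -/
def arrival (e : ℕ+ → ℕ → ℝ) (x : ℕ+) (j : ℕ) : ℝ :=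
  ∑ i ∈ Finset.range (j + 1), e x i

/-- The clock `Γ(s) = ∑ₓ γ(x) ∑_{j : σⱼ(x) ≤ s} τⱼ(x)`, where the inner sum runs over the events up
to time `s` of the `x`-th Poisson process. -/
def clock (γ : ℕ+ → ℝ) (e τ : ℕ+ → ℕ → ℝ) (s : ℝ) : ℝ≥0∞ :=
  ∑' x : ℕ+, ∑' j : ℕ, if arrival e x j ≤ s then ENNReal.ofReal (γ x * τ x j) else 0

/-- At the (real) time `t`, the path is in the holding interval `[Γ(σ-), Γ(σ))` of the event
number `j` of the `x`-th Poisson process. -/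
def IsHolding (γ : ℕ+ → ℝ) (e τ : ℕ+ → ℕ → ℝ) (t : ℝ) (x : ℕ+) (j : ℕ) : Prop :=
  Function.leftLim (clock γ e τ) (arrival e x j) ≤ ENNReal.ofReal t ∧
    ENNReal.ofReal t < clock γ e τ (arrival e x j)

open Classical in
/-- The path of the K-process with parameters `γ` and `c = 0` started at `∞`, with values in the
one-point compactification of `{1, 2, …}`: it is at `x` on the holding intervals of the events of
the `x`-th Poisson process and at `∞` at all other times. -/
def kPath (γ : ℕ+ → ℝ) (e τ : ℕ+ → ℕ → ℝ) (t : ℝ) : OnePoint ℕ+ :=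
  if h : ∃ x : ℕ+, ∃ j : ℕ, IsHolding γ e τ t x j then ((h.choose : ℕ+) : OnePoint ℕ+)
  else OnePoint.infty

/-! ### The aging function and its limit -/

/-- `Λₜ(θ)`: the probability, for fixed `γ`, that the K-process started at `∞` stays
constant on the time interval `[t, t + θ t]`. -/
def agingFn {Ω : Type*} [MeasurableSpace Ω] (P : Measure Ω) (E T : ℕ+ → ℕ → Ω → ℝ)
    (γ : ℕ+ → ℝ) (t θ : ℝ) : ℝ :=
  P.real {ω | ∀ s ∈ Icc t (t + θ * t),
    kPath γ (fun x j => E x j ω) (fun x j => T x j ω) s =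
      kPath γ (fun x j => E x j ω) (fun x j => T x j ω) t}

/-- The arcsine-law function
`Λ⁰(θ) = (sin πα / π) ∫_{θ/(1+θ)}^1 s ^ (-α) (1 - s) ^ (α - 1) ds`. -/
def arcsineFn (α θ : ℝ) : ℝ :=
  Real.sin (Real.pi * α) / Real.pi *
    ∫ s in (θ / (1 + θ))..1, s ^ (-α) * (1 - s) ^ (α - 1)

end

end KProc

namespace KProc

/-! Only one feature of the environment matters: almost surely the number of weights `γ x ≥ r` is
asymptotic to `r ^ (-α)` as `r ↓ 0`. The count of jumps of size at least `r` located in `[0, 1]` is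
Poisson with mean `r ^ (-α)`. A variance bound along `r = (k + 1) ^ (-2 / α)` and monotonicity
between these points give a strong law (`ae_isRegularEnv_jumpWeight`). The rest is deterministic in
`γ`.

Since `c = 0`, the clock is a pure jump process. Its ranges over the jumps fill almost all of the
time axis, so the path is constant on `[t, t + u]` exactly when this interval lies inside one
holding interval (`kPath_const_iff`). Let `H(t, u)` be the probability of this event and `φ(l) = ∑
lγₓ / (1 + lγₓ)` the Laplace exponent of the clock. Given `Γ(σ-) = g ≤ t` at an event of state `x`,
the event has probability `exp(-(t + u - g) / γₓ)`. Moreover, `E ∑ⱼ exp(-l Γ(σⱼ-)) = 1 / φ(l)` for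
the events of any single state. Hence `∫∫ e^{-l(t+u)} uⁿ H(t, u) du dt = φ(l)⁻¹ ∑ₓ n! (γₓ / (1 +
lγₓ))^{n+2}` (`lintegral_lintegral_holdProb`).

Multiply by `l^{n+2}` and let `l → ∞`. On the right, `∑ₓ (lγₓ / (1 + lγₓ))^m ∼ m B(m - α, 1 + α)
l^α` (`tendsto_powerSum`), and the powers of `l` cancel in the ratio. On the left, substitute `t = s
/ l`, `u = θt`. The assumed convergence of `H(t, θt)` and two uses of dominated convergence give
`(n+1)! ∫ θⁿ (1+θ)^{-n-2} Λ(θ) dθ` (`tendsto_lintegral_lintegral_scaling`). Because the limit is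
assumed to exist, no Tauberian argument is needed.

Thus the images of `Λ(θ) dθ / (1+θ)²` and `Λ⁰(θ) dθ / (1+θ)²` under `θ / (1+θ)` are finite measures
on `[0, 1]` with the same moments. They coincide, and `Λ = Λ⁰` almost everywhere
(`ae_eq_of_moments_div_one_add`). Finally, `Λₜ` is antitone in `θ` and `Λ⁰` is continuous, which
settles every positive point of convergence; at `θ = 0` both sides are `1`. -/

/-- The number of indices `i` with `r ≤ γ i`. -/
noncomputable def tailCount (γ : ℕ+ → ℝ) (r : ℝ) : ℝ≥0∞ :=
  ∑' i : ℕ+, if r ≤ γ i then 1 else 0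

/-- The environments `γ` for which the aging limit is computed: positive bounded weights whose
counting function is asymptotic to `r ^ (-α)` as `r ↓ 0`. -/
structure IsRegularEnv (α : ℝ) (γ : ℕ+ → ℝ) : Prop where
  pos : ∀ i, 0 < γ i
  bdd : ∃ R, ∀ i, γ i ≤ R
  fin : ∀ r, 0 < r → tailCount γ r ≠ ∞
  lim : Tendsto (fun r => (tailCount γ r).toReal * r ^ α) (𝓝[>] 0) (𝓝 1)

/-! ### Strong law for the number of large jumps -/

theorem stableIntensity_Icc_prod_Ici {α : ℝ} (hα : 0 < α) {r : ℝ} (hr : 0 < r) :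
    stableIntensity α (Icc (0 : ℝ) 1 ×ˢ Ici r) = ENNReal.ofReal (r ^ (-α)) := by
  have h1 : (-1 - α) < -1 := by linarith
  have hint : IntegrableOn (fun w : ℝ => α * w ^ (-1 - α)) (Ioi r) :=
    (integrableOn_Ioi_rpow_of_lt h1 hr).const_mul α
  rw [stableIntensity, Measure.prod_prod, withDensity_apply _ measurableSet_Ici,
    Measure.restrict_restrict measurableSet_Ici]
  have : Ici r ∩ Ioi 0 = Ici r := inter_eq_left.2 fun x hx => lt_of_lt_of_le hr hx
  rw [this, setLIntegral_congr Ioi_ae_eq_Ici.symm, ← ofReal_integral_eq_lintegral_ofReal hint,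
    integral_const_mul, integral_Ioi_rpow_of_lt h1 hr]
  · have : -1 - α + 1 = -α := by ring
    rw [this]
    simp only [Real.volume_Icc, sub_zero, ENNReal.ofReal_one, one_mul]
    congr 1
    field_simp
  · filter_upwards [self_mem_ae_restrict measurableSet_Ioi] with w hw
    have : 0 < w := hr.trans hw
    simp only [Pi.zero_apply]
    positivity

/-- Write `(n - m)² = n(n - 1) + (1 - 2m)n + m²`; each factorial moment follows from the preceding
one by a shift of index. -/
theorem hasSum_poisson_variance (m : ℝ) :
    HasSum (fun n : ℕ => Real.exp (-m) * m ^ n / n.factorial * ((n : ℝ) - m) ^ 2) m := by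
  have h0 : HasSum (fun n : ℕ => m ^ n / n.factorial) (Real.exp m) := by
    simpa [Real.exp_eq_exp_ℝ] using NormedSpace.expSeries_div_hasSum_exp m
  have h1 : HasSum (fun n : ℕ => m ^ n / n.factorial * n) (m * Real.exp m) := by
    rw [← hasSum_nat_add_iff' 1]
    simp only [Finset.range_one, Finset.sum_singleton, Nat.cast_zero, mul_zero, sub_zero]
    refine HasSum.congr_fun (h0.mul_left m) fun n => ?_
    rw [Nat.factorial_succ]
    push_cast
    field_simp
    ring
  have h2 : HasSum (fun n : ℕ => m ^ n / n.factorial * (n * (n - 1))) (m * (m * Real.exp m)) := by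
    rw [← hasSum_nat_add_iff' 1]
    simp only [Finset.range_one, Finset.sum_singleton, Nat.cast_zero, mul_zero, sub_zero, zero_mul]
    refine HasSum.congr_fun (h1.mul_left m) fun n => ?_
    rw [Nat.factorial_succ]
    push_cast
    field_simp
    ring
  have h3 := ((h2.add (h1.mul_left (1 - 2 * m))).add (h0.mul_left (m ^ 2))).mul_left
    (Real.exp (-m))
  have he : Real.exp (-m) * Real.exp m = 1 := by rw [← Real.exp_add]; simp
  have h4 : Real.exp (-m) * (m * (m * Real.exp m) + (1 - 2 * m) * (m * Real.exp m) +
      m ^ 2 * Real.exp m) = m := by linear_combination m * he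
  rw [h4] at h3
  exact h3.congr_fun fun n => by ring

theorem lintegral_poissonMeasure_sq_sub (m : NNReal) :
    ∫⁻ n : ℕ, ENNReal.ofReal (((n : ℝ) - m) ^ 2) ∂(poissonMeasure m) = m := by
  rw [poissonMeasure, lintegral_sum_measure]
  simp only [lintegral_smul_measure, lintegral_dirac, smul_eq_mul]
  have h := hasSum_poisson_variance m
  rw [← ENNReal.ofReal_coe_nnreal (p := m)]
  conv_rhs => rw [← h.tsum_eq]
  rw [ENNReal.ofReal_tsum_of_nonneg (fun n => by positivity) h.summable]
  congr 1 with n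
  rw [ENNReal.ofReal_mul (by positivity)]

theorem lintegral_sq_sub_of_hasLaw_poisson {Ω : Type*} [MeasurableSpace Ω] {P : Measure Ω}
    {M : Ω → ℝ≥0∞} {m : NNReal}
    (h : HasLaw M ((poissonMeasure m).map (Nat.cast : ℕ → ℝ≥0∞)) P) :
    ∫⁻ ω, ENNReal.ofReal (((M ω).toReal - m) ^ 2) ∂P = m := by
  have hf : Measurable fun z : ℝ≥0∞ => ENNReal.ofReal ((z.toReal - m) ^ 2) := by fun_prop
  rw [h.lintegral_comp (f := fun z => ENNReal.ofReal ((z.toReal - m) ^ 2)) hf.aemeasurable,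
    lintegral_map hf Measurable.of_discrete, ← lintegral_poissonMeasure_sq_sub m]
  simp

theorem ae_ne_top_of_hasLaw_poisson {Ω : Type*} [MeasurableSpace Ω] {P : Measure Ω}
    {M : Ω → ℝ≥0∞} {m : NNReal}
    (h : HasLaw M ((poissonMeasure m).map (Nat.cast : ℕ → ℝ≥0∞)) P) :
    ∀ᵐ ω ∂P, M ω ≠ ∞ := by
  have hs : MeasurableSet {z : ℝ≥0∞ | z ≠ ∞} := (measurableSet_singleton ∞).compl
  have h1 : ∀ᵐ z ∂(P.map M), z ≠ ∞ := by
    rw [h.map_eq, ae_map_iff Measurable.of_discrete.aemeasurable hs]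
    exact ae_of_all _ fun n => ENNReal.natCast_ne_top n
  exact ae_of_ae_map h.aemeasurable h1

/-- A sequence of Poisson variables with means `(k + 1) ^ 2` satisfies the law of large numbers. -/
theorem ae_tendsto_of_hasLaw_poisson_sq {Ω : Type*} [MeasurableSpace Ω] {P : Measure Ω}
    {M : ℕ → Ω → ℝ≥0∞}
    (h : ∀ k, HasLaw (M k)
      ((poissonMeasure ((k + 1 : NNReal) ^ 2)).map (Nat.cast : ℕ → ℝ≥0∞)) P) :
    ∀ᵐ ω ∂P, Tendsto (fun k => (M k ω).toReal / ((k : ℝ) + 1) ^ 2) atTop (𝓝 1) := by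
  -- The variance `(k + 1)²` is divided by the squared mean `(k + 1)⁴`.
  have hE : ∀ k, ∫⁻ ω, ENNReal.ofReal (((M k ω).toReal / ((k : ℝ) + 1) ^ 2 - 1) ^ 2) ∂P =
      ENNReal.ofReal (1 / ((k : ℝ) + 1) ^ 2) := by
    intro k
    have h1 := lintegral_sq_sub_of_hasLaw_poisson (h k)
    have h2 : ∀ ω, ENNReal.ofReal (((M k ω).toReal / ((k : ℝ) + 1) ^ 2 - 1) ^ 2) =
        ENNReal.ofReal (1 / ((k : ℝ) + 1) ^ 4) *
          ENNReal.ofReal (((M k ω).toReal - ((k + 1 : NNReal) ^ 2 : NNReal)) ^ 2) := by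
      intro ω
      rw [← ENNReal.ofReal_mul (by positivity)]
      congr 1
      push_cast
      have : (0 : ℝ) < (k : ℝ) + 1 := by positivity
      field_simp
    simp_rw [h2]
    rw [lintegral_const_mul' _ _ ENNReal.ofReal_ne_top, h1, ← ENNReal.ofReal_coe_nnreal,
      ← ENNReal.ofReal_mul (by positivity)]
    congr 1
    push_cast
    field_simp
  -- The squared errors have summable expectations, so their sum is almost surely finite and its
  -- terms tend to zero.
  have hsum : ∫⁻ ω, ∑' k, ENNReal.ofReal (((M k ω).toReal / ((k : ℝ) + 1) ^ 2 - 1) ^ 2) ∂P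
      ≠ ∞ := by
    rw [lintegral_tsum]
    · simp_rw [hE]
      have hs : Summable fun k : ℕ => 1 / ((k : ℝ) + 1) ^ 2 := by
        have := (summable_nat_add_iff 1).2 (Real.summable_one_div_nat_pow.2 (one_lt_two))
        simpa using this
      rw [← ENNReal.ofReal_tsum_of_nonneg (fun k => by positivity) hs]
      exact ENNReal.ofReal_ne_top
    · intro k
      have := (h k).aemeasurable
      fun_prop
  have hae := ae_lt_top' (AEMeasurable.tsum fun k => by
    have := (h k).aemeasurable
    fun_prop) hsum
  filter_upwards [hae] with ω hω
  have h0 := ENNReal.tendsto_atTop_zero_of_tsum_ne_top hω.ne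
  have h1 := (ENNReal.tendsto_toReal ENNReal.zero_ne_top).comp h0
  have h2 : Tendsto (fun k : ℕ => ((M k ω).toReal / ((k : ℝ) + 1) ^ 2 - 1) ^ 2) atTop (𝓝 0) := by
    refine h1.congr fun k => ?_
    simp only [Function.comp]
    rw [ENNReal.toReal_ofReal (by positivity)]
  have h3 : Tendsto (fun k : ℕ => (M k ω).toReal / ((k : ℝ) + 1) ^ 2 - 1) atTop (𝓝 0) := by
    have h4 := (Real.continuous_sqrt.tendsto 0).comp h2
    simp only [Real.sqrt_zero, Function.comp_def, Real.sqrt_sq_eq_abs] at h4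
    exact (tendsto_zero_iff_abs_tendsto_zero _).2 h4
  simpa using h3.add_const 1

/-- Interpolation: an antitone function whose values along `r_k = (k+1)^(-2/α)` are asymptotic to
`(k+1)^2` is asymptotic to `r^(-α)`. -/
theorem tendsto_mul_rpow_of_tendsto_seq {α : ℝ} (hα : 0 < α) {m : ℝ → ℝ}
    (hm0 : ∀ r, 0 ≤ m r)
    (hm : ∀ r s, 0 < r → r ≤ s → m s ≤ m r)
    (h : Tendsto (fun k : ℕ => m (((k : ℝ) + 1) ^ (-2 / α)) / ((k : ℝ) + 1) ^ 2) atTop (𝓝 1)) :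
    Tendsto (fun r => m r * r ^ α) (𝓝[>] 0) (𝓝 1) := by
  -- With `k = ⌊r ^ (-α / 2)⌋`, the point `r` is squeezed between `(k + 1) ^ (-2 / α)` and `k ^ (-2
  -- / α)`. The two bounds on `m r * r ^ α` differ from the known ratios only by factors `(k / (k +
  -- 1))²` and its inverse.
  have hk : Tendsto (fun r : ℝ => ⌊r ^ (-(α / 2))⌋₊) (𝓝[>] 0) atTop :=
    tendsto_nat_floor_atTop.comp (tendsto_rpow_neg_nhdsGT_zero (by linarith))
  have hratio : Tendsto (fun k : ℕ => ((k : ℝ) / (k + 1)) ^ 2) atTop (𝓝 1) := by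
    simpa using (tendsto_natCast_div_add_atTop (1 : ℝ)).pow 2
  have hratio' : Tendsto (fun k : ℕ => (((k : ℝ) + 1) / k) ^ 2) atTop (𝓝 1) := by
    have := hratio.inv₀ one_ne_zero
    simpa [← inv_pow, inv_div] using this
  have hseq : Tendsto (fun k : ℕ => m ((k : ℝ) ^ (-2 / α)) / (k : ℝ) ^ 2) atTop (𝓝 1) := by
    rw [← tendsto_add_atTop_iff_nat 1]
    simpa using h
  have hlow := (hratio.mul hseq).comp hk
  have hupp := (hratio'.mul h).comp hk
  rw [mul_one] at hlow hupp
  refine tendsto_of_tendsto_of_tendsto_of_le_of_le' hlow hupp ?_ ?_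
  all_goals
    have hmem : Ioo (0 : ℝ) 1 ∈ 𝓝[>] (0 : ℝ) := Ioo_mem_nhdsGT one_pos
    filter_upwards [hmem] with r hr
    simp only [Function.comp]
    set k := ⌊r ^ (-(α / 2))⌋₊ with hkdef
    have hpos : 0 < r ^ (-(α / 2)) := Real.rpow_pos_of_pos hr.1 _
    have hk1 : (k : ℝ) ≤ r ^ (-(α / 2)) := Nat.floor_le hpos.le
    have hk2 : r ^ (-(α / 2)) < (k : ℝ) + 1 := Nat.lt_floor_add_one _
    have hone : 1 ≤ k := by
      refine Nat.le_floor ?_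
      rw [Nat.cast_one]
      exact Real.one_le_rpow_of_pos_of_le_one_of_nonpos hr.1 hr.2.le (by linarith)
    have hkpos : (0 : ℝ) < k := by exact_mod_cast hone
    have hrα : r ^ α = ((r ^ (-(α / 2))) ^ 2)⁻¹ := by
      rw [← Real.rpow_natCast, ← Real.rpow_mul hr.1.le, ← Real.rpow_neg hr.1.le]
      congr 1; push_cast; ring
    have hr2 : r = (r ^ (-(α / 2))) ^ (-2 / α) := by
      rw [← Real.rpow_mul hr.1.le]
      have : -(α / 2) * (-2 / α) = 1 := by field_simp
      rw [this, Real.rpow_one]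
    have hneg : -2 / α ≤ 0 := div_nonpos_of_nonpos_of_nonneg (by norm_num) hα.le
  · have h1 : r ≤ (k : ℝ) ^ (-2 / α) := by
      conv_lhs => rw [hr2]
      exact Real.rpow_le_rpow_of_nonpos hkpos hk1 hneg
    have h2 := hm _ _ hr.1 h1
    have h3 : (k : ℝ) / (k + 1) * (k / (k + 1)) = (k / (k + 1)) ^ 2 := by ring
    calc ((k : ℝ) / (k + 1)) ^ 2 * (m ((k : ℝ) ^ (-2 / α)) / (k : ℝ) ^ 2)
        = m ((k : ℝ) ^ (-2 / α)) * (((k : ℝ) + 1) ^ 2)⁻¹ := by field_simp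
      _ ≤ m r * r ^ α := by
        rw [hrα]
        gcongr
        exact hm0 r
  · have h1 : ((k : ℝ) + 1) ^ (-2 / α) ≤ r := by
      conv_rhs => rw [hr2]
      exact Real.rpow_le_rpow_of_nonpos hpos hk2.le hneg
    have h2 := hm _ _ (Real.rpow_pos_of_pos (by positivity) _) h1
    calc m r * r ^ α ≤ m (((k : ℝ) + 1) ^ (-2 / α)) * ((k : ℝ) ^ 2)⁻¹ := by
          rw [hrα]
          gcongr
          exact hm0 _
      _ = (((k : ℝ) + 1) / k) ^ 2 * (m (((k : ℝ) + 1) ^ (-2 / α)) / ((k : ℝ) + 1) ^ 2) := by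
        field_simp

/-! ### The ordered jump sizes and their counting function -/

theorem pointMeasure_eq_encard {S : Type*} [MeasurableSpace S] (ξ : ℕ → S) {B : Set S}
    (hB : MeasurableSet B) : pointMeasure ξ B = ({j | ξ j ∈ B}.encard : ℝ≥0∞) := by
  rw [pointMeasure, Measure.sum_apply _ hB, ← ENNReal.tsum_set_one,
    tsum_subtype {j | ξ j ∈ B} (fun _ => (1 : ℝ≥0∞))]
  refine tsum_congr fun j => ?_
  rw [Measure.dirac_apply' _ hB]
  rfl

theorem measurableSet_Icc_prod_Ici (r : ℝ) :
    MeasurableSet (Icc (0 : ℝ) 1 ×ˢ Ici r) := measurableSet_Icc.prod measurableSet_Ici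

theorem pnat_tsum_ite_le (n : ℕ) : ∑' i : ℕ+, (if ((i : ℕ) : ℝ≥0∞) ≤ n then (1 : ℝ≥0∞) else 0) = n := by
  rw [tsum_pnat_eq_tsum_succ (f := fun i : ℕ => if ((i : ℕ) : ℝ≥0∞) ≤ n then (1 : ℝ≥0∞) else 0),
    tsum_eq_sum (s := Finset.range n)]
  · rw [Finset.sum_congr rfl (g := fun _ => (1 : ℝ≥0∞))]
    · simp
    · intro i hi
      rw [if_pos]
      exact_mod_cast Finset.mem_range.1 hi
  · intro i hi
    rw [if_neg]
    simp only [Finset.mem_range, not_lt] at hi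
    rw [not_le]
    exact_mod_cast Nat.lt_succ_of_le hi

section JumpWeight

variable {p : ℕ → ℝ × ℝ}

theorem pointMeasure_Ici_antitone {r s : ℝ} (h : r ≤ s) :
    pointMeasure p (Icc (0 : ℝ) 1 ×ˢ Ici s) ≤ pointMeasure p (Icc (0 : ℝ) 1 ×ˢ Ici r) :=
  measure_mono (prod_mono le_rfl (Ici_subset_Ici.2 h))

/-- The boxes decrease to the empty set, so continuity from above applies once one of them has
finite measure. -/
theorem exists_pointMeasure_Ici_lt_one
    (hfin : ∀ r, 0 < r → pointMeasure p (Icc (0 : ℝ) 1 ×ˢ Ici r) ≠ ∞) :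
    ∃ R, 0 < R ∧ pointMeasure p (Icc (0 : ℝ) 1 ×ˢ Ici R) < 1 := by
  have h := tendsto_measure_iInter_atTop (μ := pointMeasure p)
    (s := fun n : ℕ => Icc (0 : ℝ) 1 ×ˢ Ici ((n : ℝ) + 1))
    (fun n => (measurableSet_Icc_prod_Ici _).nullMeasurableSet)
    (fun n m hnm => prod_mono le_rfl (Ici_subset_Ici.2 (by gcongr)))
    ⟨0, hfin _ (by positivity)⟩
  have hempty : ⋂ n : ℕ, Icc (0 : ℝ) 1 ×ˢ Ici ((n : ℝ) + 1) = ∅ := by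
    refine eq_empty_of_forall_notMem fun z hz => ?_
    obtain ⟨n, hn⟩ := exists_nat_gt z.2
    have := (mem_iInter.1 hz n).2
    simp only [mem_Ici] at this
    linarith
  rw [hempty, measure_empty] at h
  obtain ⟨n, hn⟩ := (h.eventually_lt_const one_pos).exists
  exact ⟨n + 1, by positivity, hn⟩

/-- The supremum defining `jumpWeight` is attained: the boxes are closed on the left, so by
continuity from above the count is left-continuous in `r`. For the converse the set must be bounded
above, which holds because the count eventually drops below `1`. -/
theorem le_jumpWeight_iff
    (hfin : ∀ r, 0 < r → pointMeasure p (Icc (0 : ℝ) 1 ×ˢ Ici r) ≠ ∞) {r : ℝ} (hr : 0 < r)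
    (i : ℕ+) :
    r ≤ jumpWeight p i ↔ ((i : ℕ) : ℝ≥0∞) ≤ pointMeasure p (Icc (0 : ℝ) 1 ×ˢ Ici r) := by
  constructor
  · intro h
    have hne : {r : ℝ | 0 < r ∧ ((i : ℕ) : ℝ≥0∞) ≤
        pointMeasure p (Icc (0 : ℝ) 1 ×ˢ Ici r)}.Nonempty := by
      by_contra hne
      rw [not_nonempty_iff_eq_empty] at hne
      -- The supremum of the empty set is `0`, against `0 < r`.
      rw [jumpWeight, hne, Real.sSup_empty] at h
      linarith
    obtain ⟨u, hu, hur, hlim⟩ := exists_seq_strictMono_tendsto' hr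
    have hle : ∀ n, ((i : ℕ) : ℝ≥0∞) ≤ pointMeasure p (Icc (0 : ℝ) 1 ×ˢ Ici (u n)) := by
      intro n
      obtain ⟨s, hs, hns⟩ := exists_lt_of_lt_csSup hne ((hur n).2.trans_le h)
      exact hs.2.trans (pointMeasure_Ici_antitone hns.le)
    have hI : ⋂ n, Icc (0 : ℝ) 1 ×ˢ Ici (u n) = Icc (0 : ℝ) 1 ×ˢ Ici r := by
      ext z
      simp only [mem_iInter, mem_prod, mem_Ici]
      constructor
      · intro hz
        exact ⟨(hz 0).1, le_of_tendsto' hlim fun n => (hz n).2⟩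
      · intro hz n
        exact ⟨hz.1, (hur n).2.le.trans hz.2⟩
    have ht := tendsto_measure_iInter_atTop (μ := pointMeasure p)
      (s := fun n : ℕ => Icc (0 : ℝ) 1 ×ˢ Ici (u n))
      (fun n => (measurableSet_Icc_prod_Ici _).nullMeasurableSet)
      (fun n m hnm => prod_mono le_rfl (Ici_subset_Ici.2 (hu.monotone hnm)))
      ⟨0, hfin _ (hur 0).1⟩
    rw [hI] at ht
    exact ge_of_tendsto' ht hle
  · intro h
    obtain ⟨R, hR, hlt⟩ := exists_pointMeasure_Ici_lt_one hfin
    refine le_csSup ⟨R, ?_⟩ ⟨hr, h⟩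
    rintro s ⟨hs, his⟩
    by_contra hsR
    have h1 := his.trans ((pointMeasure_Ici_antitone (not_le.1 hsR).le).trans_lt hlt).le
    have h2 : ((i : ℕ) : ℝ≥0∞) < 1 :=
      his.trans_lt ((pointMeasure_Ici_antitone (not_le.1 hsR).le).trans_lt hlt)
    have h3 : (1 : ℝ≥0∞) ≤ ((i : ℕ) : ℝ≥0∞) := by exact_mod_cast one_le (a := i)
    exact absurd h2 (not_lt.2 h3)

/-- By `le_jumpWeight_iff` the left side counts the positive integers not exceeding the right side,
which is a natural number because it is a finite cardinality. -/
theorem tailCount_jumpWeight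
    (hfin : ∀ r, 0 < r → pointMeasure p (Icc (0 : ℝ) 1 ×ˢ Ici r) ≠ ∞) {r : ℝ} (hr : 0 < r) :
    tailCount (jumpWeight p) r = pointMeasure p (Icc (0 : ℝ) 1 ×ˢ Ici r) := by
  simp only [tailCount, le_jumpWeight_iff hfin hr]
  have h := hfin r hr
  rw [pointMeasure_eq_encard p (measurableSet_Icc_prod_Ici r)] at h ⊢
  have hf : {j | p j ∈ Icc (0 : ℝ) 1 ×ˢ Ici r}.Finite := by
    by_contra hinf
    rw [Set.Infinite.encard_eq hinf] at h
    simp at h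
  rw [← hf.cast_ncard_eq]
  simpa using pnat_tsum_ite_le _

/-- Positivity of every weight reflects that there are infinitely many jumps: the assumed
asymptotics force the count to tend to infinity as `r ↓ 0`. -/
theorem isRegularEnv_jumpWeight {α : ℝ} (hα : 0 < α)
    (hfin : ∀ r, 0 < r → pointMeasure p (Icc (0 : ℝ) 1 ×ˢ Ici r) ≠ ∞)
    (hlim : Tendsto (fun r => (pointMeasure p (Icc (0 : ℝ) 1 ×ˢ Ici r)).toReal * r ^ α)
      (𝓝[>] 0) (𝓝 1)) :
    IsRegularEnv α (jumpWeight p) where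
  pos := by
    intro i
    have h1 : Tendsto (fun r => (pointMeasure p (Icc (0 : ℝ) 1 ×ˢ Ici r)).toReal)
        (𝓝[>] 0) atTop := by
      refine (hlim.pos_mul_atTop one_pos (tendsto_rpow_neg_nhdsGT_zero (neg_lt_zero.2 hα))).congr' ?_
      filter_upwards [self_mem_nhdsWithin] with r (hr : 0 < r)
      rw [mul_assoc, ← Real.rpow_add hr]
      simp
    obtain ⟨r, hr1, hr2⟩ := ((h1.eventually_ge_atTop ((i : ℕ) : ℝ)).and self_mem_nhdsWithin).exists
    refine lt_of_lt_of_le hr2 ((le_jumpWeight_iff hfin hr2 i).2 ?_)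
    rw [← ENNReal.ofReal_toReal (hfin r hr2), ← ENNReal.ofReal_natCast]
    exact ENNReal.ofReal_le_ofReal hr1
  bdd := by
    obtain ⟨R, hR, hlt⟩ := exists_pointMeasure_Ici_lt_one hfin
    refine ⟨R, fun i => le_of_not_ge fun h => ?_⟩
    have h2 := ((le_jumpWeight_iff hfin hR i).1 h).trans_lt hlt
    have h3 : (1 : ℝ≥0∞) ≤ ((i : ℕ) : ℝ≥0∞) := by exact_mod_cast one_le (a := i)
    exact absurd h2 (not_lt.2 h3)
  fin := fun r hr => by rw [tailCount_jumpWeight hfin hr]; exact hfin r hr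
  lim := by
    refine hlim.congr' ?_
    filter_upwards [self_mem_nhdsWithin] with r (hr : 0 < r)
    rw [tailCount_jumpWeight hfin hr]

end JumpWeight

theorem ae_isRegularEnv_jumpWeight {Ω : Type*} [MeasurableSpace Ω] {P : Measure Ω}
    {α : ℝ} (hα : 0 < α) {p : ℕ → Ω → ℝ × ℝ}
    (hp : IsPoissonPointProcess p (stableIntensity α) P) :
    ∀ᵐ ω ∂P, IsRegularEnv α (jumpWeight fun j => p j ω) := by
  have hlaw : ∀ k : ℕ, HasLaw (fun ω => pointMeasure (fun j => p j ω)
      (Icc (0 : ℝ) 1 ×ˢ Ici (((k : ℝ) + 1) ^ (-2 / α))))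
      ((poissonMeasure ((k + 1 : NNReal) ^ 2)).map (Nat.cast : ℕ → ℝ≥0∞)) P := by
    intro k
    have hr : 0 < ((k : ℝ) + 1) ^ (-2 / α) := Real.rpow_pos_of_pos (by positivity) _
    have hμ := stableIntensity_Icc_prod_Ici hα hr
    have h := hp.hasLaw_count _ (measurableSet_Icc_prod_Ici _)
      (by rw [hμ]; exact ENNReal.ofReal_lt_top)
    have he : (stableIntensity α (Icc (0 : ℝ) 1 ×ˢ Ici (((k : ℝ) + 1) ^ (-2 / α)))).toNNReal =
        (k + 1 : NNReal) ^ 2 := by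
      rw [hμ, ← Real.rpow_mul (by positivity)]
      have : -2 / α * -α = (2 : ℕ) := by push_cast; field_simp
      rw [this, Real.rpow_natCast]
      ext
      rw [ENNReal.coe_toNNReal_eq_toReal, ENNReal.toReal_ofReal (by positivity)]
      push_cast; ring
    rwa [he] at h
  filter_upwards [ae_tendsto_of_hasLaw_poisson_sq hlaw,
    ae_all_iff.2 fun k => ae_ne_top_of_hasLaw_poisson (hlaw k)] with ω hlim hfin
  -- Finiteness is known along the sequence only; below any `r` lies a member of it, with a larger
  -- count.
  have hfin' : ∀ r, 0 < r →
      pointMeasure (fun j => p j ω) (Icc (0 : ℝ) 1 ×ˢ Ici r) ≠ ∞ := by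
    intro r hr
    have h0 : Tendsto (fun k : ℕ => ((k : ℝ) + 1) ^ (-2 / α)) atTop (𝓝 0) := by
      have h1 := (tendsto_rpow_neg_atTop (y := 2 / α) (by positivity)).comp
        (tendsto_atTop_add_const_right atTop (1 : ℝ) tendsto_natCast_atTop_atTop)
      simpa [Function.comp_def, neg_div] using h1
    obtain ⟨k, hk⟩ := (h0.eventually_lt_const hr).exists
    exact ne_top_of_le_ne_top (hfin k) (pointMeasure_Ici_antitone hk.le)
  refine isRegularEnv_jumpWeight hα hfin' (tendsto_mul_rpow_of_tendsto_seq hα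
    (fun r => ENNReal.toReal_nonneg) (fun r s hr hrs => ?_) hlim)
  exact ENNReal.toReal_mono (hfin' r hr) (pointMeasure_Ici_antitone hrs)

/-! ### Asymptotics of the power sums of a regular environment -/

theorem lintegral_Ioo_rpow_mul_one_sub_rpow {a b : ℝ} (ha : 0 < a) (hb : 0 < b) :
    ∫⁻ v in Ioo (0 : ℝ) 1, ENNReal.ofReal (v ^ (a - 1) * (1 - v) ^ (b - 1)) =
      ENNReal.ofReal (beta a b) := by
  have hB := beta_pos ha hb
  have h1 := lintegral_betaPDF_eq_one ha hb
  rw [lintegral_betaPDF] at h1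
  have h2 : ∀ v : ℝ, ENNReal.ofReal (v ^ (a - 1) * (1 - v) ^ (b - 1)) =
      ENNReal.ofReal (beta a b) *
        ENNReal.ofReal (1 / beta a b * v ^ (a - 1) * (1 - v) ^ (b - 1)) := by
    intro v
    rw [← ENNReal.ofReal_mul hB.le]
    congr 1
    field_simp
  simp_rw [h2]
  rw [lintegral_const_mul' _ _ ENNReal.ofReal_ne_top, h1, mul_one]

/-- The sum `∑ₓ (l γₓ / (1 + l γₓ)) ^ m`. -/
noncomputable def powerSum (γ : ℕ+ → ℝ) (m : ℕ) (l : ℝ) : ℝ≥0∞ :=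
  ∑' x : ℕ+, ENNReal.ofReal ((l * γ x / (1 + l * γ x)) ^ m)

@[fun_prop]
theorem measurable_tailCount (γ : ℕ+ → ℝ) : Measurable (tailCount γ) :=
  Measurable.tsum fun _ =>
    Measurable.ite measurableSet_Iic measurable_const measurable_const

theorem lintegral_pow_succ_mul_ite {w : ℝ} (hw : w ∈ Ioo (0 : ℝ) 1) (m : ℕ) :
    ∫⁻ v in Ioo (0 : ℝ) 1, ENNReal.ofReal ((m + 1 : ℝ) * v ^ m) * (if v ≤ w then 1 else 0) =
      ENNReal.ofReal (w ^ (m + 1)) := by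
  have h1 : ∀ v : ℝ, ENNReal.ofReal ((m + 1 : ℝ) * v ^ m) * (if v ≤ w then (1 : ℝ≥0∞) else 0) =
      (Iic w).indicator (fun v => ENNReal.ofReal ((m + 1 : ℝ) * v ^ m)) v := by
    intro v
    by_cases hv : v ≤ w <;> simp [hv]
  simp_rw [h1]
  rw [lintegral_indicator measurableSet_Iic, Measure.restrict_restrict measurableSet_Iic]
  have h2 : Iic w ∩ Ioo 0 1 = Ioc 0 w := by
    ext v
    simp only [mem_inter_iff, mem_Iic, mem_Ioo, mem_Ioc]
    exact ⟨fun h => ⟨h.2.1, h.1⟩, fun h => ⟨h.2, h.1, h.2.trans_lt hw.2⟩⟩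
  rw [h2, ← ofReal_integral_eq_lintegral_ofReal, ← intervalIntegral.integral_of_le hw.1.le]
  · rw [intervalIntegral.integral_const_mul, integral_pow]
    congr 1
    field_simp
    simp
  · exact (Continuous.integrableOn_Icc (by fun_prop)).mono_set Ioc_subset_Icc_self
  · filter_upwards [self_mem_ae_restrict measurableSet_Ioc] with v hv
    have : 0 < v := hv.1
    simp only [Pi.zero_apply]
    positivity

namespace IsRegularEnv

variable {α : ℝ} {γ : ℕ+ → ℝ}

/-- A bound valid for all `r`, not only small ones, is what dominated convergence in
`tendsto_powerSum` requires. -/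
theorem exists_tailCount_le (hα : 0 < α) (h : IsRegularEnv α γ) :
    ∃ K, 0 ≤ K ∧ ∀ r, 0 < r → tailCount γ r ≤ ENNReal.ofReal (K * r ^ (-α)) := by
  obtain ⟨R, hR⟩ := h.bdd
  have h1 := h.lim.eventually_le_const one_lt_two
  obtain ⟨δ, hδ, hδ'⟩ := (mem_nhdsGT_iff_exists_Ioo_subset).1 h1
  rw [mem_Ioi] at hδ
  have hδ2 : 0 < δ / 2 := by positivity
  -- The `2` serves for `r < δ`, by the limit. For `δ ≤ r ≤ R` the count is at most its value at `δ
  -- / 2`, and `|R| ^ α * r ^ (-α) ≥ 1`. Above `R` the count vanishes.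
  refine ⟨2 + (tailCount γ (δ / 2)).toReal * |R| ^ α, by positivity, fun r hr => ?_⟩
  have hpos := Real.rpow_pos_of_pos hr (-α)
  rcases lt_or_ge r δ with hrδ | hrδ
  · have h2 : (tailCount γ r).toReal * r ^ α ≤ 2 := hδ' ⟨hr, hrδ⟩
    rw [← ENNReal.ofReal_toReal (h.fin r hr)]
    refine ENNReal.ofReal_le_ofReal ?_
    calc (tailCount γ r).toReal = ((tailCount γ r).toReal * r ^ α) * r ^ (-α) := by
          rw [mul_assoc, ← Real.rpow_add hr]; simp
      _ ≤ 2 * r ^ (-α) := by gcongr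
      _ ≤ _ := by
        gcongr
        have : 0 ≤ (tailCount γ (δ / 2)).toReal * |R| ^ α := by positivity
        linarith
  · rcases le_or_gt r R with hrR | hrR
    · have h3 : tailCount γ r ≤ tailCount γ (δ / 2) := by
        refine ENNReal.tsum_le_tsum fun i => ?_
        split_ifs with h4 h5
        · exact le_rfl
        · exact absurd (by linarith) h5
        · exact zero_le
        · exact le_rfl
      refine h3.trans ?_
      rw [← ENNReal.ofReal_toReal (h.fin _ hδ2)]
      refine ENNReal.ofReal_le_ofReal ?_
      have h4 : 1 ≤ |R| ^ α * r ^ (-α) := by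
        rw [Real.rpow_neg hr.le, ← div_eq_mul_inv, one_le_div (Real.rpow_pos_of_pos hr _)]
        exact Real.rpow_le_rpow hr.le (hrR.trans (le_abs_self R)) hα.le
      rw [ENNReal.toReal_ofReal ENNReal.toReal_nonneg]
      have h5 := mul_le_mul_of_nonneg_left h4
        (ENNReal.toReal_nonneg (a := tailCount γ (δ / 2)))
      nlinarith
    · have : tailCount γ r = 0 := by
        simp only [tailCount, ENNReal.tsum_eq_zero]
        intro i
        rw [if_neg]
        exact not_le.2 ((hR i).trans_lt hrR)
      rw [this]
      exact zero_le

/-- Layer-cake formula: `w ^ (m + 1)` is the integral of `(m + 1) v ^ m` over `v ≤ w`, and `v ≤ lγ /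
(1 + lγ)` means `γ ≥ v / ((1 - v) l)`. -/
theorem powerSum_eq_lintegral (hpos : ∀ i, 0 < γ i) (m : ℕ) {l : ℝ} (hl : 0 < l) :
    powerSum γ (m + 1) l = ∫⁻ v in Ioo (0 : ℝ) 1,
      ENNReal.ofReal ((m + 1 : ℝ) * v ^ m) * tailCount γ (v / ((1 - v) * l)) := by
  have h1 : ∀ x, ENNReal.ofReal ((l * γ x / (1 + l * γ x)) ^ (m + 1)) =
      ∫⁻ v in Ioo (0 : ℝ) 1, ENNReal.ofReal ((m + 1 : ℝ) * v ^ m) *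
        (if v / ((1 - v) * l) ≤ γ x then 1 else 0) := by
    intro x
    have hx : 0 < l * γ x := mul_pos hl (hpos x)
    have hw : l * γ x / (1 + l * γ x) ∈ Ioo (0 : ℝ) 1 :=
      ⟨by positivity, by rw [div_lt_one (by positivity)]; linarith⟩
    rw [← lintegral_pow_succ_mul_ite hw]
    refine setLIntegral_congr_fun measurableSet_Ioo fun v hv => ?_
    have hv1 : 0 < (1 - v) * l := mul_pos (by linarith [hv.2]) hl
    have : v ≤ l * γ x / (1 + l * γ x) ↔ v / ((1 - v) * l) ≤ γ x := by
      rw [le_div_iff₀ (by positivity), div_le_iff₀ hv1]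
      constructor <;> intro h <;> nlinarith
    simp only [this]
  rw [powerSum]
  simp_rw [h1]
  rw [← lintegral_tsum]
  · simp_rw [tailCount, ENNReal.tsum_mul_left]
  · intro x
    refine (Measurable.mul (by fun_prop) (Measurable.ite ?_ measurable_const
      measurable_const)).aemeasurable
    exact measurableSet_le (by fun_prop) measurable_const

/-- The integrand is that of `powerSum_eq_lintegral` with `tailCount γ r` replaced by `r ^ (-α)` and
the factor `l ^ α` removed. -/
theorem lintegral_limit (m : ℕ) (hα : 0 < α) (hα1 : α < 1) :
    ∫⁻ v in Ioo (0 : ℝ) 1, ENNReal.ofReal ((m + 1 : ℝ) * v ^ m) *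
      ENNReal.ofReal ((v / (1 - v)) ^ (-α)) =
      ENNReal.ofReal ((m + 1 : ℝ) * beta (m + 1 - α) (1 + α)) := by
  rw [ENNReal.ofReal_mul (by positivity),
    ← lintegral_Ioo_rpow_mul_one_sub_rpow (by linarith [m.cast_nonneg (α := ℝ)]) (by linarith),
    ← lintegral_const_mul' _ _ ENNReal.ofReal_ne_top]
  refine setLIntegral_congr_fun measurableSet_Ioo fun v hv => ?_
  have h0 : 0 < v := hv.1
  have h1 : 0 < 1 - v := by linarith [hv.2]
  rw [← ENNReal.ofReal_mul (by positivity), ← ENNReal.ofReal_mul (by positivity), mul_assoc]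
  congr 2
  rw [Real.div_rpow h0.le h1.le, Real.rpow_neg h1.le, div_inv_eq_mul, ← mul_assoc,
    ← Real.rpow_natCast, ← Real.rpow_add h0]
  congr 2 <;> ring

/-- The asymptotics `∑ₓ (l γₓ / (1 + l γₓ)) ^ m ∼ m B(m - α, 1 + α) l ^ α` as `l → ∞`. -/
theorem tendsto_powerSum (hα : 0 < α) (hα1 : α < 1) (h : IsRegularEnv α γ) (m : ℕ) :
    Tendsto (fun l : ℝ => ENNReal.ofReal (l ^ (-α)) * powerSum γ (m + 1) l) atTop
      (𝓝 (ENNReal.ofReal ((m + 1 : ℝ) * beta (m + 1 - α) (1 + α)))) := by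
  obtain ⟨K, hK, hKle⟩ := h.exists_tailCount_le hα
  rw [← lintegral_limit m hα hα1]
  have hr : ∀ v ∈ Ioo (0 : ℝ) 1, ∀ l : ℝ, 0 < l → 0 < v / ((1 - v) * l) := fun v hv l hl =>
    div_pos hv.1 (mul_pos (by linarith [hv.2]) hl)
  have hscale : ∀ v ∈ Ioo (0 : ℝ) 1, ∀ l : ℝ, 0 < l →
      l ^ (-α) * (v / ((1 - v) * l)) ^ (-α) = (v / (1 - v)) ^ (-α) := by
    intro v hv l hl
    rw [← Real.mul_rpow hl.le (hr v hv l hl).le]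
    congr 1
    have : 0 < 1 - v := by linarith [hv.2]
    field_simp
  have hcongr : (fun l : ℝ => ∫⁻ v in Ioo (0 : ℝ) 1, ENNReal.ofReal ((m + 1 : ℝ) * v ^ m) *
      (ENNReal.ofReal (l ^ (-α)) * tailCount γ (v / ((1 - v) * l)))) =ᶠ[atTop]
      fun l : ℝ => ENNReal.ofReal (l ^ (-α)) * powerSum γ (m + 1) l := by
    filter_upwards [eventually_gt_atTop 0] with l hl
    rw [powerSum_eq_lintegral h.pos m hl, ← lintegral_const_mul' _ _ ENNReal.ofReal_ne_top]
    refine lintegral_congr fun v => ?_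
    ring
  refine Tendsto.congr' hcongr ?_
  -- The bound of `exists_tailCount_le` scales exactly as the limit does, so `K` times the limiting
  -- integrand dominates for every `l > 0`.
  refine tendsto_lintegral_filter_of_dominated_convergence
    (fun v => ENNReal.ofReal K * (ENNReal.ofReal ((m + 1 : ℝ) * v ^ m) *
      ENNReal.ofReal ((v / (1 - v)) ^ (-α)))) ?_ ?_ ?_ ?_
  · exact Eventually.of_forall fun l => by fun_prop
  · filter_upwards [eventually_gt_atTop 0] with l hl
    filter_upwards [self_mem_ae_restrict measurableSet_Ioo] with v hv
    calc _ ≤ ENNReal.ofReal ((m + 1 : ℝ) * v ^ m) * (ENNReal.ofReal (l ^ (-α)) *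
          ENNReal.ofReal (K * (v / ((1 - v) * l)) ^ (-α))) := by
          gcongr
          exact hKle _ (hr v hv l hl)
      _ = _ := by
        rw [← hscale v hv l hl, ENNReal.ofReal_mul hK,
          ENNReal.ofReal_mul (p := l ^ (-α)) (by positivity)]
        ring
  · rw [lintegral_const_mul' _ _ ENNReal.ofReal_ne_top, lintegral_limit m hα hα1]
    exact ENNReal.mul_ne_top ENNReal.ofReal_ne_top ENNReal.ofReal_ne_top
  · filter_upwards [self_mem_ae_restrict measurableSet_Ioo] with v hv
    refine ENNReal.Tendsto.const_mul ?_ (Or.inr ENNReal.ofReal_ne_top)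
    have hv1 : 0 < 1 - v := by linarith [hv.2]
    have hto : Tendsto (fun l : ℝ => v / ((1 - v) * l)) atTop (𝓝[>] 0) := by
      refine tendsto_nhdsWithin_iff.2 ⟨?_, ?_⟩
      · exact Tendsto.div_atTop tendsto_const_nhds (tendsto_id.const_mul_atTop hv1)
      · filter_upwards [eventually_gt_atTop 0] with l hl
        exact hr v hv l hl
    have h2 := (h.lim.comp hto).mul_const ((v / (1 - v)) ^ (-α))
    rw [one_mul] at h2
    refine (ENNReal.tendsto_ofReal h2).congr' ?_
    filter_upwards [eventually_gt_atTop 0] with l hl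
    simp only [Function.comp]
    have hr' := hr v hv l hl
    rw [← ENNReal.ofReal_toReal (h.fin _ hr'), ← ENNReal.ofReal_mul (by positivity),
      ENNReal.toReal_ofReal ENNReal.toReal_nonneg, ← hscale v hv l hl]
    congr 1
    have : (v / ((1 - v) * l)) ^ α * (v / ((1 - v) * l)) ^ (-α) = 1 := by
      rw [← Real.rpow_add hr']; simp
    linear_combination ((tailCount γ (v / ((1 - v) * l))).toReal * l ^ (-α)) * this

theorem powerSum_ne_top (hα : 0 < α) (hα1 : α < 1) (h : IsRegularEnv α γ) (m : ℕ) {l : ℝ}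
    (hl : 0 < l) : powerSum γ (m + 1) l ≠ ∞ := by
  obtain ⟨K, hK, hKle⟩ := h.exists_tailCount_le hα
  rw [powerSum_eq_lintegral h.pos m hl]
  refine ne_top_of_le_ne_top (b := ENNReal.ofReal (K * l ^ α) *
    ∫⁻ v in Ioo (0 : ℝ) 1, ENNReal.ofReal ((m + 1 : ℝ) * v ^ m) *
      ENNReal.ofReal ((v / (1 - v)) ^ (-α))) ?_ ?_
  · rw [lintegral_limit m hα hα1]
    exact ENNReal.mul_ne_top ENNReal.ofReal_ne_top ENNReal.ofReal_ne_top
  · rw [← lintegral_const_mul' _ _ ENNReal.ofReal_ne_top]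
    refine setLIntegral_mono' measurableSet_Ioo fun v hv => ?_
    have hv1 : 0 < 1 - v := by linarith [hv.2]
    have hr : 0 < v / ((1 - v) * l) := div_pos hv.1 (mul_pos hv1 hl)
    calc _ ≤ ENNReal.ofReal ((m + 1 : ℝ) * v ^ m) *
          ENNReal.ofReal (K * (v / ((1 - v) * l)) ^ (-α)) := by
          gcongr
          exact hKle _ hr
      _ = _ := by
        have : K * (v / ((1 - v) * l)) ^ (-α) = (K * l ^ α) * (v / (1 - v)) ^ (-α) := by
          rw [mul_assoc, ← div_div, Real.div_rpow (div_pos hv.1 hv1).le hl.le,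
            Real.rpow_neg hl.le, div_inv_eq_mul]
          ring
        rw [this, ENNReal.ofReal_mul (p := K * l ^ α) (by positivity)]
        ring

/-- For weights bounded by `R`, `γ ≤ (1 + R) γ / (1 + γ)`, and the right side is summable as a power
sum at `l = 1`. -/
theorem tsum_ne_top (hα : 0 < α) (hα1 : α < 1) (h : IsRegularEnv α γ) :
    ∑' x, ENNReal.ofReal (γ x) ≠ ∞ := by
  obtain ⟨R, hR⟩ := h.bdd
  refine ne_top_of_le_ne_top (b := ENNReal.ofReal (1 + R) * powerSum γ 1 1) ?_ ?_
  · exact ENNReal.mul_ne_top ENNReal.ofReal_ne_top (h.powerSum_ne_top hα hα1 0 one_pos)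
  · rw [powerSum, ← ENNReal.tsum_mul_left]
    refine ENNReal.tsum_le_tsum fun x => ?_
    have hx := h.pos x
    have hxR := hR x
    rw [← ENNReal.ofReal_mul (by linarith)]
    refine ENNReal.ofReal_le_ofReal ?_
    rw [one_mul, pow_one, mul_div_assoc', le_div_iff₀ (by linarith)]
    nlinarith

end IsRegularEnv

/-! ### Sample paths: constancy and holding intervals -/

section Path

/-- The measure putting at every arrival time the corresponding holding time. -/
noncomputable def jumpMeasure (γ : ℕ+ → ℝ) (e τ : ℕ+ → ℕ → ℝ) : Measure ℝ :=
  Measure.sum fun k : ℕ+ × ℕ =>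
    ENNReal.ofReal (γ k.1 * τ k.1 k.2) • Measure.dirac (arrival e k.1 k.2)

variable {γ : ℕ+ → ℝ} {e τ : ℕ+ → ℕ → ℝ}

theorem jumpMeasure_apply {B : Set ℝ} (hB : MeasurableSet B) :
    jumpMeasure γ e τ B = ∑' k : ℕ+ × ℕ,
      B.indicator (fun _ => ENNReal.ofReal (γ k.1 * τ k.1 k.2)) (arrival e k.1 k.2) := by
  rw [jumpMeasure, Measure.sum_apply _ hB]
  refine tsum_congr fun k => ?_
  rw [Measure.smul_apply, Measure.dirac_apply' _ hB]
  by_cases h : arrival e k.1 k.2 ∈ B <;> simp [h]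

theorem clock_eq (s : ℝ) : clock γ e τ s = jumpMeasure γ e τ (Iic s) := by
  rw [jumpMeasure_apply measurableSet_Iic, clock, ← ENNReal.tsum_prod]
  rfl

/-- The value of the clock just before time `s`. -/
noncomputable def clockLeft (γ : ℕ+ → ℝ) (e τ : ℕ+ → ℕ → ℝ) (s : ℝ) : ℝ≥0∞ :=
  ∑' x : ℕ+, ∑' j : ℕ, if arrival e x j < s then ENNReal.ofReal (γ x * τ x j) else 0

theorem clockLeft_eq (s : ℝ) : clockLeft γ e τ s = jumpMeasure γ e τ (Iio s) := by
  rw [jumpMeasure_apply measurableSet_Iio, clockLeft, ← ENNReal.tsum_prod]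
  rfl

theorem monotone_clock : Monotone (clock γ e τ) := fun s t h => by
  rw [clock_eq, clock_eq]
  exact measure_mono (Iic_subset_Iic.2 h)

/-- Continuity from below of `jumpMeasure` along half-lines increasing to `Iio s`. -/
theorem leftLim_clock (s : ℝ) : Function.leftLim (clock γ e τ) s = clockLeft γ e τ s := by
  obtain ⟨u, hu, hus, hlim⟩ := exists_seq_strictMono_tendsto s
  have h1 : Tendsto u atTop (𝓝[<] s) :=
    tendsto_nhdsWithin_iff.2 ⟨hlim, Eventually.of_forall hus⟩
  have h2 := (monotone_clock (γ := γ) (e := e) (τ := τ)).tendsto_leftLim s |>.comp h1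
  have h3 : Tendsto (clock γ e τ ∘ u) atTop (𝓝 (jumpMeasure γ e τ (⋃ n, Iic (u n)))) := by
    have := tendsto_measure_iUnion_atTop (μ := jumpMeasure γ e τ) (s := fun n => Iic (u n))
      (fun n m hnm => Iic_subset_Iic.2 (hu.monotone hnm))
    refine this.congr fun n => ?_
    simp only [Function.comp, clock_eq]
  have h4 : ⋃ n, Iic (u n) = Iio s := by
    ext z
    simp only [mem_iUnion, mem_Iic, mem_Iio]
    constructor
    · rintro ⟨n, hn⟩
      exact hn.trans_lt (hus n)
    · intro hz
      obtain ⟨n, hn⟩ := (hlim.eventually_const_lt hz).exists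
      exact ⟨n, hn.le⟩
  rw [h4, ← clockLeft_eq] at h3
  exact tendsto_nhds_unique h2 h3

theorem clock_le_clockLeft {s t : ℝ} (h : s < t) : clock γ e τ s ≤ clockLeft γ e τ t := by
  rw [clock_eq, clockLeft_eq]
  exact measure_mono fun z hz => lt_of_le_of_lt hz h

theorem clockLeft_le_clock (s : ℝ) : clockLeft γ e τ s ≤ clock γ e τ s := by
  rw [clock_eq, clockLeft_eq]
  exact measure_mono Iio_subset_Iic_self

theorem isHolding_iff {t : ℝ} {x : ℕ+} {j : ℕ} :
    IsHolding γ e τ t x j ↔ clockLeft γ e τ (arrival e x j) ≤ ENNReal.ofReal t ∧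
      ENNReal.ofReal t < clock γ e τ (arrival e x j) := by
  rw [IsHolding, leftLim_clock]

/-- The properties of the driving family which hold almost surely and which are used to describe
the sets on which the path is constant. -/
structure IsGoodPath (γ : ℕ+ → ℝ) (e τ : ℕ+ → ℕ → ℝ) : Prop where
  inj : ∀ k l : ℕ+ × ℕ, arrival e k.1 k.2 = arrival e l.1 l.2 → k = l
  pos : ∀ x j, 0 < γ x * τ x j
  nonneg : ∀ x j, 0 ≤ arrival e x j
  dense : ∀ a b : ℝ, 0 ≤ a → a < b → ∃ y, a < arrival e y 0 ∧ arrival e y 0 < b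
  fin : ∀ s, clock γ e τ s ≠ ∞
  unbdd : ∀ t : ℝ, ∃ s, ENNReal.ofReal t < clock γ e τ s

namespace IsGoodPath

/-- No two events occur at the same time, so the jump of the clock at an event is exactly that
event's holding time. -/
theorem clock_arrival (h : IsGoodPath γ e τ) (k : ℕ+ × ℕ) :
    clock γ e τ (arrival e k.1 k.2) =
      clockLeft γ e τ (arrival e k.1 k.2) + ENNReal.ofReal (γ k.1 * τ k.1 k.2) := by
  rw [clock_eq, clockLeft_eq, ← Iio_union_right, measure_union _ (measurableSet_singleton _)]
  · congr 1
    rw [jumpMeasure_apply (measurableSet_singleton _), tsum_eq_single k]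
    · simp
    · intro l hl
      rw [indicator_of_notMem]
      exact fun h' => hl (h.inj _ _ h')
  · simp

theorem clockLeft_ne_top (h : IsGoodPath γ e τ) (s : ℝ) : clockLeft γ e τ s ≠ ∞ :=
  ne_top_of_le_ne_top (h.fin s) (clockLeft_le_clock s)

/-- Density of the events makes the clock strictly increasing: some first event falls strictly
between `s` and `t` and adds a positive amount. -/
theorem clock_lt_clockLeft (h : IsGoodPath γ e τ) {s t : ℝ} (hs : 0 ≤ s) (hst : s < t) :
    clock γ e τ s < clockLeft γ e τ t := by
  obtain ⟨y, hy1, hy2⟩ := h.dense s t hs hst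
  calc clock γ e τ s ≤ clockLeft γ e τ (arrival e y 0) := clock_le_clockLeft hy1
    _ < clock γ e τ (arrival e y 0) := by
      rw [h.clock_arrival (y, 0)]
      exact ENNReal.lt_add_right (h.clockLeft_ne_top _)
        (ENNReal.ofReal_pos.2 (h.pos y 0)).ne'
    _ ≤ clockLeft γ e τ t := clock_le_clockLeft hy2

theorem isHolding_unique (h : IsGoodPath γ e τ) {t : ℝ} {x y : ℕ+} {i j : ℕ} (hx : IsHolding γ e τ t x i)
    (hy : IsHolding γ e τ t y j) : (x, i) = (y, j) := by
  rw [isHolding_iff] at hx hy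
  rcases lt_trichotomy (arrival e x i) (arrival e y j) with hlt | heq | hgt
  · exact absurd (hx.2.trans_le ((clock_le_clockLeft hlt).trans hy.1)) (lt_irrefl _)
  · exact h.inj (x, i) (y, j) heq
  · exact absurd (hy.2.trans_le ((clock_le_clockLeft hgt).trans hx.1)) (lt_irrefl _)

theorem kPath_eq_coe_iff (h : IsGoodPath γ e τ) {t : ℝ} {x : ℕ+} :
    kPath γ e τ t = (x : OnePoint ℕ+) ↔ ∃ j, IsHolding γ e τ t x j := by
  constructor
  · intro hk
    by_cases hex : ∃ x : ℕ+, ∃ j : ℕ, IsHolding γ e τ t x j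
    · rw [kPath, dif_pos hex, OnePoint.coe_eq_coe] at hk
      rw [← hk]
      exact hex.choose_spec
    · rw [kPath, dif_neg hex] at hk
      exact absurd hk (OnePoint.infty_ne_coe x)
  · rintro ⟨j, hj⟩
    have hex : ∃ x : ℕ+, ∃ j : ℕ, IsHolding γ e τ t x j := ⟨x, j, hj⟩
    obtain ⟨i, hi⟩ := hex.choose_spec
    rw [kPath, dif_pos hex, OnePoint.coe_eq_coe]
    exact congrArg Prod.fst (h.isHolding_unique hi hj)

/-- This is where `c = 0` enters. The holding intervals of the events up to `s` are disjoint subsets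
of `[0, Γ(s))`, and their lengths add up to `Γ(s)`, so what they miss is null. -/
theorem ae_exists_isHolding (h : IsGoodPath γ e τ) :
    ∀ᵐ t : ℝ ∂(volume.restrict (Ici 0)), ∃ x j, IsHolding γ e τ t x j := by
  set G : ℕ+ × ℕ → ℝ := fun k => (clockLeft γ e τ (arrival e k.1 k.2)).toReal with hG
  set b : ℕ+ × ℕ → ℝ := fun k => (clock γ e τ (arrival e k.1 k.2)).toReal with hb
  have hbG : ∀ k, b k - G k = γ k.1 * τ k.1 k.2 := by
    intro k
    simp only [hb, hG]
    rw [h.clock_arrival k, ENNReal.toReal_add (h.clockLeft_ne_top _) ENNReal.ofReal_ne_top,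
      ENNReal.toReal_ofReal (h.pos _ _).le]
    ring
  have hmem : ∀ k t, t ∈ Ico (G k) (b k) → IsHolding γ e τ t k.1 k.2 := by
    intro k t ht
    have h0 : 0 ≤ t := ENNReal.toReal_nonneg.trans ht.1
    rw [isHolding_iff]
    exact ⟨ENNReal.le_ofReal_iff_toReal_le (h.clockLeft_ne_top _) h0 |>.2 ht.1,
      (ENNReal.ofReal_lt_iff_lt_toReal h0 (h.fin _)).2 ht.2⟩
  have hdisj : Pairwise (Function.onFun Disjoint fun k => Ico (G k) (b k)) := by
    intro k l hkl
    rw [Function.onFun, Set.disjoint_left]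
    intro t hk hl
    exact hkl (h.isHolding_unique (hmem k t hk) (hmem l t hl))
  have key : ∀ s, ∀ᵐ t : ℝ ∂volume, t ∈ Ico 0 (clock γ e τ s).toReal →
      ∃ x j, IsHolding γ e τ t x j := by
    intro s
    set U : Set ℝ := ⋃ k : {k : ℕ+ × ℕ // arrival e k.1 k.2 ≤ s}, Ico (G k) (b k) with hU
    have hUm : MeasurableSet U := MeasurableSet.iUnion fun _ => measurableSet_Ico
    have hUsub : U ⊆ Ico 0 (clock γ e τ s).toReal := by
      refine iUnion_subset fun k => Ico_subset_Ico ENNReal.toReal_nonneg ?_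
      exact ENNReal.toReal_mono (h.fin s) (monotone_clock k.2)
    have hUvol : volume U = clock γ e τ s := by
      have hdisj' : Pairwise (Function.onFun Disjoint
          fun k : {k : ℕ+ × ℕ // arrival e k.1 k.2 ≤ s} => Ico (G k) (b k)) :=
        fun k l hkl => hdisj (fun h' => hkl (Subtype.ext h'))
      rw [hU, measure_iUnion hdisj' fun _ => measurableSet_Ico, clock_eq, jumpMeasure_apply measurableSet_Iic]
      simp only [Real.volume_Ico, hbG]
      exact tsum_subtype {k : ℕ+ × ℕ | arrival e k.1 k.2 ≤ s}
        (fun k => ENNReal.ofReal (γ k.1 * τ k.1 k.2))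
    have hdiff : volume (Ico 0 (clock γ e τ s).toReal \ U) = 0 := by
      rw [measure_sdiff hUsub hUm.nullMeasurableSet (by rw [hUvol]; exact h.fin s), hUvol,
        Real.volume_Ico, sub_zero, ENNReal.ofReal_toReal (h.fin s), tsub_self]
    have hae := measure_eq_zero_iff_ae_notMem.1 hdiff
    filter_upwards [hae] with t ht hts
    by_contra hno
    refine ht ⟨hts, fun htU => ?_⟩
    obtain ⟨k, hk⟩ := mem_iUnion.1 htU
    exact hno ⟨_, _, hmem _ _ hk⟩
  choose s hs using fun n : ℕ => h.unbdd n
  rw [ae_restrict_iff' measurableSet_Ici]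
  filter_upwards [ae_all_iff.2 fun n => key (s n)] with t ht ht0
  obtain ⟨n, hn⟩ := exists_nat_gt t
  refine ht n ⟨ht0, hn.trans ?_⟩
  exact (ENNReal.ofReal_lt_iff_lt_toReal n.cast_nonneg (h.fin _)).1 (hs n)

/-- The path is constant on `[t, t + u]` iff this interval lies in a holding interval. -/
theorem kPath_const_iff (h : IsGoodPath γ e τ) {t u : ℝ} (ht : 0 ≤ t) (hu : 0 < u) :
    (∀ s ∈ Icc t (t + u), kPath γ e τ s = kPath γ e τ t) ↔
      ∃ k : ℕ+ × ℕ, clockLeft γ e τ (arrival e k.1 k.2) ≤ ENNReal.ofReal t ∧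
        ENNReal.ofReal (t + u) < clock γ e τ (arrival e k.1 k.2) := by
  constructor
  · intro hconst
    -- An interval of positive length meets some holding interval, so the constant value is a state
    -- and not `∞`.
    obtain ⟨s, hs, x, j₀, hj₀⟩ : ∃ s ∈ Icc t (t + u), ∃ x j, IsHolding γ e τ s x j := by
      by_contra hno
      push Not at hno
      have h1 : Icc t (t + u) ⊆ {s | ¬ (s ∈ Ici (0 : ℝ) → ∃ x j, IsHolding γ e τ s x j)} := by
        intro s hs h'
        obtain ⟨x, j, hxj⟩ := h' (ht.trans hs.1)
        exact hno s hs x j hxj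
      have h2 := measure_mono_null h1
        (ae_iff.1 ((ae_restrict_iff' measurableSet_Ici).1 h.ae_exists_isHolding))
      rw [Real.volume_Icc, ENNReal.ofReal_eq_zero] at h2
      linarith
    have hx : kPath γ e τ t = (x : OnePoint ℕ+) := by
      rw [← hconst s hs, h.kPath_eq_coe_iff]
      exact ⟨j₀, hj₀⟩
    obtain ⟨j, hj⟩ := h.kPath_eq_coe_iff.1 hx
    rw [isHolding_iff] at hj
    refine ⟨(x, j), hj.1, ?_⟩
    by_contra hle
    rw [not_lt] at hle
    -- Otherwise the right end `b` of the holding interval lies in `[t, t + u]`, and at `b` the path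
    -- is again at `x`, through an event `i`. An event not later than `j` has its interval finished
    -- by time `b`; a later one starts its interval strictly after `b`.
    set b := (clock γ e τ (arrival e x j)).toReal with hb
    have hbof : ENNReal.ofReal b = clock γ e τ (arrival e x j) := ENNReal.ofReal_toReal (h.fin _)
    have hbt : b ∈ Icc t (t + u) := by
      constructor
      · exact ((ENNReal.ofReal_lt_iff_lt_toReal ht (h.fin _)).1 hj.2).le
      · exact ENNReal.toReal_le_of_le_ofReal (by linarith) hle
    obtain ⟨i, hi⟩ := h.kPath_eq_coe_iff.1 ((hconst b hbt).trans hx)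
    rw [isHolding_iff, hbof] at hi
    rcases le_or_gt (arrival e x i) (arrival e x j) with hij | hij
    · exact absurd (hi.2.trans_le (monotone_clock hij)) (lt_irrefl _)
    · exact absurd (hi.1.trans_lt (h.clock_lt_clockLeft (h.nonneg _ _) hij)) (lt_irrefl _)
  · rintro ⟨⟨x, j⟩, h1, h2⟩
    have hH : ∀ s ∈ Icc t (t + u), kPath γ e τ s = (x : OnePoint ℕ+) := by
      intro s hs
      rw [h.kPath_eq_coe_iff]
      refine ⟨j, isHolding_iff.2 ⟨h1.trans (ENNReal.ofReal_le_ofReal hs.1), ?_⟩⟩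
      exact (ENNReal.ofReal_le_ofReal hs.2).trans_lt h2
    intro s hs
    rw [hH s hs, hH t ⟨le_rfl, by linarith⟩]

theorem unique_index (h : IsGoodPath γ e τ) {t u : ℝ} (hu : 0 ≤ u) {k l : ℕ+ × ℕ}
    (hk : clockLeft γ e τ (arrival e k.1 k.2) ≤ ENNReal.ofReal t ∧
        ENNReal.ofReal (t + u) < clock γ e τ (arrival e k.1 k.2))
    (hl : clockLeft γ e τ (arrival e l.1 l.2) ≤ ENNReal.ofReal t ∧
        ENNReal.ofReal (t + u) < clock γ e τ (arrival e l.1 l.2)) : k = l := by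
  have hle : ENNReal.ofReal t ≤ ENNReal.ofReal (t + u) :=
    ENNReal.ofReal_le_ofReal (by linarith)
  exact h.isHolding_unique (isHolding_iff.2 ⟨hk.1, hle.trans_lt hk.2⟩)
    (isHolding_iff.2 ⟨hl.1, hle.trans_lt hl.2⟩)

end IsGoodPath

end Path

/-! ### Independence of blocks of variables -/

section Blocks

theorem lintegral_comp_prodMk_of_indepFun {Ω β δ : Type*} [MeasurableSpace Ω]
    [MeasurableSpace β] [MeasurableSpace δ] {P : Measure Ω} [IsProbabilityMeasure P]
    {S : Ω → β} {V : Ω → δ} (hS : Measurable S) (hV : Measurable V) (hind : IndepFun S V P)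
    {f : β → δ → ℝ≥0∞} (hf : Measurable (Function.uncurry f)) :
    ∫⁻ ω, f (S ω) (V ω) ∂P = ∫⁻ ω, ∫⁻ ω', f (S ω) (V ω') ∂P ∂P := by
  have hmap := (indepFun_iff_map_prod_eq_prod_map_map hS.aemeasurable hV.aemeasurable).1 hind
  have := Measure.isProbabilityMeasure_map (μ := P) hV.aemeasurable
  calc ∫⁻ ω, f (S ω) (V ω) ∂P
      = ∫⁻ z, Function.uncurry f z ∂(P.map fun ω => (S ω, V ω)) := by
        rw [lintegral_map hf (hS.prodMk hV)]
        rfl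
    _ = ∫⁻ s, ∫⁻ v, f s v ∂(P.map V) ∂(P.map S) := by
        rw [hmap, lintegral_prod _ hf.aemeasurable]
        rfl
    _ = ∫⁻ ω, ∫⁻ v, f (S ω) v ∂(P.map V) ∂P := lintegral_map hf.lintegral_prod_right' hS
    _ = _ := lintegral_congr fun ω => lintegral_map hf.of_uncurry_left hV

/-- Independent variables can be integrated one after the other. -/
theorem lintegral_eq_lintegral_lintegral_of_indep {Ω β : Type*} [MeasurableSpace β]
    {m₁ m₂ mΩ : MeasurableSpace Ω} {P : Measure Ω} [IsProbabilityMeasure P]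
    (h₁ : m₁ ≤ mΩ) (h₂ : m₂ ≤ mΩ)
    (hind : Indep m₁ m₂ P) {S : Ω → β} (hS : Measurable[m₁] S) {f : β → Ω → ℝ≥0∞}
    (hf : @Measurable (β × Ω) _ (@Prod.instMeasurableSpace _ _ _ m₂) _ (Function.uncurry f)) :
    ∫⁻ ω, f (S ω) ω ∂P = ∫⁻ ω, ∫⁻ ω', f (S ω) ω' ∂P ∂P := by
  -- The second variable is the identity, viewed as a map into `Ω` equipped with `m₂`.
  refine @lintegral_comp_prodMk_of_indepFun Ω β Ω mΩ _ m₂ P _ S id (hS.mono h₁ le_rfl)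
    (measurable_id.mono h₂ le_rfl) ?_ f hf
  refine (@IndepFun_iff_Indep Ω β Ω mΩ _ m₂ S id P).2 ?_
  rw [MeasurableSpace.comap_id]
  exact indep_of_indep_of_le_left hind hS.comap_le

variable {Ω ι : Type*} {X : ι → Ω → ℝ}

/-- The σ-algebra generated by the variables `X i`, `i ∈ S`. -/
@[reducible] def blk (X : ι → Ω → ℝ) (S : Set ι) : MeasurableSpace Ω :=
  ⨆ i ∈ S, (inferInstance : MeasurableSpace ℝ).comap (X i)

theorem measurable_blk {S : Set ι} {i : ι} (hi : i ∈ S) : Measurable[blk X S] (X i) :=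
  (comap_measurable (X i)).mono
    (le_iSup₂ (f := fun i (_ : i ∈ S) => (inferInstance : MeasurableSpace ℝ).comap (X i)) i hi)
    le_rfl

theorem blk_mono {S T : Set ι} (hST : S ⊆ T) : blk X S ≤ blk X T :=
  iSup₂_le fun i hi =>
    le_iSup₂ (f := fun i (_ : i ∈ T) => (inferInstance : MeasurableSpace ℝ).comap (X i)) i (hST hi)

variable [mΩ : MeasurableSpace Ω] {P : Measure Ω}

theorem blk_le (hX : ∀ i, Measurable (X i)) (S : Set ι) : blk X S ≤ mΩ :=
  iSup₂_le fun i _ => (hX i).comap_le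

theorem indep_blk (hX : ∀ i, Measurable (X i)) (h : iIndepFun X P) {S T : Set ι}
    (hST : Disjoint S T) : Indep (blk X S) (blk X T) P :=
  indep_iSup_of_disjoint (fun i => (hX i).comap_le) h hST

theorem lintegral_mul_of_blk (hX : ∀ i, Measurable (X i)) (h : iIndepFun X P) {S T : Set ι}
    (hST : Disjoint S T) {f g : Ω → ℝ≥0∞} (hf : Measurable[blk X S] f)
    (hg : Measurable[blk X T] g) :
    ∫⁻ ω, f ω * g ω ∂P = (∫⁻ ω, f ω ∂P) * ∫⁻ ω, g ω ∂P :=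
  lintegral_mul_eq_lintegral_mul_lintegral_of_independent_measurableSpace (blk_le hX S)
    (blk_le hX T) (indep_blk hX h hST) hf hg

/-- Expectation of a finite product of variables measurable with respect to disjoint blocks. -/
theorem lintegral_prod_of_blk [IsProbabilityMeasure P] (hX : ∀ i, Measurable (X i))
    (h : iIndepFun X P) {κ : Type*} (A : Finset κ) {S : κ → Set ι}
    (hS : Pairwise (Function.onFun Disjoint S)) {f : κ → Ω → ℝ≥0∞}
    (hf : ∀ a, Measurable[blk X (S a)] (f a)) :
    ∫⁻ ω, ∏ a ∈ A, f a ω ∂P = ∏ a ∈ A, ∫⁻ ω, f a ω ∂P := by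
  classical
  induction A using Finset.induction_on with
  | empty => simp
  | insert a A ha ih =>
    simp only [Finset.prod_insert ha]
    rw [lintegral_mul_of_blk hX h (S := S a) (T := ⋃ b ∈ A, S b) ?_ (hf a) ?_, ih]
    · rw [disjoint_iUnion₂_right]
      intro b hb
      exact hS fun hab => ha (hab ▸ hb)
    · exact Finset.measurable_prod _ fun b hb =>
        (hf b).mono (blk_mono (subset_biUnion_of_mem (u := fun b => S b) hb)) le_rfl

/-- Second Borel-Cantelli lemma for independent variables. -/
theorem ae_frequently_mem_of_iIndepFun [IsProbabilityMeasure P] {Y : ℕ → Ω → ℝ}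
    (hY : ∀ i, Measurable (Y i)) (h : iIndepFun Y P) {A : Set ℝ} (hA : MeasurableSet A)
    {c : ℝ≥0∞} (hc : c ≠ 0) (hP : ∀ i, P (Y i ⁻¹' A) = c) :
    ∀ᵐ ω ∂P, ∃ᶠ n in atTop, Y n ω ∈ A := by
  have hm : ∀ n, MeasurableSet (Y n ⁻¹' A) := fun n => hY n hA
  have h1 := measure_limsup_eq_one (μ := P) (s := fun n => Y n ⁻¹' A) hm
    ((iIndepSet_iff_meas_biInter hm).2 fun s =>
      h.measure_inter_preimage_eq_mul s fun _ _ => hA)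
    (by simp only [hP]; exact ENNReal.tsum_const_eq_top_of_ne_zero hc)
  have h2 := (prob_compl_eq_zero_iff (MeasurableSet.measurableSet_limsup hm)).2 h1
  filter_upwards [compl_mem_ae_iff.2 h2] with ω hω
  rw [compl_compl, mem_limsup_iff_frequently_mem] at hω
  exact hω

end Blocks

/-! ### Exponential variables -/

section Exponential

variable {Ω : Type*} [MeasurableSpace Ω] {P : Measure Ω} {Y : Ω → ℝ}

theorem lintegral_comp_of_hasLaw_exp (hY : HasLaw Y (expMeasure 1) P) {f : ℝ → ℝ≥0∞}
    (hf : Measurable f) :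
    ∫⁻ ω, f (Y ω) ∂P = ∫⁻ r in Ioi (0 : ℝ), ENNReal.ofReal (Real.exp (-r)) * f r := by
  have hm : Measurable (gammaPDF 1 1) := (measurable_gammaPDFReal 1 1).ennreal_ofReal
  rw [hY.lintegral_comp hf.aemeasurable, expMeasure, gammaMeasure,
    lintegral_withDensity_eq_lintegral_mul _ hm hf, ← lintegral_indicator measurableSet_Ioi]
  have h0 : ∀ᵐ r : ℝ, r ≠ 0 := by simp [ae_iff]
  refine lintegral_congr_ae ?_
  filter_upwards [h0] with r hr
  rcases lt_or_gt_of_ne hr with hr | hr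
  · simp [gammaPDF_of_neg hr, hr.le]
  · have h2 := exponentialPDF_of_nonneg (r := 1) hr.le
    simp only [exponentialPDF, exponentialPDFReal, one_mul] at h2
    rw [indicator_of_mem (by exact hr), Pi.mul_apply, gammaPDF, h2]

theorem map_apply_of_hasLaw_exp (hY : HasLaw Y (expMeasure 1) P) {A : Set ℝ}
    (hA : MeasurableSet A) :
    P.map Y A = ∫⁻ r in A ∩ Ioi 0, ENNReal.ofReal (Real.exp (-r)) := by
  have hi : Measurable (A.indicator (1 : ℝ → ℝ≥0∞)) := measurable_one.indicator hA
  rw [← lintegral_indicator_one hA, lintegral_map' hi.aemeasurable hY.aemeasurable,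
    lintegral_comp_of_hasLaw_exp hY hi, ← Measure.restrict_restrict hA,
    ← lintegral_indicator hA]
  refine lintegral_congr fun r => ?_
  by_cases hr : r ∈ A <;> simp [hr]

theorem ae_pos_of_hasLaw_exp (hY : HasLaw Y (expMeasure 1) P) : ∀ᵐ ω ∂P, 0 < Y ω := by
  refine ae_of_ae_map hY.aemeasurable (p := fun r => 0 < r) ?_
  have h := map_apply_of_hasLaw_exp hY (measurableSet_Iic (a := 0))
  rw [Iic_inter_Ioi, Ioc_self, Measure.restrict_empty, lintegral_zero_measure] at h
  filter_upwards [measure_eq_zero_iff_ae_notMem.1 h] with r hr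
  exact not_le.1 hr

theorem lintegral_exp_neg_mul {b : ℝ} (hb : 0 < b) :
    ∫⁻ r in Ioi (0 : ℝ), ENNReal.ofReal (Real.exp (-(b * r))) = ENNReal.ofReal (1 / b) := by
  have h1 : IntegrableOn (fun r : ℝ => Real.exp (-(b * r))) (Ioi 0) := by
    simpa [neg_mul] using exp_neg_integrableOn_Ioi 0 hb
  rw [← ofReal_integral_eq_lintegral_ofReal h1 (ae_of_all _ fun r => (Real.exp_pos _).le)]
  congr 1
  have := integral_exp_neg_mul_rpow (p := 1) (b := b) one_pos hb
  simp only [Real.rpow_one, neg_mul] at this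
  rw [this]
  norm_num [Real.rpow_neg_one]

theorem lintegral_exp_neg_of_hasLaw_exp (hY : HasLaw Y (expMeasure 1) P) {a : ℝ} (ha : 0 ≤ a) :
    ∫⁻ ω, ENNReal.ofReal (Real.exp (-(a * Y ω))) ∂P = ENNReal.ofReal (1 / (1 + a)) := by
  rw [lintegral_comp_of_hasLaw_exp hY (f := fun r => ENNReal.ofReal (Real.exp (-(a * r))))
    (by fun_prop), ← lintegral_exp_neg_mul (by linarith : 0 < 1 + a)]
  refine lintegral_congr fun r => ?_
  rw [← ENNReal.ofReal_mul (Real.exp_pos _).le, ← Real.exp_add]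
  ring_nf

theorem lintegral_ofReal_of_hasLaw_exp (hY : HasLaw Y (expMeasure 1) P) :
    ∫⁻ ω, ENNReal.ofReal (Y ω) ∂P = 1 := by
  rw [lintegral_comp_of_hasLaw_exp hY (f := fun r => ENNReal.ofReal r) (by fun_prop)]
  have h1 : ∫⁻ r in Ioi (0 : ℝ), ENNReal.ofReal (Real.exp (-r)) * ENNReal.ofReal r =
      ∫⁻ r in Ioi (0 : ℝ), ENNReal.ofReal (Real.exp (-r) * r ^ ((2 : ℝ) - 1)) := by
    refine lintegral_congr fun r => ?_
    rw [← ENNReal.ofReal_mul (Real.exp_pos _).le]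
    norm_num
  rw [h1, ← ofReal_integral_eq_lintegral_ofReal (Real.GammaIntegral_convergent two_pos),
    ← Real.Gamma_eq_integral two_pos, Real.Gamma_two, ENNReal.ofReal_one]
  filter_upwards [self_mem_ae_restrict measurableSet_Ioi] with r (hr : 0 < r)
  simp only [Pi.zero_apply]
  positivity

theorem measure_Ioo_of_hasLaw_exp (hY : HasLaw Y (expMeasure 1) P) (hm : Measurable Y) {a b : ℝ}
    (ha : 0 ≤ a) : P (Y ⁻¹' Ioo a b) =
      ∫⁻ r in Ioo a b, ENNReal.ofReal (Real.exp (-r)) := by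
  rw [← Measure.map_apply hm measurableSet_Ioo, map_apply_of_hasLaw_exp hY measurableSet_Ioo]
  have : Ioo a b ∩ Ioi 0 = Ioo a b := inter_eq_left.2 fun r hr => lt_of_le_of_lt ha hr.1
  rw [this]

theorem measure_Ioo_pos_of_hasLaw_exp (hY : HasLaw Y (expMeasure 1) P) (hm : Measurable Y)
    {a b : ℝ} (ha : 0 ≤ a) (hab : a < b) : P (Y ⁻¹' Ioo a b) ≠ 0 := by
  rw [measure_Ioo_of_hasLaw_exp hY hm ha]
  refine (setLIntegral_pos_iff (by fun_prop)).2 ?_ |>.ne'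
  have : Function.support (fun r : ℝ => ENNReal.ofReal (Real.exp (-r))) = univ := by
    ext r
    simp [Real.exp_pos]
  rw [this, univ_inter, Real.volume_Ioo]
  simpa using hab

theorem measure_Ioi_of_hasLaw_exp (hY : HasLaw Y (expMeasure 1) P) (hm : Measurable Y) {s : ℝ}
    (hs : 0 ≤ s) : P {ω | s < Y ω} = ENNReal.ofReal (Real.exp (-s)) := by
  have h0 : P {ω | s < Y ω} = P.map Y (Ioi s) := (Measure.map_apply hm measurableSet_Ioi).symm
  have h2 : Ioi s ∩ Ioi 0 = Ioi s := inter_eq_left.2 fun r hr => lt_of_le_of_lt hs hr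
  rw [h0, map_apply_of_hasLaw_exp hY measurableSet_Ioi, h2]
  have h1 : IntegrableOn (fun r : ℝ => Real.exp (-r)) (Ioi s) := by
    simpa using exp_neg_integrableOn_Ioi s one_pos
  rw [← ofReal_integral_eq_lintegral_ofReal h1 (ae_of_all _ fun r => (Real.exp_pos _).le),
    integral_exp_neg_Ioi]

theorem measure_eq_of_hasLaw_exp (hY : HasLaw Y (expMeasure 1) P) (hm : Measurable Y) (s : ℝ) :
    P {ω | Y ω = s} = 0 := by
  have h0 : P {ω | Y ω = s} = P.map Y {s} :=
    (Measure.map_apply hm (measurableSet_singleton s)).symm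
  rw [h0, map_apply_of_hasLaw_exp hY (measurableSet_singleton s)]
  exact setLIntegral_measure_zero _ _ (measure_mono_null inter_subset_left (by simp))

end Exponential

/-! ### Sums of independent exponential variables -/

section Renewal

variable {Ω : Type*} [MeasurableSpace Ω] {P : Measure Ω} [IsProbabilityMeasure P]
  {Y : ℕ → Ω → ℝ}

/-- The induction step for the Erlang distribution function: its convolution with the exponential
density, with the factor `exp (-r)` already multiplied in. -/
theorem integral_poisson_step (m : ℕ) (s : ℝ) :
    ∫ r in (0 : ℝ)..s, (Real.exp (-r) - Real.exp (-s) *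
      ∑ i ∈ Finset.range (m + 1), (s - r) ^ i / i.factorial) =
      1 - Real.exp (-s) * ∑ i ∈ Finset.range (m + 2), s ^ i / i.factorial := by
  have hderiv : ∀ r ∈ uIcc 0 s, HasDerivAt (fun r : ℝ => -Real.exp (-r) + Real.exp (-s) *
      ∑ i ∈ Finset.range (m + 1), (s - r) ^ (i + 1) / (i + 1).factorial)
      (Real.exp (-r) - Real.exp (-s) *
        ∑ i ∈ Finset.range (m + 1), (s - r) ^ i / i.factorial) r := by
    intro r _
    have h1 : HasDerivAt (fun r : ℝ => -Real.exp (-r)) (Real.exp (-r)) r := by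
      exact ((hasDerivAt_neg r).exp).neg.congr_deriv (by simp)
    have h2 : ∀ i ∈ Finset.range (m + 1), HasDerivAt
        (fun r : ℝ => (s - r) ^ (i + 1) / (i + 1).factorial) (-((s - r) ^ i / i.factorial)) r := by
      intro i _
      have := ((((hasDerivAt_id r).const_sub s).pow (i + 1)).div_const ((i + 1).factorial : ℝ))
      simp only [id, Nat.add_sub_cancel] at this
      refine this.congr_deriv ?_
      rw [Nat.factorial_succ]
      push_cast
      have : ((i : ℝ) + 1) ≠ 0 := by positivity
      field_simp
    have h3 := (HasDerivAt.fun_sum h2).const_mul (Real.exp (-s))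
    refine (h1.add h3).congr_deriv ?_
    rw [Finset.sum_neg_distrib]
    ring
  rw [intervalIntegral.integral_eq_sub_of_hasDerivAt hderiv
    (Continuous.intervalIntegrable (by fun_prop) _ _)]
  simp only [sub_self, sub_zero, neg_zero, Real.exp_zero]
  rw [Finset.sum_range_succ' (fun i => s ^ i / (i.factorial : ℝ)) (m + 1)]
  simp
  ring

theorem ae_sum_range_pos {P : Measure Ω} (hlaw : ∀ i, HasLaw (Y i) (expMeasure 1) P) (m : ℕ) :
    ∀ᵐ ω ∂P, 0 < ∑ i ∈ Finset.range (m + 1), Y i ω := by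
  filter_upwards [ae_all_iff.2 fun i => ae_pos_of_hasLaw_exp (hlaw i)] with ω hω
  exact Finset.sum_pos (fun i _ => hω i) (by simp)

theorem one_sub_exp_mul_sum_nonneg (m : ℕ) {s : ℝ} (hs : 0 ≤ s) :
    0 ≤ 1 - Real.exp (-s) * ∑ i ∈ Finset.range m, s ^ i / i.factorial := by
  have h1 := Real.sum_le_exp_of_nonneg hs m
  have h2 : Real.exp (-s) * Real.exp s = 1 := by rw [← Real.exp_add]; simp
  have h3 := mul_le_mul_of_nonneg_left h1 (Real.exp_pos (-s)).le
  linarith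

/-- The distribution function of the sum of `m + 1` independent exponential variables. -/
theorem measure_sum_range_lt (hY : ∀ i, Measurable (Y i)) (hind : iIndepFun Y P)
    (hlaw : ∀ i, HasLaw (Y i) (expMeasure 1) P) (m : ℕ) {s : ℝ} (hs : 0 < s) :
    P {ω | ∑ i ∈ Finset.range (m + 1), Y i ω < s} =
      ENNReal.ofReal (1 - Real.exp (-s) * ∑ i ∈ Finset.range (m + 1), s ^ i / i.factorial) := by
  induction m generalizing s with
  | zero =>
    have h1 : {ω | ∑ i ∈ Finset.range (0 + 1), Y i ω < s} =ᵐ[P] Y 0 ⁻¹' Ioo 0 s := by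
      refine eventuallyEq_set.2 ?_
      filter_upwards [ae_pos_of_hasLaw_exp (hlaw 0)] with ω hω
      simp [hω]
    rw [measure_congr h1, measure_Ioo_of_hasLaw_exp (hlaw 0) (hY 0) le_rfl,
      ← ofReal_integral_eq_lintegral_ofReal, ← integral_Ioc_eq_integral_Ioo,
      ← intervalIntegral.integral_of_le hs.le]
    · congr 1
      have := integral_poisson_step 0 s
      simp
    · exact (Continuous.integrableOn_Icc (by fun_prop)).mono_set Ioo_subset_Icc_self
    · exact ae_of_all _ fun r => (Real.exp_pos _).le
  | succ m ih =>
    have hmS : Measurable[blk Y {i | i ≤ m}] fun ω => ∑ i ∈ Finset.range (m + 1), Y i ω :=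
      Finset.measurable_sum _ fun i hi =>
        measurable_blk (by simpa [Nat.lt_succ_iff] using hi)
    have hmV : Measurable[blk Y {m + 1}] (Y (m + 1)) := measurable_blk rfl
    have hindep : IndepFun (Y (m + 1)) (fun ω => ∑ i ∈ Finset.range (m + 1), Y i ω) P := by
      rw [IndepFun_iff_Indep]
      exact indep_of_indep_of_le_left (indep_of_indep_of_le_right
        (indep_blk hY hind (S := {m + 1}) (T := {i | i ≤ m}) (by simp)) hmS.comap_le) hmV.comap_le
    have hS : Measurable fun ω => ∑ i ∈ Finset.range (m + 1), Y i ω := by fun_prop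
    have hf : Measurable (Function.uncurry fun r z : ℝ => if z + r < s then (1 : ℝ≥0∞) else 0) :=
      Measurable.ite (measurableSet_lt (by fun_prop) measurable_const) measurable_const
        measurable_const
    have h1 := lintegral_comp_prodMk_of_indepFun (hY (m + 1)) hS hindep hf
    -- With the last summand frozen at `r`, the other `m + 1` must sum to less than `s - r`.
    have h2 : ∀ r : ℝ, ∫⁻ ω', (if ∑ i ∈ Finset.range (m + 1), Y i ω' + r < s
        then (1 : ℝ≥0∞) else 0) ∂P = P {ω | ∑ i ∈ Finset.range (m + 1), Y i ω < s - r} := by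
      intro r
      rw [← lintegral_indicator_one (measurableSet_lt hS measurable_const)]
      refine lintegral_congr fun ω => ?_
      simp [indicator_apply, lt_sub_iff_add_lt]
    have h3 : P {ω | ∑ i ∈ Finset.range (m + 1 + 1), Y i ω < s} =
        ∫⁻ ω, (if ∑ i ∈ Finset.range (m + 1), Y i ω + Y (m + 1) ω < s
          then (1 : ℝ≥0∞) else 0) ∂P := by
      rw [← lintegral_indicator_one (measurableSet_lt (by fun_prop) measurable_const)]
      refine lintegral_congr fun ω => ?_
      simp only [indicator_apply, mem_ofPred_eq, Finset.sum_range_succ _ (m + 1), Pi.one_apply]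
    rw [h3, h1]
    simp_rw [h2]
    have hmeas : Measurable fun r : ℝ => P {ω | ∑ i ∈ Finset.range (m + 1), Y i ω < s - r} := by
      simp_rw [← h2]
      exact hf.comp (measurable_fst.prodMk (hS.comp measurable_snd)) |>.lintegral_prod_right'
    rw [lintegral_comp_of_hasLaw_exp (hlaw (m + 1)) hmeas, ← integral_poisson_step m s,
      intervalIntegral.integral_of_le hs.le, integral_Ioc_eq_integral_Ioo,
      ofReal_integral_eq_lintegral_ofReal]
    · have hsplit : Ioi (0 : ℝ) = Ioo 0 s ∪ Ici s := by
        rw [Ioo_union_Ici_eq_Ioi hs]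
      rw [hsplit, lintegral_union measurableSet_Ici
        (disjoint_left.2 fun r hr hr' => absurd hr.2 (not_lt.2 hr'))]
      -- A value `r ≥ s` contributes nothing, because the remaining sum is almost surely positive.
      have hz : ∫⁻ r in Ici s, ENNReal.ofReal (Real.exp (-r)) *
          P {ω | ∑ i ∈ Finset.range (m + 1), Y i ω < s - r} = 0 := by
        rw [setLIntegral_congr_fun measurableSet_Ici (g := fun _ => 0)]
        · simp
        · intro r hr
          simp only [mul_eq_zero]
          right
          refine measure_eq_zero_iff_ae_notMem.2 ?_
          filter_upwards [ae_sum_range_pos hlaw m] with ω hω h'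
          have : s ≤ r := hr
          have h'' : ∑ i ∈ Finset.range (m + 1), Y i ω < s - r := h'
          linarith
      rw [hz, add_zero]
      refine setLIntegral_congr_fun measurableSet_Ioo fun r hr => ?_
      rw [ih (by linarith [hr.2] : 0 < s - r), ← ENNReal.ofReal_mul (Real.exp_pos _).le]
      congr 1
      rw [mul_sub, ← mul_assoc, ← Real.exp_add]
      ring_nf
    · exact (Continuous.integrableOn_Icc (by fun_prop)).mono_set Ioo_subset_Icc_self
    · filter_upwards [self_mem_ae_restrict measurableSet_Ioo] with r hr
      have h5 := mul_nonneg (Real.exp_pos (-r)).le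
        (one_sub_exp_mul_sum_nonneg (m + 1) (by linarith [hr.2] : 0 ≤ s - r))
      rw [mul_sub, ← mul_assoc, ← Real.exp_add] at h5
      ring_nf at h5 ⊢
      exact h5

theorem lintegral_exp_neg_sum_range (hY : ∀ i, Measurable (Y i)) (hind : iIndepFun Y P)
    (hlaw : ∀ i, HasLaw (Y i) (expMeasure 1) P) (m : ℕ) {a : ℝ} (ha : 0 ≤ a) :
    ∫⁻ ω, ENNReal.ofReal (Real.exp (-(a * ∑ i ∈ Finset.range m, Y i ω))) ∂P =
      ENNReal.ofReal (1 / (1 + a)) ^ m := by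
  have h1 : ∀ ω, ENNReal.ofReal (Real.exp (-(a * ∑ i ∈ Finset.range m, Y i ω))) =
      ∏ i ∈ Finset.range m, ENNReal.ofReal (Real.exp (-(a * Y i ω))) := by
    intro ω
    rw [← ENNReal.ofReal_prod_of_nonneg fun i _ => (Real.exp_pos _).le, ← Real.exp_sum,
      Finset.mul_sum, Finset.sum_neg_distrib]
  simp_rw [h1]
  rw [lintegral_prod_of_blk hY hind _ (S := fun i => {i})]
  · simp [lintegral_exp_neg_of_hasLaw_exp (hlaw _) ha]
  · intro i j hij
    simpa [Function.onFun] using hij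
  · intro i
    have := measurable_blk (X := Y) (S := {i}) (i := i) rfl
    exact (Measurable.ennreal_ofReal (Real.measurable_exp.comp (this.const_mul a).neg))

end Renewal

/-! ### Laplace transform of the time spent in one state -/

/-- The function `z ↦ exp (-l z)` on `[0, ∞)`. -/
noncomputable def expNeg (l : ℝ) (z : ℝ≥0∞) : ℝ≥0∞ := ENNReal.ofReal (Real.exp (-(l * z.toReal)))

@[fun_prop]
theorem measurable_expNeg (l : ℝ) : Measurable (expNeg l) := by
  unfold expNeg; fun_prop

theorem expNeg_le_one {l : ℝ} (hl : 0 ≤ l) (z : ℝ≥0∞) : expNeg l z ≤ 1 := by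
  rw [expNeg, ← ENNReal.ofReal_one]
  refine ENNReal.ofReal_le_ofReal (Real.exp_le_one_iff.2 ?_)
  have : 0 ≤ l * z.toReal := mul_nonneg hl ENNReal.toReal_nonneg
  linarith

/-- Finiteness is essential: `toReal` sends `∞` to `0`, so `expNeg l ∞` is `1` and not `0`. -/
theorem expNeg_add (l : ℝ) {z w : ℝ≥0∞} (hz : z ≠ ∞) (hw : w ≠ ∞) :
    expNeg l (z + w) = expNeg l z * expNeg l w := by
  rw [expNeg, expNeg, expNeg, ENNReal.toReal_add hz hw, ← ENNReal.ofReal_mul (Real.exp_pos _).le,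
    ← Real.exp_add]
  ring_nf

theorem expNeg_sum (l : ℝ) {κ : Type*} (A : Finset κ) {z : κ → ℝ≥0∞} (hz : ∀ k, z k ≠ ∞) :
    expNeg l (∑ k ∈ A, z k) = ∏ k ∈ A, expNeg l (z k) := by
  classical
  induction A using Finset.induction_on with
  | empty => simp [expNeg]
  | insert a A ha ih =>
    rw [Finset.sum_insert ha, Finset.prod_insert ha, expNeg_add l (hz a)
      (ENNReal.sum_ne_top.2 fun k _ => hz k), ih]

theorem tendsto_expNeg_sum (l : ℝ) {κ : Type*} {z : κ → ℝ≥0∞} (hz : ∑' k, z k ≠ ∞) :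
    Tendsto (fun A : Finset κ => expNeg l (∑ k ∈ A, z k)) atTop (𝓝 (expNeg l (∑' k, z k))) := by
  have h1 := (ENNReal.tendsto_toReal hz).comp (ENNReal.summable (f := z)).hasSum
  exact ENNReal.tendsto_ofReal ((Real.continuous_exp.tendsto _).comp (h1.const_mul l).neg)

/-- The time spent in a state of weight `g` by the events strictly before `s`. -/
noncomputable def stateClock (g : ℝ) (y z : ℕ → ℝ) (s : ℝ) : ℝ≥0∞ :=
  ∑' j : ℕ, if ∑ i ∈ Finset.range (j + 1), y i < s then ENNReal.ofReal (g * z j) else 0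

theorem clockLeft_eq_tsum_stateClock (γ : ℕ+ → ℝ) (e τ : ℕ+ → ℕ → ℝ) (s : ℝ) :
    clockLeft γ e τ s = ∑' x, stateClock (γ x) (e x) (τ x) s := rfl

/-- There are exactly `m` events strictly before `s`. -/
def HasCount (y : ℕ → ℝ) (s : ℝ) (m : ℕ) : Prop :=
  (∀ j < m, ∑ i ∈ Finset.range (j + 1), y i < s) ∧ s ≤ ∑ i ∈ Finset.range (m + 1), y i

theorem sum_range_strictMono {y : ℕ → ℝ} (hy : ∀ i, 0 < y i) :
    StrictMono fun m => ∑ i ∈ Finset.range m, y i :=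
  strictMono_nat_of_lt_succ fun m => by simp [Finset.sum_range_succ, hy m]

theorem HasCount.unique {y : ℕ → ℝ} {s : ℝ} {m n : ℕ} (hm : HasCount y s m) (hn : HasCount y s n) :
    m = n := by
  rcases lt_trichotomy m n with h | h | h
  · exact absurd (hn.1 m h) (not_lt.2 hm.2)
  · exact h
  · exact absurd (hm.1 n h) (not_lt.2 hn.2)

theorem HasCount.stateClock_eq {y : ℕ → ℝ} (hy : ∀ i, 0 < y i) {s : ℝ} {m : ℕ}
    (hm : HasCount y s m) (g : ℝ) (z : ℕ → ℝ) :
    stateClock g y z s = ∑ j ∈ Finset.range m, ENNReal.ofReal (g * z j) := by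
  rw [stateClock, tsum_eq_sum (s := Finset.range m)]
  · refine Finset.sum_congr rfl fun j hj => ?_
    rw [if_pos (hm.1 j (Finset.mem_range.1 hj))]
  · intro j hj
    rw [if_neg]
    rw [not_lt]
    refine hm.2.trans ((sum_range_strictMono hy).monotone ?_)
    simpa using hj

/-- Events are numbered from `0`, so exactly `m` of them precede event number `m`. -/
theorem hasCount_sum_range {y : ℕ → ℝ} (hy : ∀ i, 0 < y i) (m : ℕ) :
    HasCount y (∑ i ∈ Finset.range (m + 1), y i) m :=
  ⟨fun j hj => sum_range_strictMono hy (by omega), le_rfl⟩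

theorem exists_hasCount {y : ℕ → ℝ} {s : ℝ} (h : ∃ m, s ≤ ∑ i ∈ Finset.range (m + 1), y i) :
    ∃ m, HasCount y s m := by
  classical
  exact ⟨Nat.find h, fun j hj => not_le.1 (Nat.find_min h hj), Nat.find_spec h⟩

/-- Infinitely many terms exceed `1`, so the series of positive terms cannot converge. -/
theorem tendsto_sum_range_of_frequently {y : ℕ → ℝ} (hy : ∀ i, 0 < y i)
    (hf : ∃ᶠ n in atTop, y n ∈ Ioo (1 : ℝ) 2) :
    Tendsto (fun m => ∑ i ∈ Finset.range m, y i) atTop atTop := by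
  rw [← not_summable_iff_tendsto_nat_atTop_of_nonneg fun i => (hy i).le]
  intro hs
  obtain ⟨n, hn1, hn2⟩ :=
    (hf.and_eventually (hs.tendsto_atTop_zero.eventually_lt_const one_pos)).exists
  exact absurd hn1.1 hn2.le.not_gt

theorem measurableSet_hasCount {Ω : Type*} {m0 : MeasurableSpace Ω} {Y : ℕ → Ω → ℝ}
    (hY : ∀ i, Measurable[m0] (Y i)) (s : ℝ) (m : ℕ) :
    MeasurableSet[m0] {ω | HasCount (fun i => Y i ω) s m} := by
  have h1 : ∀ k, Measurable[m0] fun ω => ∑ i ∈ Finset.range k, Y i ω :=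
    fun k => Finset.measurable_sum _ fun i _ => hY i
  have : {ω | HasCount (fun i => Y i ω) s m} =
      (⋂ j, ⋂ (_ : j < m), {ω | ∑ i ∈ Finset.range (j + 1), Y i ω < s}) ∩
        {ω | s ≤ ∑ i ∈ Finset.range (m + 1), Y i ω} := by
    ext ω
    simp [HasCount]
  rw [this]
  exact (MeasurableSet.iInter fun j => MeasurableSet.iInter fun _ =>
    (h1 _) measurableSet_Iio).inter ((h1 _) measurableSet_Ici)

theorem measurable_indicator_one {Ω : Type*} {m0 : MeasurableSpace Ω} {A : Set Ω}
    (hA : MeasurableSet[m0] A) : Measurable[m0] (A.indicator (1 : Ω → ℝ≥0∞)) :=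
  measurable_one.indicator hA

section StateClock

variable {Ω : Type*} [MeasurableSpace Ω] {P : Measure Ω} [IsProbabilityMeasure P]
  {Y Z : ℕ → Ω → ℝ}

theorem ae_tendsto_sum_range (hY : ∀ i, Measurable (Y i)) (hind : iIndepFun Y P)
    (hlaw : ∀ i, HasLaw (Y i) (expMeasure 1) P) :
    ∀ᵐ ω ∂P, Tendsto (fun m => ∑ i ∈ Finset.range m, Y i ω) atTop atTop := by
  have h1 : ∀ i, P (Y i ⁻¹' Ioo 1 2) = P (Y 0 ⁻¹' Ioo 1 2) := fun i => by
    rw [measure_Ioo_of_hasLaw_exp (hlaw i) (hY i) zero_le_one,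
      measure_Ioo_of_hasLaw_exp (hlaw 0) (hY 0) zero_le_one]
  filter_upwards [ae_all_iff.2 fun i => ae_pos_of_hasLaw_exp (hlaw i),
    ae_frequently_mem_of_iIndepFun hY hind measurableSet_Ioo
      (measure_Ioo_pos_of_hasLaw_exp (hlaw 0) (hY 0) zero_le_one one_lt_two) h1] with ω h2 h3
  exact tendsto_sum_range_of_frequently h2 h3

/-- The Poisson probabilities are differences of consecutive Erlang distribution functions. -/
theorem measure_hasCount (hY : ∀ i, Measurable (Y i)) (hind : iIndepFun Y P)
    (hlaw : ∀ i, HasLaw (Y i) (expMeasure 1) P) {s : ℝ} (hs : 0 < s) (m : ℕ) :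
    P {ω | HasCount (fun i => Y i ω) s m} =
      ENNReal.ofReal (Real.exp (-s) * (s ^ m / m.factorial)) := by
  have hmeas : ∀ k, MeasurableSet {ω | ∑ i ∈ Finset.range k, Y i ω < s} := fun k =>
    measurableSet_lt (by fun_prop) measurable_const
  cases m with
  | zero =>
    have h1 : {ω | HasCount (fun i => Y i ω) s 0} =
        {ω | ∑ i ∈ Finset.range (0 + 1), Y i ω < s}ᶜ := by
      ext ω
      simp [HasCount]
    rw [h1, prob_compl_eq_one_sub (hmeas _), measure_sum_range_lt hY hind hlaw 0 hs,
      ← ENNReal.ofReal_one, ← ENNReal.ofReal_sub _ (one_sub_exp_mul_sum_nonneg 1 hs.le)]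
    congr 1
    simp
  | succ m =>
    set B : ℕ → Set Ω := fun k => {ω | ∑ i ∈ Finset.range (k + 1), Y i ω < s} with hB
    have hpos := ae_all_iff.2 fun i => ae_pos_of_hasLaw_exp (hlaw i)
    have h1 : {ω | HasCount (fun i => Y i ω) s (m + 1)} =ᵐ[P] (B m \ B (m + 1) : Set Ω) := by
      refine eventuallyEq_set.2 ?_
      filter_upwards [hpos] with ω hω
      constructor
      · intro h
        exact ⟨h.1 m (by omega), not_lt.2 h.2⟩
      · intro h
        refine ⟨fun j hj => lt_of_le_of_lt ?_ h.1, not_lt.1 h.2⟩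
        exact (sum_range_strictMono hω).monotone (by omega)
    have h2 : (B m ∩ B (m + 1) : Set Ω) =ᵐ[P] B (m + 1) := by
      refine eventuallyEq_set.2 ?_
      filter_upwards [hpos] with ω hω
      refine ⟨fun h => h.2, fun h => ⟨?_, h⟩⟩
      exact lt_of_lt_of_le (sum_range_strictMono hω (by omega : m + 1 < m + 1 + 1)) (le_of_lt h)
    have h3 := measure_inter_add_sdiff (μ := P) (B m) (hmeas (m + 1 + 1))
    have h4 : P (B m ∩ {ω | ∑ i ∈ Finset.range (m + 1 + 1), Y i ω < s}) = P (B (m + 1)) :=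
      measure_congr h2
    have h5 : P (B m \ {ω | ∑ i ∈ Finset.range (m + 1 + 1), Y i ω < s}) =
        P {ω | HasCount (fun i => Y i ω) s (m + 1)} := (measure_congr h1).symm
    rw [h4, h5] at h3
    have h6 := ENNReal.eq_sub_of_add_eq' (measure_ne_top P _) ((add_comm _ _).trans h3)
    rw [h6, measure_sum_range_lt hY hind hlaw m hs, measure_sum_range_lt hY hind hlaw (m + 1) hs,
      ← ENNReal.ofReal_sub _ (one_sub_exp_mul_sum_nonneg _ hs.le)]
    congr 1
    rw [Finset.sum_range_succ _ (m + 1)]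
    ring

/-- Laplace transform of the time spent in a state before `s`. -/
theorem lintegral_expNeg_stateClock (hY : ∀ i, Measurable (Y i)) (hZ : ∀ i, Measurable (Z i))
    (hind : iIndepFun (Sum.elim Y Z) P) (hlawY : ∀ i, HasLaw (Y i) (expMeasure 1) P)
    (hlawZ : ∀ i, HasLaw (Z i) (expMeasure 1) P) {g l s : ℝ} (hg : 0 < g) (hl : 0 < l)
    (hs : 0 < s) :
    ∫⁻ ω, expNeg l (stateClock g (fun i => Y i ω) (fun i => Z i ω) s) ∂P =
      ENNReal.ofReal (Real.exp (-(s * (l * g / (1 + l * g))))) := by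
  classical
  have hX : ∀ i, Measurable (Sum.elim Y Z i) := by
    rintro (i | i)
    · exact hY i
    · exact hZ i
  have hindY : iIndepFun Y P := hind.precomp (g := Sum.inl) Sum.inl_injective
  have hindZ : iIndepFun Z P := hind.precomp (g := Sum.inr) Sum.inr_injective
  set A : ℕ → Set Ω := fun m => {ω | HasCount (fun i => Y i ω) s m} with hA
  -- Split according to the number `m` of events before `s`. This number depends on `Y` only, and
  -- the corresponding holding times on `Z` only.
  have h1 : ∀ᵐ ω ∂P, expNeg l (stateClock g (fun i => Y i ω) (fun i => Z i ω) s) =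
      ∑' m, (A m).indicator 1 ω *
        ENNReal.ofReal (Real.exp (-((l * g) * ∑ i ∈ Finset.range m, Z i ω))) := by
    filter_upwards [ae_all_iff.2 fun i => ae_pos_of_hasLaw_exp (hlawY i),
      ae_all_iff.2 fun i => ae_pos_of_hasLaw_exp (hlawZ i),
      ae_tendsto_sum_range hY hindY hlawY] with ω hpos hposZ hlim
    obtain ⟨m, hm⟩ := exists_hasCount (y := fun i => Y i ω) (s := s)
      (((hlim.comp (tendsto_add_atTop_nat 1)).eventually_ge_atTop s).exists)
    rw [tsum_eq_single m, hm.stateClock_eq hpos, indicator_of_mem (show ω ∈ A m from hm),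
      Pi.one_apply, one_mul, expNeg, ← ENNReal.ofReal_sum_of_nonneg, ENNReal.toReal_ofReal,
      ← Finset.mul_sum, mul_assoc]
    · exact Finset.sum_nonneg fun i _ => (mul_pos hg (hposZ i)).le
    · exact fun i _ => (mul_pos hg (hposZ i)).le
    · intro n hn
      rw [indicator_of_notMem, zero_mul]
      exact fun h' => hn (HasCount.unique h' hm)
  have hmA : ∀ m, Measurable[blk (Sum.elim Y Z) (range Sum.inl)] ((A m).indicator (1 : Ω → ℝ≥0∞)) :=
    fun m => measurable_indicator_one (measurableSet_hasCount
      (fun i => measurable_blk (X := Sum.elim Y Z) (i := Sum.inl i) (mem_range_self i)) s m)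
  have hmZ : ∀ m, Measurable[blk (Sum.elim Y Z) (range Sum.inr)] fun ω =>
      ENNReal.ofReal (Real.exp (-((l * g) * ∑ i ∈ Finset.range m, Z i ω))) := by
    intro m
    have hs : Measurable[blk (Sum.elim Y Z) (range Sum.inr)] fun ω =>
        ∑ i ∈ Finset.range m, Z i ω := Finset.measurable_sum _ fun i _ =>
      measurable_blk (X := Sum.elim Y Z) (i := Sum.inr i) (mem_range_self i)
    exact (Real.measurable_exp.comp (hs.const_mul _).neg).ennreal_ofReal
  rw [lintegral_congr_ae h1, lintegral_tsum]
  · have h2 : ∀ m, ∫⁻ ω, (A m).indicator 1 ω *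
        ENNReal.ofReal (Real.exp (-((l * g) * ∑ i ∈ Finset.range m, Z i ω))) ∂P =
        ENNReal.ofReal (Real.exp (-s) * ((s * (1 / (1 + l * g))) ^ m / m.factorial)) := by
      intro m
      rw [lintegral_mul_of_blk hX hind (isCompl_range_inl_range_inr.disjoint) (hmA m) (hmZ m),
        lintegral_exp_neg_sum_range hZ hindZ hlawZ m (by positivity),
        lintegral_indicator_one (measurableSet_hasCount hY s m),
        measure_hasCount hY hindY hlawY hs, ← ENNReal.ofReal_pow (by positivity),
        ← ENNReal.ofReal_mul (by positivity), mul_pow]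
      congr 1
      ring
    simp_rw [h2]
    -- Poisson generating function at `1 / (1 + l g)`.
    have h3 : HasSum (fun m : ℕ => Real.exp (-s) * ((s * (1 / (1 + l * g))) ^ m / m.factorial))
        (Real.exp (-s) * Real.exp (s * (1 / (1 + l * g)))) := by
      refine HasSum.mul_left _ ?_
      simpa [Real.exp_eq_exp_ℝ] using NormedSpace.expSeries_div_hasSum_exp (s * (1 / (1 + l * g)))
    rw [← ENNReal.ofReal_tsum_of_nonneg (fun m => by positivity) h3.summable, h3.tsum_eq,
      ← Real.exp_add]
    congr 2
    field_simp
    ring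
  · intro m
    exact (((hmA m).mono (blk_le hX _) le_rfl).mul
      ((hmZ m).mono (blk_le hX _) le_rfl)).aemeasurable

end StateClock

/-! ### Almost sure properties of the driving family -/

/-- A driving family consisting of measurable functions. -/
structure IsMeasurableDriving {Ω : Type*} [MeasurableSpace Ω] (E T : ℕ+ → ℕ → Ω → ℝ)
    (P : Measure Ω) : Prop extends IsDrivingFamily E T P where
  measurable_E : ∀ x j, Measurable (E x j)
  measurable_T : ∀ x j, Measurable (T x j)

/-- The driving variables as one family. -/
def driving {Ω : Type*} (E T : ℕ+ → ℕ → Ω → ℝ) : (ℕ+ × ℕ) ⊕ (ℕ+ × ℕ) → Ω → ℝ :=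
  Sum.elim (fun q => E q.1 q.2) (fun q => T q.1 q.2)

section Measurability

variable {Ω : Type*} {m0 : MeasurableSpace Ω}

theorem measurable_arrival {E : ℕ+ → ℕ → Ω → ℝ} {x : ℕ+} {j : ℕ}
    (hE : ∀ i ≤ j, Measurable (E x i)) : Measurable fun ω => arrival (fun x j => E x j ω) x j :=
  Finset.measurable_sum _ fun i hi => hE i (by simpa [Nat.lt_succ_iff] using hi)

theorem measurable_stateClock {Y Z : ℕ → Ω → ℝ} {S : Ω → ℝ} (hY : ∀ i, Measurable (Y i))
    (hZ : ∀ i, Measurable (Z i)) (hS : Measurable S) (g : ℝ) :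
    Measurable fun ω => stateClock g (fun i => Y i ω) (fun i => Z i ω) (S ω) :=
  Measurable.tsum fun j => Measurable.ite
    (measurableSet_lt (Finset.measurable_sum _ fun i _ => hY i) hS)
    ((hZ j).const_mul g).ennreal_ofReal measurable_const

end Measurability

namespace IsMeasurableDriving

variable {Ω : Type*} [MeasurableSpace Ω] {P : Measure Ω} {E T : ℕ+ → ℕ → Ω → ℝ}

theorem measurable_driving (h : IsMeasurableDriving E T P) : ∀ q, Measurable (driving E T q)
  | Sum.inl q => h.measurable_E q.1 q.2
  | Sum.inr q => h.measurable_T q.1 q.2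

theorem iIndepFun_driving (h : IsMeasurableDriving E T P) : iIndepFun (driving E T) P := h.indep

theorem iIndepFun_state (h : IsMeasurableDriving E T P) (x : ℕ+) :
    iIndepFun (Sum.elim (E x) (T x)) P := by
  have h1 := h.iIndepFun_driving.precomp
    (g := Sum.map (fun j : ℕ => (x, j)) (fun j : ℕ => (x, j)))
    (Sum.map_injective.2 ⟨Prod.mk_right_injective x, Prod.mk_right_injective x⟩)
  have h2 : (fun q => driving E T (Sum.map (fun j : ℕ => (x, j)) (fun j : ℕ => (x, j)) q)) =
      Sum.elim (E x) (T x) := by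
    ext (q | q) <;> rfl
  rw [← h2]
  exact h1

theorem iIndepFun_E (h : IsMeasurableDriving E T P) (x : ℕ+) : iIndepFun (E x) P :=
  (h.iIndepFun_state x).precomp (g := Sum.inl) Sum.inl_injective

theorem iIndepFun_T (h : IsMeasurableDriving E T P) (x : ℕ+) : iIndepFun (T x) P :=
  (h.iIndepFun_state x).precomp (g := Sum.inr) Sum.inr_injective

theorem ae_E_pos (h : IsMeasurableDriving E T P) : ∀ᵐ ω ∂P, ∀ x j, 0 < E x j ω :=
  ae_all_iff.2 fun x => ae_all_iff.2 fun j => ae_pos_of_hasLaw_exp (h.hasLaw_E x j)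

theorem ae_T_pos (h : IsMeasurableDriving E T P) : ∀ᵐ ω ∂P, ∀ x j, 0 < T x j ω :=
  ae_all_iff.2 fun x => ae_all_iff.2 fun j => ae_pos_of_hasLaw_exp (h.hasLaw_T x j)

variable [IsProbabilityMeasure P]

/-- Exponential Markov inequality: the indicator of `σ ≤ s` is at most `exp s * exp (-σ)`. Since `σ`
is a sum of `j + 1` exponential variables, the bound decays like `2 ^ (-(j + 1))` and is summable
over `j`. -/
theorem lintegral_ite_arrival_le (h : IsMeasurableDriving E T P) (x : ℕ+) (j : ℕ) {g : ℝ}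
    (hg : 0 ≤ g) (s : ℝ) :
    ∫⁻ ω, (if arrival (fun x j => E x j ω) x j ≤ s then ENNReal.ofReal (g * T x j ω) else 0) ∂P ≤
      ENNReal.ofReal (Real.exp s) * ENNReal.ofReal (1 / (1 + 1)) ^ (j + 1) *
        ENNReal.ofReal g := by
  have hmA : Measurable fun ω => arrival (fun x j => E x j ω) x j :=
    measurable_arrival fun i _ => h.measurable_E x i
  calc _ ≤ ∫⁻ ω, ENNReal.ofReal (Real.exp s) * ENNReal.ofReal g *
        (ENNReal.ofReal (Real.exp (-(1 * ∑ i ∈ Finset.range (j + 1), E x i ω))) *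
          ENNReal.ofReal (T x j ω)) ∂P := by
        refine lintegral_mono fun ω => ?_
        split_ifs with hle
        · rw [ENNReal.ofReal_mul hg]
          have h1 : (1 : ℝ≥0∞) ≤ ENNReal.ofReal (Real.exp s) *
              ENNReal.ofReal (Real.exp (-(1 * ∑ i ∈ Finset.range (j + 1), E x i ω))) := by
            rw [← ENNReal.ofReal_mul (Real.exp_pos _).le, ← Real.exp_add, ← ENNReal.ofReal_one]
            refine ENNReal.ofReal_le_ofReal (Real.one_le_exp ?_)
            have h2 : ∑ i ∈ Finset.range (j + 1), E x i ω ≤ s := hle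
            linarith
          rw [mul_mul_mul_comm]
          exact le_mul_of_one_le_left zero_le h1
        · exact zero_le
    _ = _ := by
      rw [lintegral_const_mul' _ _ (ENNReal.mul_ne_top ENNReal.ofReal_ne_top
        ENNReal.ofReal_ne_top)]
      rw [lintegral_mul_of_blk h.measurable_driving h.iIndepFun_driving
        (isCompl_range_inl_range_inr.disjoint), lintegral_ofReal_of_hasLaw_exp (h.hasLaw_T x j),
        lintegral_exp_neg_sum_range (h.measurable_E x) (h.iIndepFun_E x) (h.hasLaw_E x) (j + 1)
          zero_le_one]
      · ring
      · have hs : Measurable[blk (driving E T) (range Sum.inl)] fun ω =>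
            ∑ i ∈ Finset.range (j + 1), E x i ω := Finset.measurable_sum _ fun i _ =>
          measurable_blk (X := driving E T) (i := Sum.inl (x, i)) (mem_range_self _)
        exact (Real.measurable_exp.comp (hs.const_mul _).neg).ennreal_ofReal
      · exact (measurable_blk (X := driving E T) (i := Sum.inr (x, j))
          (mem_range_self _)).ennreal_ofReal

/-- At integer times the clock has finite expectation, as the weights are summable; monotonicity
covers all other times simultaneously. -/
theorem ae_clock_ne_top (h : IsMeasurableDriving E T P) {γ : ℕ+ → ℝ} (hγ : ∀ x, 0 < γ x)
    (hsum : ∑' x, ENNReal.ofReal (γ x) ≠ ∞) :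
    ∀ᵐ ω ∂P, ∀ s, clock γ (fun x j => E x j ω) (fun x j => T x j ω) s ≠ ∞ := by
  have hmeas : ∀ n : ℕ, ∀ x j, Measurable fun ω =>
      if arrival (fun x j => E x j ω) x j ≤ (n : ℝ)
        then ENNReal.ofReal (γ x * T x j ω) else 0 := by
    intro n x j
    have hT := h.measurable_T x j
    exact Measurable.ite (measurableSet_le (measurable_arrival fun i _ => h.measurable_E x i)
      measurable_const) (by fun_prop) measurable_const
  have h1 : ∀ n : ℕ, ∀ᵐ ω ∂P,
      clock γ (fun x j => E x j ω) (fun x j => T x j ω) n ≠ ∞ := by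
    intro n
    have hm : Measurable fun ω => clock γ (fun x j => E x j ω) (fun x j => T x j ω) n :=
      Measurable.tsum fun x => Measurable.tsum fun j => hmeas n x j
    have hfin : ∫⁻ ω, clock γ (fun x j => E x j ω) (fun x j => T x j ω) n ∂P ≠ ∞ := by
      simp only [clock]
      rw [lintegral_tsum fun x => (Measurable.tsum fun j => hmeas n x j).aemeasurable]
      simp_rw [lintegral_tsum fun j => (hmeas n _ j).aemeasurable]
      refine ne_top_of_le_ne_top ?_ (ENNReal.tsum_le_tsum fun x => ENNReal.tsum_le_tsum fun j =>
        h.lintegral_ite_arrival_le x j (hγ x).le n)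
      simp_rw [ENNReal.tsum_mul_right, ENNReal.tsum_mul_left]
      refine ENNReal.mul_ne_top (ENNReal.mul_ne_top ENNReal.ofReal_ne_top ?_) hsum
      rw [ENNReal.tsum_geometric_add_one]
      refine ENNReal.mul_ne_top ENNReal.ofReal_ne_top (ENNReal.inv_ne_top.2 ?_)
      refine (tsub_pos_of_lt ?_).ne'
      rw [ENNReal.ofReal_lt_one]
      norm_num
    filter_upwards [ae_lt_top hm hfin] with ω hω using hω.ne
  filter_upwards [ae_all_iff.2 h1] with ω hω s
  obtain ⟨n, hn⟩ := exists_nat_ge s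
  exact ne_top_of_le_ne_top (hω n) (monotone_clock hn)

/-- A coincidence would prescribe the value of `E x i` in terms of variables independent of it,
which has probability zero as the exponential law has no atoms. -/
theorem ae_arrival_ne (h : IsMeasurableDriving E T P) {x y : ℕ+} (hxy : x ≠ y) (i j : ℕ) :
    ∀ᵐ ω ∂P, arrival (fun x j => E x j ω) x i ≠ arrival (fun x j => E x j ω) y j := by
  set V : Ω → ℝ := fun ω => arrival (fun x j => E x j ω) y j - ∑ n ∈ Finset.range i, E x n ω
    with hV
  have hmV : Measurable[blk (driving E T) {Sum.inl (x, i)}ᶜ] V := by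
    refine Measurable.sub (measurable_arrival fun n _ =>
      measurable_blk (X := driving E T) (i := Sum.inl (y, n)) ?_)
      (Finset.measurable_sum _ fun n hn =>
        measurable_blk (X := driving E T) (i := Sum.inl (x, n)) ?_)
    · simp [hxy.symm]
    · simp only [Finset.mem_range] at hn
      simp [hn.ne]
  have hmE : Measurable[blk (driving E T) {Sum.inl (x, i)}] (E x i) :=
    measurable_blk (X := driving E T) (i := Sum.inl (x, i)) rfl
  have hind : IndepFun V (E x i) P := by
    rw [IndepFun_iff_Indep]
    exact indep_of_indep_of_le_left (indep_of_indep_of_le_right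
      (indep_blk h.measurable_driving h.iIndepFun_driving disjoint_compl_left)
      hmE.comap_le) hmV.comap_le
  have hmV' : Measurable V := hmV.mono (blk_le h.measurable_driving _) le_rfl
  have hf : Measurable (Function.uncurry fun v e : ℝ => if e = v then (1 : ℝ≥0∞) else 0) :=
    Measurable.ite (measurableSet_eq_fun measurable_snd measurable_fst) measurable_const
      measurable_const
  have h1 := lintegral_comp_prodMk_of_indepFun hmV' (h.measurable_E x i) hind hf
  have h2 : ∀ v : ℝ, ∫⁻ ω, (if E x i ω = v then (1 : ℝ≥0∞) else 0) ∂P = 0 := by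
    intro v
    refine lintegral_eq_zero_of_ae_eq_zero ?_
    filter_upwards [measure_eq_zero_iff_ae_notMem.1
      (measure_eq_of_hasLaw_exp (h.hasLaw_E x i) (h.measurable_E x i) v)] with ω hω
    exact if_neg hω
  simp_rw [h2, lintegral_zero] at h1
  have h4 : Measurable fun ω => if E x i ω = V ω then (1 : ℝ≥0∞) else 0 :=
    hf.comp (hmV'.prodMk (h.measurable_E x i))
  rw [lintegral_eq_zero_iff h4] at h1
  filter_upwards [h1] with ω hω heq
  have h3 : E x i ω = V ω := by
    simp only [arrival] at heq
    rw [Finset.sum_range_succ] at heq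
    simp only [hV, arrival]
    linarith
  simp [h3] at hω

/-- The first event times of the different states are independent with a common law charging every
rational interval in `[0, ∞)`, so by Borel-Cantelli each such interval contains one of them. -/
theorem ae_dense (h : IsMeasurableDriving E T P) :
    ∀ᵐ ω ∂P, ∀ a b : ℝ, 0 ≤ a → a < b → ∃ y, a < arrival (fun x j => E x j ω) y 0 ∧
      arrival (fun x j => E x j ω) y 0 < b := by
  have h1 : ∀ q : ℚ × ℚ, ∀ᵐ ω ∂P, (0 : ℝ) ≤ q.1 → (q.1 : ℝ) < q.2 →
      ∃ y, E y 0 ω ∈ Ioo (q.1 : ℝ) q.2 := by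
    intro q
    by_cases hq : (0 : ℝ) ≤ q.1 ∧ (q.1 : ℝ) < q.2
    · have hinj : Function.Injective fun n : ℕ =>
          (Sum.inl (n.succPNat, 0) : (ℕ+ × ℕ) ⊕ (ℕ+ × ℕ)) := by
        intro n m hnm
        exact Nat.succPNat_injective (Prod.ext_iff.1 (Sum.inl_injective hnm)).1
      have hind : iIndepFun (fun n : ℕ => E n.succPNat 0) P :=
        h.iIndepFun_driving.precomp hinj
      have hc : ∀ n : ℕ, P (E n.succPNat 0 ⁻¹' Ioo (q.1 : ℝ) q.2) =
          P (E 1 0 ⁻¹' Ioo (q.1 : ℝ) q.2) := fun n => by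
        rw [measure_Ioo_of_hasLaw_exp (h.hasLaw_E _ _) (h.measurable_E _ _) hq.1,
          measure_Ioo_of_hasLaw_exp (h.hasLaw_E _ _) (h.measurable_E _ _) hq.1]
      filter_upwards [ae_frequently_mem_of_iIndepFun (fun n : ℕ => h.measurable_E n.succPNat 0) hind
        measurableSet_Ioo (measure_Ioo_pos_of_hasLaw_exp (h.hasLaw_E 1 0) (h.measurable_E 1 0)
          hq.1 hq.2) hc] with ω hω _ _
      obtain ⟨n, hn⟩ := hω.exists
      exact ⟨_, hn⟩
    · exact ae_of_all _ fun ω h1 h2 => absurd ⟨h1, h2⟩ hq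
  filter_upwards [ae_all_iff.2 h1] with ω hω a b ha hab
  obtain ⟨q, hq1, hq2⟩ := exists_rat_btwn hab
  obtain ⟨r, hr1, hr2⟩ := exists_rat_btwn hq2
  obtain ⟨y, hy⟩ := hω (q, r) (ha.trans hq1.le) hr1
  refine ⟨y, ?_⟩
  simp only [arrival, zero_add, Finset.range_one, Finset.sum_singleton]
  exact ⟨hq1.trans hy.1, hy.2.trans hr2⟩

theorem ae_isGoodPath (h : IsMeasurableDriving E T P) {γ : ℕ+ → ℝ} (hγ : ∀ x, 0 < γ x)
    (hsum : ∑' x, ENNReal.ofReal (γ x) ≠ ∞) :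
    ∀ᵐ ω ∂P, IsGoodPath γ (fun x j => E x j ω) (fun x j => T x j ω) := by
  have hne : ∀ᵐ ω ∂P, ∀ x y, x ≠ y → ∀ i j,
      arrival (fun x j => E x j ω) x i ≠ arrival (fun x j => E x j ω) y j := by
    rw [ae_all_iff]; intro x
    rw [ae_all_iff]; intro y
    by_cases hxy : x = y
    · exact ae_of_all _ fun ω h' => absurd hxy h'
    · filter_upwards [ae_all_iff.2 fun i => ae_all_iff.2 fun j => h.ae_arrival_ne hxy i j]
        with ω hω _ using hω
  filter_upwards [hne, h.ae_E_pos, h.ae_T_pos, h.ae_dense, h.ae_clock_ne_top hγ hsum,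
    ae_tendsto_sum_range (h.measurable_T 1) (h.iIndepFun_T 1) (h.hasLaw_T 1)]
    with ω h1 h2 h3 h4 h5 h6
  refine ⟨?_, fun x j => mul_pos (hγ x) (h3 x j), ?_, h4, h5, ?_⟩
  · rintro ⟨x, i⟩ ⟨y, j⟩ hkl
    by_cases hxy : x = y
    · subst hxy
      have := (sum_range_strictMono (h2 x)).injective hkl
      simpa using this
    · exact absurd hkl (h1 x y hxy i j)
  · exact fun x j => Finset.sum_nonneg fun i _ => (h2 x i).le
  · intro t
    -- State `1` alone already drives the clock beyond any level.
    obtain ⟨m, hm⟩ := ((h6.const_mul_atTop (hγ 1)).eventually_gt_atTop (max t 0)).exists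
    refine ⟨arrival (fun x j => E x j ω) 1 m, ?_⟩
    calc ENNReal.ofReal t ≤ ENNReal.ofReal (max t 0) := ENNReal.ofReal_le_ofReal (le_max_left _ _)
      _ < ENNReal.ofReal (γ 1 * ∑ i ∈ Finset.range m, T 1 i ω) :=
        (ENNReal.ofReal_lt_ofReal_iff (lt_of_le_of_lt (le_max_right _ _) hm)).2 hm
      _ = ∑ i ∈ Finset.range m, ENNReal.ofReal (γ 1 * T 1 i ω) := by
        rw [Finset.mul_sum, ENNReal.ofReal_sum_of_nonneg fun i _ => (mul_pos (hγ 1) (h3 1 i)).le]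
      _ ≤ ∑' j, if arrival (fun x j => E x j ω) 1 j ≤ arrival (fun x j => E x j ω) 1 m
            then ENNReal.ofReal (γ 1 * T 1 j ω) else 0 := by
        refine le_trans (le_of_eq ?_) (ENNReal.sum_le_tsum (Finset.range m))
        refine Finset.sum_congr rfl fun i hi => ?_
        rw [if_pos]
        refine (sum_range_strictMono (h2 1)).monotone ?_
        have := Finset.mem_range.1 hi
        omega
      _ ≤ _ := ENNReal.le_tsum (f := fun x => ∑' j,
          if arrival (fun x j => E x j ω) x j ≤ arrival (fun x j => E x j ω) 1 m
            then ENNReal.ofReal (γ x * T x j ω) else 0) 1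

end IsMeasurableDriving

/-! ### Laplace transform of the clock just before an event -/

/-- The contribution to the clock, strictly before `s`, of the states other than `x`. -/
noncomputable def otherClock (γ : ℕ+ → ℝ) (e τ : ℕ+ → ℕ → ℝ) (x : ℕ+) (s : ℝ) : ℝ≥0∞ :=
  ∑' y, if y = x then 0 else stateClock (γ y) (e y) (τ y) s

theorem clockLeft_eq_add_otherClock (γ : ℕ+ → ℝ) (e τ : ℕ+ → ℕ → ℝ) (x : ℕ+) (s : ℝ) :
    clockLeft γ e τ s = stateClock (γ x) (e x) (τ x) s + otherClock γ e τ x s := by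
  rw [clockLeft_eq_tsum_stateClock, ENNReal.tsum_eq_add_tsum_ite x, otherClock]
  congr!

/-- The σ-algebra is left arbitrary, and the variables of state `x` are exempted, so that the lemma
applies to sub-σ-algebras generated by blocks and to product spaces. -/
theorem measurable_otherClock {Ω : Type*} {m0 : MeasurableSpace Ω} {E T : ℕ+ → ℕ → Ω → ℝ}
    {x : ℕ+} {S : Ω → ℝ} (hE : ∀ y, y ≠ x → ∀ i, Measurable (E y i))
    (hT : ∀ y, y ≠ x → ∀ i, Measurable (T y i)) (hS : Measurable S) (γ : ℕ+ → ℝ) :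
    Measurable fun ω => otherClock γ (fun x j => E x j ω) (fun x j => T x j ω) x (S ω) := by
  refine Measurable.tsum fun y => ?_
  by_cases hy : y = x
  · simp only [if_pos hy]
    exact measurable_const
  · simp only [if_neg hy]
    exact measurable_stateClock (hE y hy) (hT y hy) hS _

/-- The Laplace exponent of the clock. -/
noncomputable def laplaceExponent (γ : ℕ+ → ℝ) (l : ℝ) : ℝ := ∑' y, l * γ y / (1 + l * γ y)

section Exponent

variable {γ : ℕ+ → ℝ}

theorem summable_of_tsum_ofReal_ne_top (hγ : ∀ x, 0 < γ x)
    (hsum : ∑' x, ENNReal.ofReal (γ x) ≠ ∞) : Summable γ := by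
  refine (ENNReal.summable_toReal hsum).congr fun x => ?_
  rw [ENNReal.toReal_ofReal (hγ x).le]

theorem summable_laplaceExponent (hγ : ∀ x, 0 < γ x)
    (hsum : ∑' x, ENNReal.ofReal (γ x) ≠ ∞) {l : ℝ} (hl : 0 < l) :
    Summable fun y => l * γ y / (1 + l * γ y) := by
  refine Summable.of_nonneg_of_le (fun y => ?_) (fun y => ?_)
    ((summable_of_tsum_ofReal_ne_top hγ hsum).mul_left l)
  · have := mul_pos hl (hγ y); positivity
  · have := mul_pos hl (hγ y)
    exact div_le_self this.le (by linarith)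

theorem laplaceExponent_pos (hγ : ∀ x, 0 < γ x)
    (hsum : ∑' x, ENNReal.ofReal (γ x) ≠ ∞) {l : ℝ} (hl : 0 < l) : 0 < laplaceExponent γ l := by
  refine (summable_laplaceExponent hγ hsum hl).tsum_pos (fun y => ?_) 1 ?_
  · have := mul_pos hl (hγ y); positivity
  · have := mul_pos hl (hγ 1); positivity

theorem powerSum_one_eq (hγ : ∀ x, 0 < γ x)
    (hsum : ∑' x, ENNReal.ofReal (γ x) ≠ ∞) {l : ℝ} (hl : 0 < l) :
    powerSum γ 1 l = ENNReal.ofReal (laplaceExponent γ l) := by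
  rw [laplaceExponent, ENNReal.ofReal_tsum_of_nonneg (fun y => ?_)
    (summable_laplaceExponent hγ hsum hl), powerSum]
  · simp
  · have := mul_pos hl (hγ y); positivity

theorem tsum_ite_laplaceExponent (hγ : ∀ x, 0 < γ x)
    (hsum : ∑' x, ENNReal.ofReal (γ x) ≠ ∞) {l : ℝ} (hl : 0 < l) (x : ℕ+) :
    ∑' y, (if y = x then 0 else l * γ y / (1 + l * γ y)) =
      laplaceExponent γ l - l * γ x / (1 + l * γ x) := by
  have := (summable_laplaceExponent hγ hsum hl).tsum_eq_add_tsum_ite x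
  rw [laplaceExponent, this]
  ring

theorem summable_ite_laplaceExponent (hγ : ∀ x, 0 < γ x)
    (hsum : ∑' x, ENNReal.ofReal (γ x) ≠ ∞) {l : ℝ} (hl : 0 < l) (x : ℕ+) :
    Summable fun y => if y = x then 0 else l * γ y / (1 + l * γ y) := by
  refine Summable.of_nonneg_of_le (fun y => ?_) (fun y => ?_) (summable_laplaceExponent hγ hsum hl)
  · have := mul_pos hl (hγ y)
    split_ifs <;> positivity
  · have := mul_pos hl (hγ y)
    split_ifs
    · positivity
    · exact le_rfl

end Exponent

/-- The geometric series that turns the transforms at single events into `1 / φ`; it is used with `q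
= 1 / (1 + l * γ x)`, and the result does not depend on `q`. -/
theorem tsum_pow_mul_pow {q φ : ℝ} (hq : 0 < q) (hφ : 0 < φ) :
    ∑' j : ℕ, ENNReal.ofReal q ^ j * ENNReal.ofReal (1 / (φ + q)) ^ (j + 1) =
      (ENNReal.ofReal φ)⁻¹ := by
  have h1 : ∀ j : ℕ, ENNReal.ofReal q ^ j * ENNReal.ofReal (1 / (φ + q)) ^ (j + 1) =
      ENNReal.ofReal (q / (φ + q)) ^ j * ENNReal.ofReal (1 / (φ + q)) := by
    intro j
    rw [pow_succ, ← mul_assoc, ← mul_pow, ← ENNReal.ofReal_mul hq.le, mul_one_div]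
  have h2 : 1 - q / (φ + q) = φ / (φ + q) := by field_simp; ring
  simp_rw [h1]
  rw [ENNReal.tsum_mul_right, ENNReal.tsum_geometric, ← ENNReal.ofReal_one,
    ← ENNReal.ofReal_sub _ (by positivity), h2, ← ENNReal.ofReal_inv_of_pos (by positivity),
    ← ENNReal.ofReal_inv_of_pos hφ, ← ENNReal.ofReal_mul (by positivity)]
  congr 1
  field_simp

/-- The state to which a driving variable belongs. -/
def drivingState : (ℕ+ × ℕ) ⊕ (ℕ+ × ℕ) → ℕ+ := Sum.elim Prod.fst Prod.fst

namespace IsMeasurableDriving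

variable {Ω : Type*} [MeasurableSpace Ω] {P : Measure Ω} {E T : ℕ+ → ℕ → Ω → ℝ}
  [IsProbabilityMeasure P] {γ : ℕ+ → ℝ}

theorem ae_clockLeft_ne_top (h : IsMeasurableDriving E T P) (hγ : ∀ x, 0 < γ x)
    (hsum : ∑' x, ENNReal.ofReal (γ x) ≠ ∞) :
    ∀ᵐ ω ∂P, ∀ s, clockLeft γ (fun x j => E x j ω) (fun x j => T x j ω) s ≠ ∞ := by
  filter_upwards [h.ae_clock_ne_top hγ hsum] with ω hω s
  exact ne_top_of_le_ne_top (hω s) (clockLeft_le_clock s)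

/-- States are independent, so the transform of a finite partial sum is a product. The infinite sum
follows by dominated convergence, and the exponent loses exactly the term of state `x`. -/
theorem lintegral_expNeg_otherClock (h : IsMeasurableDriving E T P) (hγ : ∀ x, 0 < γ x)
    (hsum : ∑' x, ENNReal.ofReal (γ x) ≠ ∞) {l s : ℝ} (hl : 0 < l) (hs : 0 < s) (x : ℕ+) :
    ∫⁻ ω, expNeg l (otherClock γ (fun x j => E x j ω) (fun x j => T x j ω) x s) ∂P =
      ENNReal.ofReal (Real.exp (-(s * (laplaceExponent γ l - l * γ x / (1 + l * γ x))))) := by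
  set W : ℕ+ → Ω → ℝ≥0∞ := fun y ω =>
    if y = x then 0 else stateClock (γ y) (fun j => E y j ω) (fun j => T y j ω) s with hW
  set c : ℕ+ → ℝ := fun y => if y = x then 0 else l * γ y / (1 + l * γ y) with hc
  have hWm : ∀ y, Measurable[blk (driving E T) (drivingState ⁻¹' {y})] (W y) := by
    intro y
    simp only [hW]
    split_ifs with hy
    · exact measurable_const
    · exact measurable_stateClock
        (fun i => measurable_blk (X := driving E T) (i := Sum.inl (y, i)) rfl)
        (fun i => measurable_blk (X := driving E T) (i := Sum.inr (y, i)) rfl) measurable_const _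
  have hWm' : ∀ y, Measurable (W y) := fun y =>
    (hWm y).mono (blk_le h.measurable_driving _) le_rfl
  have hfin : ∀ᵐ ω ∂P, ∑' y, W y ω ≠ ∞ := by
    filter_upwards [h.ae_clockLeft_ne_top hγ hsum] with ω hω
    have := hω s
    rw [clockLeft_eq_add_otherClock γ _ _ x] at this
    exact (ENNReal.add_ne_top.1 this).2
  have hint : ∀ y, ∫⁻ ω, expNeg l (W y ω) ∂P = ENNReal.ofReal (Real.exp (-(s * c y))) := by
    intro y
    simp only [hW, hc]
    split_ifs with hy
    · simp [expNeg]
    · exact lintegral_expNeg_stateClock (h.measurable_E y) (h.measurable_T y)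
        (h.iIndepFun_state y) (h.hasLaw_E y) (h.hasLaw_T y) (hγ y) hl hs
  have hprod : ∀ A : Finset ℕ+, ∫⁻ ω, expNeg l (∑ y ∈ A, W y ω) ∂P =
      ENNReal.ofReal (Real.exp (-(s * ∑ y ∈ A, c y))) := by
    intro A
    have h1 : ∀ᵐ ω ∂P, expNeg l (∑ y ∈ A, W y ω) = ∏ y ∈ A, expNeg l (W y ω) := by
      filter_upwards [hfin] with ω hω
      exact expNeg_sum l A fun y => ENNReal.ne_top_of_tsum_ne_top hω y
    rw [lintegral_congr_ae h1, lintegral_prod_of_blk h.measurable_driving h.iIndepFun_driving A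
      (S := fun y => drivingState ⁻¹' {y}) (f := fun y ω => expNeg l (W y ω)) _ fun y => (measurable_expNeg l).comp (hWm y)]
    · simp_rw [hint]
      rw [← ENNReal.ofReal_prod_of_nonneg fun i _ => (Real.exp_pos _).le, ← Real.exp_sum,
        Finset.mul_sum, Finset.sum_neg_distrib]
    · intro y z hyz
      exact Disjoint.preimage _ (by simpa using hyz)
  have hl1 : Tendsto (fun A : Finset ℕ+ => ∫⁻ ω, expNeg l (∑ y ∈ A, W y ω) ∂P) atTop
      (𝓝 (∫⁻ ω, expNeg l (∑' y, W y ω) ∂P)) := by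
    refine tendsto_lintegral_filter_of_dominated_convergence (fun _ => 1) ?_ ?_ ?_ ?_
    · exact Eventually.of_forall fun A => (measurable_expNeg l).comp (by fun_prop)
    · exact Eventually.of_forall fun A => ae_of_all _ fun ω => expNeg_le_one hl.le _
    · simp
    · filter_upwards [hfin] with ω hω using tendsto_expNeg_sum l hω
  have hl2 : Tendsto (fun A : Finset ℕ+ => ∫⁻ ω, expNeg l (∑ y ∈ A, W y ω) ∂P) atTop
      (𝓝 (ENNReal.ofReal (Real.exp (-(s * ∑' y, c y))))) := by
    simp_rw [hprod]
    exact ENNReal.tendsto_ofReal ((Real.continuous_exp.tendsto _).comp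
      ((summable_ite_laplaceExponent hγ hsum hl x).hasSum.const_mul s).neg)
  rw [← tsum_ite_laplaceExponent hγ hsum hl x]
  exact tendsto_nhds_unique hl1 hl2

/-- Just before event `j` of state `x`, the clock consists of `j` holding times in `x`, which give
the first factor, and of the other states' contribution up to an independent time `σ`. That
contribution has transform `exp (-a σ)` with `a = φ - l γₓ / (1 + l γₓ)`. Since `σ` is a sum of `j +
1` exponential variables, averaging gives `(1 / (1 + a)) ^ (j + 1)`, the second factor. -/
theorem lintegral_expNeg_clockLeft_arrival (h : IsMeasurableDriving E T P) (hγ : ∀ x, 0 < γ x)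
    (hsum : ∑' x, ENNReal.ofReal (γ x) ≠ ∞) {l : ℝ} (hl : 0 < l) (x : ℕ+) (j : ℕ) :
    ∫⁻ ω, expNeg l (clockLeft γ (fun x j => E x j ω) (fun x j => T x j ω)
        (arrival (fun x j => E x j ω) x j)) ∂P =
      ENNReal.ofReal (1 / (1 + l * γ x)) ^ j *
        ENNReal.ofReal (1 / (laplaceExponent γ l + 1 / (1 + l * γ x))) ^ (j + 1) := by
  have hlγ : 0 < l * γ x := mul_pos hl (hγ x)
  have h1 : ∀ᵐ ω ∂P, expNeg l (clockLeft γ (fun x j => E x j ω) (fun x j => T x j ω)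
        (arrival (fun x j => E x j ω) x j)) =
      ENNReal.ofReal (Real.exp (-(l * γ x * ∑ i ∈ Finset.range j, T x i ω))) *
        expNeg l (otherClock γ (fun x j => E x j ω) (fun x j => T x j ω) x
          (arrival (fun x j => E x j ω) x j)) := by
    filter_upwards [h.ae_clockLeft_ne_top hγ hsum, h.ae_E_pos, h.ae_T_pos] with ω h1 h2 h3
    have h4 := h1 (arrival (fun x j => E x j ω) x j)
    rw [clockLeft_eq_add_otherClock γ _ _ x] at h4 ⊢
    rw [expNeg_add l (ENNReal.add_ne_top.1 h4).1 (ENNReal.add_ne_top.1 h4).2]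
    congr 1
    rw [HasCount.stateClock_eq (s := arrival (fun x j => E x j ω) x j) (h2 x) (hasCount_sum_range (h2 x) j), expNeg,
      ← ENNReal.ofReal_sum_of_nonneg fun i _ => (mul_pos (hγ x) (h3 x i)).le,
      ENNReal.toReal_ofReal (Finset.sum_nonneg fun i _ => (mul_pos (hγ x) (h3 x i)).le),
      ← Finset.mul_sum, mul_assoc]
  have hm1 : Measurable[blk (driving E T) (range fun i : ℕ => Sum.inr (x, i))] fun ω =>
      ENNReal.ofReal (Real.exp (-(l * γ x * ∑ i ∈ Finset.range j, T x i ω))) := by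
    have hs : Measurable[blk (driving E T) (range fun i : ℕ => Sum.inr (x, i))] fun ω =>
        ∑ i ∈ Finset.range j, T x i ω := Finset.measurable_sum _ fun i _ =>
      measurable_blk (X := driving E T) (i := Sum.inr (x, i)) (mem_range_self i)
    exact (Real.measurable_exp.comp (hs.const_mul _).neg).ennreal_ofReal
  have hm2 : Measurable[blk (driving E T) (range fun i : ℕ => Sum.inr (x, i))ᶜ] fun ω =>
      expNeg l (otherClock γ (fun x j => E x j ω) (fun x j => T x j ω) x
          (arrival (fun x j => E x j ω) x j)) := by
    refine (measurable_expNeg l).comp (measurable_otherClock (fun y hy i => ?_)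
      (fun y hy i => ?_) (measurable_arrival fun i _ => ?_) γ)
    · exact measurable_blk (X := driving E T) (i := Sum.inl (y, i)) (by simp)
    · exact measurable_blk (X := driving E T) (i := Sum.inr (y, i)) (by simp [hy.symm])
    · exact measurable_blk (X := driving E T) (i := Sum.inl (x, i)) (by simp)
  rw [lintegral_congr_ae h1, lintegral_mul_of_blk h.measurable_driving h.iIndepFun_driving
    disjoint_compl_right hm1 hm2, lintegral_exp_neg_sum_range (h.measurable_T x) (h.iIndepFun_T x)
    (h.hasLaw_T x) j hlγ.le]
  congr 1
  -- The arrival time depends on the interarrival times of `x` only, so it can be frozen while the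
  -- other states are integrated out.
  have hfreeze := lintegral_eq_lintegral_lintegral_of_indep
    (blk_le h.measurable_driving (range fun i : ℕ => Sum.inl (x, i)))
    (blk_le h.measurable_driving (drivingState ⁻¹' {x}ᶜ))
    (indep_blk h.measurable_driving h.iIndepFun_driving (by
      rw [Set.disjoint_left]
      rintro _ ⟨i, rfl⟩ hi
      exact hi rfl))
    (S := fun ω => arrival (fun x j => E x j ω) x j)
    (measurable_arrival fun i _ =>
      measurable_blk (X := driving E T) (i := Sum.inl (x, i)) (mem_range_self i))
    (f := fun s ω => expNeg l (otherClock γ (fun x j => E x j ω) (fun x j => T x j ω) x s))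
    ((measurable_expNeg l).comp (measurable_otherClock
      (E := fun y i (p : ℝ × Ω) => E y i p.2) (T := fun y i (p : ℝ × Ω) => T y i p.2)
      (S := Prod.fst)
      (fun y hy i => (measurable_blk (X := driving E T) (i := Sum.inl (y, i)) hy).comp
        (@measurable_snd _ _ _ (blk (driving E T) (drivingState ⁻¹' {x}ᶜ))))
      (fun y hy i => (measurable_blk (X := driving E T) (i := Sum.inr (y, i)) hy).comp
        (@measurable_snd _ _ _ (blk (driving E T) (drivingState ⁻¹' {x}ᶜ))))
      (@measurable_fst _ _ _ (blk (driving E T) (drivingState ⁻¹' {x}ᶜ))) γ))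
  have ha : 0 ≤ laplaceExponent γ l - l * γ x / (1 + l * γ x) := by
    rw [← tsum_ite_laplaceExponent hγ hsum hl x]
    refine tsum_nonneg fun y => ?_
    have := mul_pos hl (hγ y)
    split_ifs <;> positivity
  rw [hfreeze]
  have h2 : ∀ᵐ ω ∂P, ∫⁻ ω', expNeg l (otherClock γ (fun x j => E x j ω') (fun x j => T x j ω') x
      (arrival (fun x j => E x j ω) x j)) ∂P = ENNReal.ofReal (Real.exp
        (-((laplaceExponent γ l - l * γ x / (1 + l * γ x)) *
          ∑ i ∈ Finset.range (j + 1), E x i ω))) := by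
    filter_upwards [ae_sum_range_pos (h.hasLaw_E x) j] with ω hω
    refine (h.lintegral_expNeg_otherClock hγ hsum hl hω x).trans ?_
    rw [mul_comm]
  rw [lintegral_congr_ae h2, lintegral_exp_neg_sum_range (h.measurable_E x) (h.iIndepFun_E x)
    (h.hasLaw_E x) (j + 1) ha]
  have he : 1 + (laplaceExponent γ l - l * γ x / (1 + l * γ x)) =
      laplaceExponent γ l + 1 / (1 + l * γ x) := by
    field_simp
    ring
  rw [he]

/-- The renewal measure of the clock has Laplace transform `1 / φ`. -/
theorem tsum_lintegral_expNeg_clockLeft_arrival (h : IsMeasurableDriving E T P)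
    (hγ : ∀ x, 0 < γ x) (hsum : ∑' x, ENNReal.ofReal (γ x) ≠ ∞) {l : ℝ} (hl : 0 < l) (x : ℕ+) :
    ∑' j, ∫⁻ ω, expNeg l (clockLeft γ (fun x j => E x j ω) (fun x j => T x j ω)
        (arrival (fun x j => E x j ω) x j)) ∂P = (powerSum γ 1 l)⁻¹ := by
  have hlγ : 0 < l * γ x := mul_pos hl (hγ x)
  simp_rw [h.lintegral_expNeg_clockLeft_arrival hγ hsum hl x]
  rw [tsum_pow_mul_pow (by positivity) (laplaceExponent_pos hγ hsum hl),
    powerSum_one_eq hγ hsum hl]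

end IsMeasurableDriving

/-! ### Double Laplace transform of the hold probabilities -/

section Integrals

theorem lintegral_Ici_exp_neg_mul {b : ℝ} (hb : 0 < b) (g : ℝ) :
    ∫⁻ t in Ici g, ENNReal.ofReal (Real.exp (-(b * t))) =
      ENNReal.ofReal (Real.exp (-(b * g)) / b) := by
  have h1 : IntegrableOn (fun t : ℝ => Real.exp (-(b * t))) (Ioi g) := by
    simpa [neg_mul] using exp_neg_integrableOn_Ioi g hb
  rw [setLIntegral_congr Ioi_ae_eq_Ici.symm,
    ← ofReal_integral_eq_lintegral_ofReal h1 (ae_of_all _ fun t => (Real.exp_pos _).le)]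
  congr 1
  have := integral_exp_mul_Ioi (neg_lt_zero.2 hb) g
  simp only [neg_mul] at this
  rw [this]
  field_simp

theorem lintegral_pow_mul_exp_neg_mul {b : ℝ} (hb : 0 < b) (n : ℕ) :
    ∫⁻ u in Ioi (0 : ℝ), ENNReal.ofReal (u ^ n * Real.exp (-(b * u))) =
      ENNReal.ofReal (n.factorial / b ^ (n + 1)) := by
  have h0 : (0 : ℝ) < n + 1 := by positivity
  have h1 : IntegrableOn (fun u : ℝ => u ^ n * Real.exp (-(b * u))) (Ioi 0) := by
    have := integrableOn_rpow_mul_exp_neg_mul_rpow (s := n) (p := 1) (b := b)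
      (by linarith [n.cast_nonneg (α := ℝ)]) one_pos hb
    simpa [Real.rpow_natCast] using this
  rw [← ofReal_integral_eq_lintegral_ofReal h1]
  · congr 1
    have := Real.integral_rpow_mul_exp_neg_mul_Ioi h0 hb
    simp only [add_sub_cancel_right, Real.rpow_natCast] at this
    rw [this, Real.Gamma_nat_eq_factorial]
    have h2 : (n : ℝ) + 1 = ((n + 1 : ℕ) : ℝ) := by push_cast; rfl
    rw [h2, Real.rpow_natCast, one_div, inv_pow]
    ring
  · filter_upwards [self_mem_ae_restrict measurableSet_Ioi] with u (hu : 0 < u)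
    simp only [Pi.zero_apply]
    positivity

end Integrals

/-- The probability that `t` and `t + u` lie in the same holding interval. -/
noncomputable def holdProb {Ω : Type*} [MeasurableSpace Ω] (P : Measure Ω)
    (E T : ℕ+ → ℕ → Ω → ℝ) (γ : ℕ+ → ℝ) (t u : ℝ) : ℝ≥0∞ :=
  ∑' k : ℕ+ × ℕ, P {ω |
    clockLeft γ (fun x j => E x j ω) (fun x j => T x j ω) (arrival (fun x j => E x j ω) k.1 k.2) ≤
        ENNReal.ofReal t ∧
      ENNReal.ofReal (t + u) <
        clock γ (fun x j => E x j ω) (fun x j => T x j ω) (arrival (fun x j => E x j ω) k.1 k.2)}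

/-- The strict inequality in `clockLeft` excludes the event `k` itself, so its holding time does not
enter. This makes the clock before the event independent of the holding time that follows. -/
theorem measurable_clockLeft_arrival_of {Ω : Type*} {m0 : MeasurableSpace Ω}
    {E T : ℕ+ → ℕ → Ω → ℝ} {k : ℕ+ × ℕ} (hE : ∀ x i, Measurable (E x i))
    (hT : ∀ x i, (x, i) ≠ k → Measurable (T x i)) (γ : ℕ+ → ℝ) :
    Measurable fun ω => clockLeft γ (fun x j => E x j ω) (fun x j => T x j ω)
      (arrival (fun x j => E x j ω) k.1 k.2) := by
  refine Measurable.tsum fun x => Measurable.tsum fun j => ?_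
  by_cases hk : (x, j) = k
  · subst hk
    simp only [lt_irrefl, if_false]
    exact measurable_const
  · refine Measurable.ite ?_ ((hT x j hk).const_mul _).ennreal_ofReal measurable_const
    exact measurableSet_lt (measurable_arrival fun i _ => hE x i)
      (measurable_arrival fun i _ => hE k.1 i)

theorem lintegral_Ioi_ite_exp {w l : ℝ} (hw : 0 < w) (hl : 0 < l) {g : ℝ≥0∞} (hg : g ≠ ∞) :
    ∫⁻ t in Ioi (0 : ℝ), (if g ≤ ENNReal.ofReal t then ENNReal.ofReal (Real.exp (g.toReal / w)) *
        ENNReal.ofReal (Real.exp (-((l + 1 / w) * t))) else 0) =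
      ENNReal.ofReal (1 / (l + 1 / w)) * expNeg l g := by
  have hb : 0 < l + 1 / w := by positivity
  rw [setLIntegral_congr Ioi_ae_eq_Ici]
  have h1 : ∫⁻ t in Ici (0 : ℝ), (if g ≤ ENNReal.ofReal t then
        ENNReal.ofReal (Real.exp (g.toReal / w)) *
        ENNReal.ofReal (Real.exp (-((l + 1 / w) * t))) else 0) =
      ∫⁻ t in Ici (0 : ℝ), (Ici g.toReal).indicator
        (fun t => ENNReal.ofReal (Real.exp (g.toReal / w)) *
          ENNReal.ofReal (Real.exp (-((l + 1 / w) * t)))) t := by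
    refine setLIntegral_congr_fun measurableSet_Ici fun t ht => ?_
    simp only [indicator_apply, mem_Ici]
    exact if_congr (ENNReal.le_ofReal_iff_toReal_le hg ht) rfl rfl
  rw [h1, lintegral_indicator measurableSet_Ici, Measure.restrict_restrict measurableSet_Ici,
    inter_eq_left.2 (Ici_subset_Ici.2 ENNReal.toReal_nonneg),
    lintegral_const_mul' _ _ ENNReal.ofReal_ne_top, lintegral_Ici_exp_neg_mul hb, expNeg,
    ← ENNReal.ofReal_mul (by positivity), ← ENNReal.ofReal_mul (by positivity)]
  congr 1
  rw [mul_div_assoc', ← Real.exp_add, one_div_mul_eq_div]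
  congr 2
  field_simp
  ring

/-- The exponential tail makes the integrand factor into a function of `u` and one of `t`. The
`u`-integral gives `n! / (l + 1 / w) ^ (n + 1)`. The `t`-integral, started at `G`, gives one more
factor `1 / (l + 1 / w)` and leaves `exp (-l G)`. -/
theorem lintegral_lintegral_hold_kernel {Ω : Type*} [MeasurableSpace Ω] {P : Measure Ω}
    [SFinite P] {G : Ω → ℝ≥0∞} (hmG : Measurable G) (hfin : ∀ᵐ ω ∂P, G ω ≠ ∞) {w l : ℝ}
    (hw : 0 < w) (hl : 0 < l) (n : ℕ) :
    ∫⁻ t in Ioi (0 : ℝ), ∫⁻ u in Ioi (0 : ℝ),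
        ENNReal.ofReal (Real.exp (-(l * (t + u))) * u ^ n) *
          ∫⁻ ω, (if G ω ≤ ENNReal.ofReal t
            then ENNReal.ofReal (Real.exp (-((t + u - (G ω).toReal) / w))) else 0) ∂P =
      ENNReal.ofReal (n.factorial * (w / (1 + l * w)) ^ (n + 2)) * ∫⁻ ω, expNeg l (G ω) ∂P := by
  have hb : 0 < l + 1 / w := by positivity
  set A : ℝ → Ω → ℝ≥0∞ := fun t ω => if G ω ≤ ENNReal.ofReal t
    then ENNReal.ofReal (Real.exp ((G ω).toReal / w)) *
      ENNReal.ofReal (Real.exp (-((l + 1 / w) * t))) else 0 with hA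
  have hmA : Measurable (Function.uncurry A) := by
    refine Measurable.ite (measurableSet_le (hmG.comp measurable_snd) (by fun_prop)) ?_
      measurable_const
    fun_prop
  have hmAint : Measurable fun t => ∫⁻ ω, A t ω ∂P := hmA.lintegral_prod_right'
  have hterm : ∀ t, ∀ u ∈ Ioi (0 : ℝ),
      ENNReal.ofReal (Real.exp (-(l * (t + u))) * u ^ n) *
          ∫⁻ ω, (if G ω ≤ ENNReal.ofReal t
            then ENNReal.ofReal (Real.exp (-((t + u - (G ω).toReal) / w))) else 0) ∂P =
        ENNReal.ofReal (u ^ n * Real.exp (-((l + 1 / w) * u))) * ∫⁻ ω, A t ω ∂P := by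
    intro t u (hu : 0 < u)
    rw [← lintegral_const_mul' _ _ ENNReal.ofReal_ne_top,
      ← lintegral_const_mul' _ _ ENNReal.ofReal_ne_top]
    refine lintegral_congr fun ω => ?_
    simp only [hA]
    split_ifs with hle
    · rw [← ENNReal.ofReal_mul (by positivity), ← ENNReal.ofReal_mul (by positivity),
        ← ENNReal.ofReal_mul (by positivity)]
      congr 1
      have hexp : Real.exp (-(l * (t + u))) * Real.exp (-((t + u - (G ω).toReal) / w)) =
          Real.exp (-((l + 1 / w) * u)) * (Real.exp ((G ω).toReal / w) *
            Real.exp (-((l + 1 / w) * t))) := by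
        rw [← Real.exp_add, ← Real.exp_add, ← Real.exp_add]
        congr 1
        field_simp
        ring
      linear_combination u ^ n * hexp
    · simp
  calc _ = ∫⁻ t in Ioi (0 : ℝ), ∫⁻ u in Ioi (0 : ℝ),
        ENNReal.ofReal (u ^ n * Real.exp (-((l + 1 / w) * u))) * ∫⁻ ω, A t ω ∂P :=
      lintegral_congr fun t => setLIntegral_congr_fun measurableSet_Ioi fun u hu => hterm t u hu
    _ = ENNReal.ofReal (n.factorial / (l + 1 / w) ^ (n + 1)) *
        ∫⁻ ω, (∫⁻ t in Ioi (0 : ℝ), A t ω) ∂P := by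
      have h1 : ∀ t, ∫⁻ u in Ioi (0 : ℝ),
          ENNReal.ofReal (u ^ n * Real.exp (-((l + 1 / w) * u))) * ∫⁻ ω, A t ω ∂P =
          ENNReal.ofReal (n.factorial / (l + 1 / w) ^ (n + 1)) * ∫⁻ ω, A t ω ∂P := by
        intro t
        rw [lintegral_mul_const _ (by fun_prop), lintegral_pow_mul_exp_neg_mul hb]
      simp_rw [h1]
      rw [lintegral_const_mul _ hmAint, lintegral_lintegral_swap hmA.aemeasurable]
    _ = ENNReal.ofReal (n.factorial / (l + 1 / w) ^ (n + 1)) *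
        ∫⁻ ω, ENNReal.ofReal (1 / (l + 1 / w)) * expNeg l (G ω) ∂P := by
      congr 1
      refine lintegral_congr_ae ?_
      filter_upwards [hfin] with ω hω
      exact lintegral_Ioi_ite_exp hw hl hω
    _ = _ := by
      rw [lintegral_const_mul' _ _ ENNReal.ofReal_ne_top, ← mul_assoc,
        ← ENNReal.ofReal_mul (by positivity)]
      congr 2
      have h1 : l + 1 / w = (1 + l * w) / w := by field_simp; ring
      have h2 : 0 < 1 + l * w := by positivity
      rw [h1, div_pow, div_pow]
      field_simp
      ring

namespace IsMeasurableDriving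

variable {Ω : Type*} [MeasurableSpace Ω] {P : Measure Ω} {E T : ℕ+ → ℕ → Ω → ℝ}
  {γ : ℕ+ → ℝ}

theorem measurable_clockLeft_arrival (h : IsMeasurableDriving E T P) (k : ℕ+ × ℕ) :
    Measurable fun ω => clockLeft γ (fun x j => E x j ω) (fun x j => T x j ω)
      (arrival (fun x j => E x j ω) k.1 k.2) :=
  Measurable.tsum fun x => measurable_stateClock (h.measurable_E x) (h.measurable_T x)
    (measurable_arrival fun i _ => h.measurable_E k.1 i) _

theorem measurable_clock_arrival (h : IsMeasurableDriving E T P) (k : ℕ+ × ℕ) :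
    Measurable fun ω => clock γ (fun x j => E x j ω) (fun x j => T x j ω)
      (arrival (fun x j => E x j ω) k.1 k.2) := by
  refine Measurable.tsum fun x => Measurable.tsum fun j => Measurable.ite ?_ ?_ measurable_const
  · exact measurableSet_le (measurable_arrival fun i _ => h.measurable_E x i)
      (measurable_arrival fun i _ => h.measurable_E k.1 i)
  · exact ((h.measurable_T x j).const_mul _).ennreal_ofReal

theorem measurableSet_hold (h : IsMeasurableDriving E T P) (k : ℕ+ × ℕ) :
    MeasurableSet {z : (ℝ × ℝ) × Ω |
      clockLeft γ (fun x j => E x j z.2) (fun x j => T x j z.2)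
        (arrival (fun x j => E x j z.2) k.1 k.2) ≤ ENNReal.ofReal z.1.1 ∧
      ENNReal.ofReal (z.1.1 + z.1.2) < clock γ (fun x j => E x j z.2) (fun x j => T x j z.2)
        (arrival (fun x j => E x j z.2) k.1 k.2)} :=
  (measurableSet_le ((h.measurable_clockLeft_arrival k).comp measurable_snd)
    (by fun_prop)).inter (measurableSet_lt (by fun_prop)
      ((h.measurable_clock_arrival k).comp measurable_snd))

theorem measurable_holdProb [SFinite P] (h : IsMeasurableDriving E T P) :
    Measurable fun q : ℝ × ℝ => holdProb P E T γ q.1 q.2 :=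
  Measurable.tsum fun k => measurable_measure_prodMk_left (h.measurableSet_hold k)

variable [IsProbabilityMeasure P]

/-- By `kPath_const_iff` the event is the union over `k` of the events in `holdProb`, which are
almost surely disjoint. -/
theorem measure_kPath_const (h : IsMeasurableDriving E T P) (hγ : ∀ x, 0 < γ x)
    (hsum : ∑' x, ENNReal.ofReal (γ x) ≠ ∞) {t u : ℝ} (ht : 0 ≤ t) (hu : 0 < u) :
    P {ω | ∀ s ∈ Icc t (t + u), kPath γ (fun x j => E x j ω) (fun x j => T x j ω) s =
      kPath γ (fun x j => E x j ω) (fun x j => T x j ω) t} = holdProb P E T γ t u := by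
  have hgood := h.ae_isGoodPath hγ hsum
  rw [holdProb, ← measure_iUnion₀]
  · refine measure_congr (eventuallyEq_set.2 ?_)
    filter_upwards [hgood] with ω hω
    rw [mem_iUnion]
    exact hω.kPath_const_iff ht hu
  · intro k l hkl
    refine measure_eq_zero_iff_ae_notMem.2 ?_
    filter_upwards [hgood] with ω hω h'
    exact hkl (hω.unique_index hu.le h'.1 h'.2)
  · intro k
    exact (measurable_prodMk_left (h.measurableSet_hold k) : MeasurableSet
      (Prod.mk (t, u) ⁻¹' _)).nullMeasurableSet

theorem agingFn_eq_holdProb (h : IsMeasurableDriving E T P) (hγ : ∀ x, 0 < γ x)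
    (hsum : ∑' x, ENNReal.ofReal (γ x) ≠ ∞) {t θ : ℝ} (ht : 0 < t) (hθ : 0 < θ) :
    agingFn P E T γ t θ = (holdProb P E T γ t (θ * t)).toReal := by
  rw [← h.measure_kPath_const hγ hsum ht.le (mul_pos hθ ht)]
  rfl

theorem holdProb_le_one (h : IsMeasurableDriving E T P) (hγ : ∀ x, 0 < γ x)
    (hsum : ∑' x, ENNReal.ofReal (γ x) ≠ ∞) {t u : ℝ} (ht : 0 ≤ t) (hu : 0 < u) :
    holdProb P E T γ t u ≤ 1 := by
  rw [← h.measure_kPath_const hγ hsum ht hu]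
  exact prob_le_one

/-- The clock after the event is `G + γ T` with `T` independent of `G`; conditionally on `G ≤ t`,
the event says `T > (t + u - G) / γ`. -/
theorem measure_hold_eq (h : IsMeasurableDriving E T P) (hγ : ∀ x, 0 < γ x)
    (hsum : ∑' x, ENNReal.ofReal (γ x) ≠ ∞) (k : ℕ+ × ℕ) {t u : ℝ} (ht : 0 ≤ t) (hu : 0 ≤ u) :
    P {ω | clockLeft γ (fun x j => E x j ω) (fun x j => T x j ω)
          (arrival (fun x j => E x j ω) k.1 k.2) ≤ ENNReal.ofReal t ∧
      ENNReal.ofReal (t + u) < clock γ (fun x j => E x j ω) (fun x j => T x j ω)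
          (arrival (fun x j => E x j ω) k.1 k.2)} =
      ∫⁻ ω, (fun g : ℝ≥0∞ => if g ≤ ENNReal.ofReal t
        then ENNReal.ofReal (Real.exp (-((t + u - g.toReal) / γ k.1))) else 0)
        (clockLeft γ (fun x j => E x j ω) (fun x j => T x j ω)
          (arrival (fun x j => E x j ω) k.1 k.2)) ∂P := by
  set G : Ω → ℝ≥0∞ := fun ω => clockLeft γ (fun x j => E x j ω) (fun x j => T x j ω)
    (arrival (fun x j => E x j ω) k.1 k.2) with hG
  have hmG : Measurable G := h.measurable_clockLeft_arrival k
  have hmG' : Measurable[blk (driving E T) {Sum.inr k}ᶜ] G :=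
    measurable_clockLeft_arrival_of (k := k)
      (fun x i => measurable_blk (X := driving E T) (i := Sum.inl (x, i)) (by simp))
      (fun x i hxi => measurable_blk (X := driving E T) (i := Sum.inr (x, i)) (by simpa using hxi)) γ
  have hmT : Measurable[blk (driving E T) {Sum.inr k}] (T k.1 k.2) :=
    measurable_blk (X := driving E T) (i := Sum.inr k) (mem_singleton _)
  have hind : IndepFun G (T k.1 k.2) P := by
    rw [IndepFun_iff_Indep]
    exact indep_of_indep_of_le_left (indep_of_indep_of_le_right
      (indep_blk h.measurable_driving h.iIndepFun_driving disjoint_compl_left)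
      hmT.comap_le) hmG'.comap_le
  set f : ℝ≥0∞ → ℝ → ℝ≥0∞ := fun g v =>
    if g ≤ ENNReal.ofReal t ∧ (t + u - g.toReal) / γ k.1 < v then 1 else 0 with hf
  have hmf : Measurable (Function.uncurry f) := by
    refine Measurable.ite ?_ measurable_const measurable_const
    exact (measurableSet_le measurable_fst measurable_const).inter
      (measurableSet_lt (by fun_prop) measurable_snd)
  have hinner : ∀ g, ∫⁻ ω, f g (T k.1 k.2 ω) ∂P = if g ≤ ENNReal.ofReal t
        then ENNReal.ofReal (Real.exp (-((t + u - g.toReal) / γ k.1))) else 0 := by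
    intro g
    by_cases hg : g ≤ ENNReal.ofReal t
    · have hgt : g.toReal ≤ t := ENNReal.toReal_le_of_le_ofReal ht hg
      have h0 : 0 ≤ (t + u - g.toReal) / γ k.1 := div_nonneg (by linarith) (hγ k.1).le
      rw [if_pos hg, ← measure_Ioi_of_hasLaw_exp (h.hasLaw_T k.1 k.2) (h.measurable_T k.1 k.2) h0,
        ← lintegral_indicator_one (measurableSet_lt measurable_const (h.measurable_T k.1 k.2))]
      refine lintegral_congr fun ω => ?_
      simp [hf, hg, indicator_apply]
    · simp [hf, hg]
  have h1 := lintegral_comp_prodMk_of_indepFun hmG (h.measurable_T k.1 k.2) hind hmf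
  simp_rw [hinner] at h1
  have hset : MeasurableSet {ω | G ω ≤ ENNReal.ofReal t ∧
      ENNReal.ofReal (t + u) < clock γ (fun x j => E x j ω) (fun x j => T x j ω)
          (arrival (fun x j => E x j ω) k.1 k.2)} :=
    (measurableSet_le hmG measurable_const).inter
      (measurableSet_lt measurable_const (h.measurable_clock_arrival k))
  refine Eq.trans ?_ h1
  rw [← lintegral_indicator_one hset]
  refine lintegral_congr_ae ?_
  filter_upwards [h.ae_isGoodPath hγ hsum] with ω hω
  rw [indicator_apply]
  simp only [hf]
  refine if_congr (and_congr_right fun hg => ?_) rfl rfl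
  have hγk := hγ k.1
  have hT : 0 < γ k.1 * T k.1 k.2 ω := hω.pos k.1 k.2
  have hGf : G ω ≠ ∞ := hω.clockLeft_ne_top _
  rw [hω.clock_arrival k, ENNReal.ofReal_lt_iff_lt_toReal (by linarith)
    (ENNReal.add_ne_top.2 ⟨hGf, ENNReal.ofReal_ne_top⟩),
    ENNReal.toReal_add hGf ENNReal.ofReal_ne_top, ENNReal.toReal_ofReal hT.le,
    div_lt_iff₀ hγk]
  constructor <;> intro h' <;> simp only [hG] at h' ⊢ <;> linarith

/-- The double Laplace transform of the hold probabilities. -/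
theorem lintegral_lintegral_holdProb (h : IsMeasurableDriving E T P) (hγ : ∀ x, 0 < γ x)
    (hsum : ∑' x, ENNReal.ofReal (γ x) ≠ ∞) {l : ℝ} (hl : 0 < l) (n : ℕ) :
    ∫⁻ t in Ioi (0 : ℝ), ∫⁻ u in Ioi (0 : ℝ),
        ENNReal.ofReal (Real.exp (-(l * (t + u))) * u ^ n) * holdProb P E T γ t u =
      (powerSum γ 1 l)⁻¹ * ∑' x, ENNReal.ofReal (n.factorial * (γ x / (1 + l * γ x)) ^ (n + 2)) := by
  have hmeas : ∀ k : ℕ+ × ℕ, Measurable fun q : ℝ × ℝ =>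
      ENNReal.ofReal (Real.exp (-(l * (q.1 + q.2))) * q.2 ^ n) * P {ω |
        clockLeft γ (fun x j => E x j ω) (fun x j => T x j ω)
            (arrival (fun x j => E x j ω) k.1 k.2) ≤ ENNReal.ofReal q.1 ∧
        ENNReal.ofReal (q.1 + q.2) < clock γ (fun x j => E x j ω) (fun x j => T x j ω)
            (arrival (fun x j => E x j ω) k.1 k.2)} := fun k =>
    Measurable.mul (by fun_prop) (measurable_measure_prodMk_left (h.measurableSet_hold k))
  simp only [holdProb, ← ENNReal.tsum_mul_left]
  calc
    _ = ∑' k : ℕ+ × ℕ, ∫⁻ t in Ioi (0 : ℝ), ∫⁻ u in Ioi (0 : ℝ),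
        ENNReal.ofReal (Real.exp (-(l * (t + u))) * u ^ n) * P {ω |
          clockLeft γ (fun x j => E x j ω) (fun x j => T x j ω)
              (arrival (fun x j => E x j ω) k.1 k.2) ≤ ENNReal.ofReal t ∧
          ENNReal.ofReal (t + u) < clock γ (fun x j => E x j ω) (fun x j => T x j ω)
              (arrival (fun x j => E x j ω) k.1 k.2)} := by
      refine Eq.trans (lintegral_congr fun t => ?_)
        (lintegral_tsum fun k => (hmeas k).lintegral_prod_right'.aemeasurable)
      exact lintegral_tsum fun k => ((hmeas k).comp measurable_prodMk_left).aemeasurable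
    _ = ∑' k : ℕ+ × ℕ, ENNReal.ofReal (n.factorial * (γ k.1 / (1 + l * γ k.1)) ^ (n + 2)) *
        ∫⁻ ω, expNeg l (clockLeft γ (fun x j => E x j ω) (fun x j => T x j ω)
          (arrival (fun x j => E x j ω) k.1 k.2)) ∂P := by
      refine tsum_congr fun k => ?_
      rw [← lintegral_lintegral_hold_kernel (h.measurable_clockLeft_arrival k)
        ((h.ae_clockLeft_ne_top hγ hsum).mono fun ω hω => hω _) (hγ k.1) hl n]
      refine setLIntegral_congr_fun measurableSet_Ioi fun t ht =>
        setLIntegral_congr_fun measurableSet_Ioi fun u hu => ?_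
      congr 1
      exact h.measure_hold_eq hγ hsum k (le_of_lt ht) (le_of_lt hu)
    _ = _ := by
      refine (ENNReal.tsum_prod (f := fun x j =>
        ENNReal.ofReal (n.factorial * (γ x / (1 + l * γ x)) ^ (n + 2)) *
        ∫⁻ ω, expNeg l (clockLeft γ (fun x j => E x j ω) (fun x j => T x j ω)
          (arrival (fun x j => E x j ω) x j)) ∂P)).trans ?_
      refine tsum_congr fun x => ?_
      -- Only the renewal sum depends on `j`, and it equals `1 / φ` for every state `x`.
      rw [ENNReal.tsum_mul_left, h.tsum_lintegral_expNeg_clockLeft_arrival hγ hsum hl x, mul_comm]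

end IsMeasurableDriving

/-! ### Uniqueness from moments -/

section Moments

theorem integrable_of_continuous_of_ae_mem_Icc {μ : Measure ℝ} [IsFiniteMeasure μ]
    (hμ : ∀ᵐ x ∂μ, x ∈ Icc (0 : ℝ) 1) {f : ℝ → ℝ} (hf : Continuous f) : Integrable f μ := by
  obtain ⟨C, hC⟩ := isCompact_Icc.exists_bound_of_continuousOn (hf.continuousOn (s := Icc 0 1))
  exact Integrable.of_bound hf.aestronglyMeasurable C (hμ.mono fun x hx => hC x hx)

theorem integral_polynomial_eq_of_moments {μ ν : Measure ℝ} [IsFiniteMeasure μ]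
    [IsFiniteMeasure ν] (hμ : ∀ᵐ x ∂μ, x ∈ Icc (0 : ℝ) 1) (hν : ∀ᵐ x ∂ν, x ∈ Icc (0 : ℝ) 1)
    (h : ∀ n : ℕ, ∫ x, x ^ n ∂μ = ∫ x, x ^ n ∂ν) (p : Polynomial ℝ) :
    ∫ x, p.eval x ∂μ = ∫ x, p.eval x ∂ν := by
  induction p using Polynomial.induction_on' with
  | add p q hp hq =>
    simp only [Polynomial.eval_add]
    rw [integral_add (integrable_of_continuous_of_ae_mem_Icc hμ p.continuous)
        (integrable_of_continuous_of_ae_mem_Icc hμ q.continuous),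
      integral_add (integrable_of_continuous_of_ae_mem_Icc hν p.continuous)
        (integrable_of_continuous_of_ae_mem_Icc hν q.continuous), hp, hq]
  | monomial n a =>
    simp only [Polynomial.eval_monomial]
    rw [integral_const_mul, integral_const_mul, h]

/-- Finite measures on `[0, 1]` are determined by their moments. -/
theorem measure_ext_of_moments {μ ν : Measure ℝ} [IsFiniteMeasure μ] [IsFiniteMeasure ν]
    (hμ : ∀ᵐ x ∂μ, x ∈ Icc (0 : ℝ) 1) (hν : ∀ᵐ x ∂ν, x ∈ Icc (0 : ℝ) 1)
    (h : ∀ n : ℕ, ∫ x, x ^ n ∂μ = ∫ x, x ^ n ∂ν) : μ = ν := by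
  refine ext_of_forall_integral_eq_of_IsFiniteMeasure fun f => ?_
  refine eq_of_forall_dist_le fun ε hε => ?_
  -- Approximating by a polynomial within `ε / M` costs at most `ε` over both measures; the added
  -- `1` keeps `M` positive.
  set M : ℝ := μ.real univ + ν.real univ + 1 with hM
  have hM0 : 0 < M := by positivity
  obtain ⟨p, hp⟩ := exists_polynomial_near_of_continuousOn 0 1 f f.continuous.continuousOn (ε / M)
    (by positivity)
  have key : ∀ {ρ : Measure ℝ} [IsFiniteMeasure ρ], (∀ᵐ x ∂ρ, x ∈ Icc (0 : ℝ) 1) →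
      |∫ x, p.eval x ∂ρ - ∫ x, f x ∂ρ| ≤ ε / M * ρ.real univ := by
    intro ρ _ hρ
    rw [← integral_sub (integrable_of_continuous_of_ae_mem_Icc hρ p.continuous)
      (integrable_of_continuous_of_ae_mem_Icc hρ f.continuous), ← Real.norm_eq_abs]
    exact norm_integral_le_of_norm_le_const (hρ.mono fun x hx => (hp x hx).le)
  have h1 := key hμ
  have h2 := key hν
  rw [integral_polynomial_eq_of_moments hμ hν h p] at h1
  have h3 : ε / M * μ.real univ + ε / M * ν.real univ ≤ ε := by
    have : ε / M * M = ε := by field_simp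
    nlinarith [div_pos hε hM0]
  rw [Real.dist_eq]
  rw [abs_le] at h1 h2 ⊢
  constructor <;> linarith

theorem measurable_div_one_add : Measurable fun θ : ℝ => θ / (1 + θ) := by fun_prop

theorem div_one_add_mem_Icc {θ : ℝ} (hθ : 0 < θ) : θ / (1 + θ) ∈ Icc (0 : ℝ) 1 :=
  ⟨by positivity, (div_le_one (by positivity)).2 (by linarith)⟩

/-- The weight `1 / (1 + θ)²` and the `n`-th power of the image point combine to the kernel `θⁿ / (1
+ θ)^{n+2}` produced by the scaling limit. -/
theorem integral_pow_map_div_one_add {f : ℝ → ℝ≥0∞}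
    (hf : AEMeasurable f (volume.restrict (Ioi 0))) (n : ℕ) :
    ∫ x, x ^ n ∂(((volume.restrict (Ioi 0)).withDensity
        fun θ => ENNReal.ofReal (1 / (1 + θ) ^ 2) * f θ).map fun θ : ℝ => θ / (1 + θ)) =
      (∫⁻ θ in Ioi (0 : ℝ), ENNReal.ofReal (θ ^ n / (1 + θ) ^ (n + 2)) * f θ).toReal := by
  have hd : AEMeasurable (fun θ : ℝ => ENNReal.ofReal (1 / (1 + θ) ^ 2) * f θ)
      (volume.restrict (Ioi 0)) := AEMeasurable.mul (by fun_prop) hf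
  rw [integral_map measurable_div_one_add.aemeasurable (by fun_prop),
    integral_eq_lintegral_of_nonneg_ae,
    lintegral_withDensity_eq_lintegral_mul₀ hd (by fun_prop)]
  · congr 1
    refine setLIntegral_congr_fun measurableSet_Ioi fun θ (hθ : 0 < θ) => ?_
    simp only [Pi.mul_apply]
    rw [mul_right_comm, ← ENNReal.ofReal_mul (by positivity)]
    congr 2
    rw [div_pow, pow_add]
    field_simp
  · refine (withDensity_absolutelyContinuous _ _).ae_le ?_
    filter_upwards [self_mem_ae_restrict measurableSet_Ioi] with θ (hθ : 0 < θ)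
    simp only [Pi.zero_apply]
    positivity
  · exact (measurable_div_one_add.pow_const n).aestronglyMeasurable

/-- Functions on the half-line are determined by the moments of their image under the
change of variables `θ / (1 + θ)`. -/
theorem ae_eq_of_moments_div_one_add {f g : ℝ → ℝ≥0∞}
    (hf : AEMeasurable f (volume.restrict (Ioi 0))) (hg : AEMeasurable g (volume.restrict (Ioi 0)))
    (hfin : ∫⁻ θ in Ioi (0 : ℝ), ENNReal.ofReal (1 / (1 + θ) ^ 2) * f θ ≠ ∞)
    (h : ∀ n : ℕ, ∫⁻ θ in Ioi (0 : ℝ), ENNReal.ofReal (θ ^ n / (1 + θ) ^ (n + 2)) * f θ =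
      ∫⁻ θ in Ioi (0 : ℝ), ENNReal.ofReal (θ ^ n / (1 + θ) ^ (n + 2)) * g θ) :
    f =ᵐ[volume.restrict (Ioi 0)] g := by
  have hfd : AEMeasurable (fun θ : ℝ => ENNReal.ofReal (1 / (1 + θ) ^ 2) * f θ)
      (volume.restrict (Ioi 0)) := AEMeasurable.mul (by fun_prop) hf
  have hgd : AEMeasurable (fun θ : ℝ => ENNReal.ofReal (1 / (1 + θ) ^ 2) * g θ)
      (volume.restrict (Ioi 0)) := AEMeasurable.mul (by fun_prop) hg
  have hgfin : ∫⁻ θ in Ioi (0 : ℝ), ENNReal.ofReal (1 / (1 + θ) ^ 2) * g θ ≠ ∞ := by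
    have := h 0
    simp only [pow_zero, zero_add] at this
    rwa [← this]
  have hmem : ∀ k : ℝ → ℝ≥0∞, ∀ᵐ x ∂(((volume.restrict (Ioi 0)).withDensity k).map
      fun θ : ℝ => θ / (1 + θ)), x ∈ Icc (0 : ℝ) 1 := by
    intro k
    refine (ae_map_iff measurable_div_one_add.aemeasurable measurableSet_Icc).2 ?_
    refine (withDensity_absolutelyContinuous _ _).ae_le ?_
    filter_upwards [self_mem_ae_restrict measurableSet_Ioi] with θ hθ
    exact div_one_add_mem_Icc hθ
  -- `v / (1 - v)` inverts `θ / (1 + θ)`, so equality of the image measures returns to the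
  -- half-line.
  have hback : ∀ k : ℝ → ℝ≥0∞, (((volume.restrict (Ioi 0)).withDensity k).map
      fun θ : ℝ => θ / (1 + θ)).map (fun v => v / (1 - v)) =
      (volume.restrict (Ioi 0)).withDensity k := by
    intro k
    rw [Measure.map_map (by fun_prop) measurable_div_one_add]
    conv_rhs => rw [← Measure.map_id (μ := (volume.restrict (Ioi 0)).withDensity k)]
    refine Measure.map_congr ((withDensity_absolutelyContinuous _ _).ae_le ?_)
    filter_upwards [self_mem_ae_restrict measurableSet_Ioi] with θ (hθ : 0 < θ)
    simp only [Function.comp_apply, id_eq]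
    have h1 : 0 < 1 + θ := by positivity
    have h2 : 1 - θ / (1 + θ) = 1 / (1 + θ) := by field_simp; ring
    rw [h2]
    field_simp
  have := isFiniteMeasure_withDensity hfin
  have := isFiniteMeasure_withDensity hgfin
  have hmap := measure_ext_of_moments (hmem fun θ => ENNReal.ofReal (1 / (1 + θ) ^ 2) * f θ)
    (hmem fun θ => ENNReal.ofReal (1 / (1 + θ) ^ 2) * g θ) fun n => by
      rw [integral_pow_map_div_one_add hf n, integral_pow_map_div_one_add hg n, h n]
  have heq := congrArg (fun m : Measure ℝ => m.map fun v => v / (1 - v)) hmap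
  simp only [hback] at heq
  filter_upwards [(withDensity_eq_iff hfd hgd hfin).1 heq,
    self_mem_ae_restrict measurableSet_Ioi] with θ hθ (hθ0 : 0 < θ)
  exact (ENNReal.mul_right_inj (by simp; positivity) ENNReal.ofReal_ne_top).1 hθ

end Moments

/-! ### Integrals of the moment kernel -/

section HalfLine

theorem hasDerivAt_div_one_add_pow {θ : ℝ} (hθ : 0 ≤ θ) (n : ℕ) :
    HasDerivAt (fun θ : ℝ => (θ / (1 + θ)) ^ (n + 1) / (n + 1))
      (θ ^ n / (1 + θ) ^ (n + 2)) θ := by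
  have h0 : (1 + θ) ≠ 0 := by positivity
  have h1 : HasDerivAt (fun θ : ℝ => θ / (1 + θ)) ((1 * (1 + θ) - θ * 1) / (1 + θ) ^ 2) θ :=
    (hasDerivAt_id θ).div ((hasDerivAt_id θ).const_add 1) h0
  refine ((h1.pow (n + 1)).div_const ((n : ℝ) + 1)).congr_deriv ?_
  have : (n : ℝ) + 1 ≠ 0 := by positivity
  push_cast
  rw [div_pow]
  field_simp
  ring

theorem lintegral_Ioo_pow_div_one_add {b : ℝ} (hb : 0 ≤ b) (n : ℕ) :
    ∫⁻ θ in Ioo 0 b, ENNReal.ofReal (θ ^ n / (1 + θ) ^ (n + 2)) =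
      ENNReal.ofReal ((b / (1 + b)) ^ (n + 1) / (n + 1)) := by
  have hc : ContinuousOn (fun θ : ℝ => θ ^ n / (1 + θ) ^ (n + 2)) (uIcc 0 b) := by
    refine ContinuousOn.div (by fun_prop) (by fun_prop) fun θ hθ => ?_
    rw [uIcc_of_le hb] at hθ
    have := hθ.1
    positivity
  have h := intervalIntegral.integral_eq_sub_of_hasDerivAt
    (fun θ hθ => hasDerivAt_div_one_add_pow ((uIcc_of_le hb ▸ hθ : θ ∈ Icc 0 b)).1 n)
    hc.intervalIntegrable
  rw [intervalIntegral.integral_of_le hb, integral_Ioc_eq_integral_Ioo] at h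
  simp only [zero_div, ne_eq, Nat.add_eq_zero_iff, one_ne_zero, and_false, not_false_eq_true,
    zero_pow, sub_zero] at h
  rw [← h, ofReal_integral_eq_lintegral_ofReal]
  · exact (hc.integrableOn_compact isCompact_uIcc).mono_set (Ioo_subset_Icc_self.trans
      (uIcc_of_le hb).ge)
  · filter_upwards [self_mem_ae_restrict measurableSet_Ioo] with θ hθ
    have := hθ.1
    simp only [Pi.zero_apply]
    positivity

theorem lintegral_Ioi_pow_div_one_add_ne_top (n : ℕ) :
    ∫⁻ θ in Ioi (0 : ℝ), ENNReal.ofReal (θ ^ n / (1 + θ) ^ (n + 2)) ≠ ∞ := by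
  have hint : IntegrableOn (fun θ : ℝ => (θ + 1) ^ (-2 : ℝ)) (Ioi 0) :=
    integrableOn_add_rpow_Ioi_of_lt (by norm_num) (by norm_num)
  refine ne_top_of_le_ne_top hint.lintegral_lt_top.ne
    (setLIntegral_mono' measurableSet_Ioi fun θ (hθ : 0 < θ) => ENNReal.ofReal_le_ofReal ?_)
  have h1 : (θ + 1) ^ (-2 : ℝ) = 1 / (1 + θ) ^ 2 := by
    rw [Real.rpow_neg (by positivity), add_comm]
    norm_num
  have h2 : θ ^ n / (1 + θ) ^ (n + 2) = (θ / (1 + θ)) ^ n * (1 / (1 + θ) ^ 2) := by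
    rw [div_pow, pow_add]
    field_simp
  rw [h1, h2]
  exact mul_le_of_le_one_left (by positivity)
    (pow_le_one₀ (div_one_add_mem_Icc hθ).1 (div_one_add_mem_Icc hθ).2)

end HalfLine

/-! ### The scaling limit of the double Laplace transform -/

section Scaling

theorem lintegral_Ioi_comp_mul_left {f : ℝ → ℝ≥0∞} (hf : Measurable f) {a : ℝ} (ha : 0 < a) :
    ∫⁻ x in Ioi (0 : ℝ), f x = ENNReal.ofReal a * ∫⁻ x in Ioi (0 : ℝ), f (a * x) := by
  rw [← lintegral_indicator measurableSet_Ioi, ← lintegral_indicator measurableSet_Ioi]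
  conv_lhs => rw [← Real.smul_map_volume_mul_left ha.ne']
  rw [lintegral_smul_measure, lintegral_map (hf.indicator measurableSet_Ioi) (by fun_prop),
    abs_of_pos ha, smul_eq_mul]
  congr 1
  refine lintegral_congr fun x => ?_
  simp only [indicator_apply, mem_Ioi, mul_pos_iff_of_pos_left ha]

/-- Substitute `u = tθ`, then `t = s / l`: the Jacobians and the power `uⁿ` give `θⁿ s^{n+1}` times
`l ^ (-(n + 2))`, which the prefactor removes. -/
theorem lintegral_lintegral_scaling {H : ℝ × ℝ → ℝ≥0∞} (hH : Measurable H) {l : ℝ} (hl : 0 < l)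
    (n : ℕ) :
    ENNReal.ofReal (l ^ (n + 2)) * ∫⁻ t in Ioi (0 : ℝ), ∫⁻ u in Ioi (0 : ℝ),
        ENNReal.ofReal (Real.exp (-(l * (t + u))) * u ^ n) * H (t, u) =
      ∫⁻ θ in Ioi (0 : ℝ), ENNReal.ofReal (θ ^ n) * ∫⁻ s in Ioi (0 : ℝ),
        ENNReal.ofReal (s ^ (n + 1) * Real.exp (-((1 + θ) * s))) *
          H (l⁻¹ * s, θ * (l⁻¹ * s)) := by
  have hm : Measurable fun q : ℝ × ℝ =>
      ENNReal.ofReal (Real.exp (-(l * (q.1 + q.2))) * q.2 ^ n) * H q := by fun_prop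
  have h1 : ∀ t ∈ Ioi (0 : ℝ), ∫⁻ u in Ioi (0 : ℝ),
        ENNReal.ofReal (Real.exp (-(l * (t + u))) * u ^ n) * H (t, u) =
      ENNReal.ofReal t * ∫⁻ θ in Ioi (0 : ℝ),
        ENNReal.ofReal (Real.exp (-(l * (t + t * θ))) * (t * θ) ^ n) * H (t, t * θ) :=
    fun t ht => lintegral_Ioi_comp_mul_left (hm.comp measurable_prodMk_left) ht
  have hm2 : Measurable fun q : ℝ × ℝ => ENNReal.ofReal (l ^ (n + 2)) * (ENNReal.ofReal q.1 *
      (ENNReal.ofReal (Real.exp (-(l * (q.1 + q.1 * q.2))) * (q.1 * q.2) ^ n) *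
        H (q.1, q.1 * q.2))) := by fun_prop
  rw [setLIntegral_congr_fun measurableSet_Ioi h1]
  simp_rw [← lintegral_const_mul' _ _ ENNReal.ofReal_ne_top]
  rw [lintegral_lintegral_swap hm2.aemeasurable]
  refine setLIntegral_congr_fun measurableSet_Ioi fun θ (hθ : 0 < θ) => ?_
  refine (lintegral_Ioi_comp_mul_left (hm2.comp (measurable_prodMk_right (y := θ)))
    (inv_pos.2 hl)).trans ?_
  rw [← lintegral_const_mul' _ _ ENNReal.ofReal_ne_top]
  refine setLIntegral_congr_fun measurableSet_Ioi fun s (hs : 0 < s) => ?_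
  simp only [Function.comp_apply]
  rw [mul_comm θ (l⁻¹ * s)]
  simp only [← mul_assoc]
  congr 1
  rw [← ENNReal.ofReal_mul (by positivity), ← ENNReal.ofReal_mul (by positivity),
    ← ENNReal.ofReal_mul (by positivity), ← ENNReal.ofReal_mul (by positivity)]
  congr 1
  have h2 : l * (l⁻¹ * s + l⁻¹ * s * θ) = (1 + θ) * s := by field_simp
  rw [h2]
  field_simp
  rw [div_pow]
  field_simp
  ring

/-- After the substitution, `l → ∞` sends the time `s / l` to zero at fixed `θ`, so `hL` applies
inside the integrals. As `H ≤ 1`, dropping `H` gives a dominating function, first in `s` and then in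
`θ`. -/
theorem tendsto_lintegral_lintegral_scaling {H : ℝ × ℝ → ℝ≥0∞} (hH : Measurable H)
    (hH1 : ∀ t u, 0 < t → 0 < u → H (t, u) ≤ 1) {L : ℝ → ℝ≥0∞}
    (hL : ∀ᵐ θ ∂volume.restrict (Ioi (0 : ℝ)),
      Tendsto (fun t => H (t, θ * t)) (𝓝[>] 0) (𝓝 (L θ))) (n : ℕ) :
    Tendsto (fun l : ℝ => ENNReal.ofReal (l ^ (n + 2)) *
        ∫⁻ t in Ioi (0 : ℝ), ∫⁻ u in Ioi (0 : ℝ),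
          ENNReal.ofReal (Real.exp (-(l * (t + u))) * u ^ n) * H (t, u)) atTop
      (𝓝 (∫⁻ θ in Ioi (0 : ℝ),
        ENNReal.ofReal ((n + 1).factorial * (θ ^ n / (1 + θ) ^ (n + 2))) * L θ)) := by
  have hm1 : ∀ l : ℝ, Measurable fun q : ℝ × ℝ =>
      ENNReal.ofReal (q.2 ^ (n + 1) * Real.exp (-((1 + q.1) * q.2))) *
        H (l⁻¹ * q.2, q.1 * (l⁻¹ * q.2)) := by
    intro l
    fun_prop
  have hm2 : ∀ l : ℝ, Measurable fun θ : ℝ => ENNReal.ofReal (θ ^ n) * ∫⁻ s in Ioi (0 : ℝ),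
      ENNReal.ofReal (s ^ (n + 1) * Real.exp (-((1 + θ) * s))) * H (l⁻¹ * s, θ * (l⁻¹ * s)) :=
    fun l => Measurable.mul (by fun_prop) (hm1 l).lintegral_prod_right'
  have hbd : ∀ θ l s : ℝ, 0 < θ → 0 < l → 0 < s →
      ENNReal.ofReal (s ^ (n + 1) * Real.exp (-((1 + θ) * s))) * H (l⁻¹ * s, θ * (l⁻¹ * s)) ≤
        ENNReal.ofReal (s ^ (n + 1) * Real.exp (-((1 + θ) * s))) := by
    intro θ l s hθ hl hs
    refine mul_le_of_le_one_right' (hH1 _ _ ?_ ?_) <;> positivity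
  have hint : ∀ θ : ℝ, 0 < θ → ENNReal.ofReal (θ ^ n) * ∫⁻ s in Ioi (0 : ℝ),
      ENNReal.ofReal (s ^ (n + 1) * Real.exp (-((1 + θ) * s))) =
        ENNReal.ofReal ((n + 1).factorial * (θ ^ n / (1 + θ) ^ (n + 2))) := by
    intro θ hθ
    rw [lintegral_pow_mul_exp_neg_mul (by positivity), ← ENNReal.ofReal_mul (by positivity)]
    congr 1
    ring
  have hlim : Tendsto (fun l : ℝ => ∫⁻ θ in Ioi (0 : ℝ), ENNReal.ofReal (θ ^ n) *
      ∫⁻ s in Ioi (0 : ℝ), ENNReal.ofReal (s ^ (n + 1) * Real.exp (-((1 + θ) * s))) *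
        H (l⁻¹ * s, θ * (l⁻¹ * s))) atTop
      (𝓝 (∫⁻ θ in Ioi (0 : ℝ),
        ENNReal.ofReal ((n + 1).factorial * (θ ^ n / (1 + θ) ^ (n + 2))) * L θ)) := by
    refine tendsto_lintegral_filter_of_dominated_convergence
      (fun θ => ENNReal.ofReal ((n + 1).factorial * (θ ^ n / (1 + θ) ^ (n + 2))))
      (Eventually.of_forall hm2) ?_ ?_ ?_
    · filter_upwards [eventually_gt_atTop 0] with l hl
      filter_upwards [self_mem_ae_restrict measurableSet_Ioi] with θ (hθ : 0 < θ)
      rw [← hint θ hθ]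
      gcongr ENNReal.ofReal _ * ?_
      exact setLIntegral_mono' measurableSet_Ioi fun s hs => hbd θ l s hθ hl hs
    · simp_rw [ENNReal.ofReal_mul (Nat.cast_nonneg' (n + 1).factorial)]
      rw [lintegral_const_mul' _ _ ENNReal.ofReal_ne_top]
      exact ENNReal.mul_ne_top ENNReal.ofReal_ne_top (lintegral_Ioi_pow_div_one_add_ne_top n)
    · filter_upwards [self_mem_ae_restrict measurableSet_Ioi, hL] with θ (hθ : 0 < θ) hLθ
      rw [← hint θ hθ, mul_assoc, ← lintegral_mul_const _ (by fun_prop)]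
      refine ENNReal.Tendsto.const_mul ?_ (Or.inr ENNReal.ofReal_ne_top)
      refine tendsto_lintegral_filter_of_dominated_convergence
        (fun s => ENNReal.ofReal (s ^ (n + 1) * Real.exp (-((1 + θ) * s))))
        (Eventually.of_forall fun l => (hm1 l).comp measurable_prodMk_left) ?_ ?_ ?_
      · filter_upwards [eventually_gt_atTop 0] with l hl
        filter_upwards [self_mem_ae_restrict measurableSet_Ioi] with s hs
        exact hbd θ l s hθ hl hs
      · rw [lintegral_pow_mul_exp_neg_mul (by positivity)]
        exact ENNReal.ofReal_ne_top
      · filter_upwards [self_mem_ae_restrict measurableSet_Ioi] with s (hs : 0 < s)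
        refine ENNReal.Tendsto.const_mul (hLθ.comp ?_) (Or.inr ENNReal.ofReal_ne_top)
        refine tendsto_nhdsWithin_iff.2 ⟨?_, ?_⟩
        · simpa using tendsto_inv_atTop_zero.mul_const s
        · filter_upwards [eventually_gt_atTop 0] with l hl
          exact mul_pos (inv_pos.2 hl) hs
  refine hlim.congr' ?_
  filter_upwards [eventually_gt_atTop 0] with l hl
  exact (lintegral_lintegral_scaling hH hl n).symm

end Scaling

/-! ### The arcsine function and its moments -/

section Arcsine

variable {α : ℝ}

/-- Euler's reflection formula. -/
theorem beta_one_sub_mul_sin (hα : 0 < α) (hα1 : α < 1) :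
    Real.sin (Real.pi * α) / Real.pi * beta (1 - α) α = 1 := by
  have hs : 0 < Real.sin (Real.pi * α) :=
    Real.sin_pos_of_pos_of_lt_pi (by positivity) (by nlinarith [Real.pi_pos])
  have hpi := Real.pi_pos
  rw [beta, mul_comm (Real.Gamma _), Real.Gamma_mul_Gamma_one_sub, sub_add_cancel, Real.Gamma_one]
  field_simp

theorem sin_div_pi_pos (hα : 0 < α) (hα1 : α < 1) : 0 < Real.sin (Real.pi * α) / Real.pi :=
  div_pos (Real.sin_pos_of_pos_of_lt_pi (by positivity) (by nlinarith [Real.pi_pos])) Real.pi_pos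

theorem beta_add_one_right {a b : ℝ} (ha : 0 < a) (hb : 0 < b) :
    (a + b) * beta a (1 + b) = b * beta a b := by
  have h1 : Real.Gamma (1 + b) = b * Real.Gamma b := by
    rw [add_comm, Real.Gamma_add_one hb.ne']
  have h2 : Real.Gamma (a + (1 + b)) = (a + b) * Real.Gamma (a + b) := by
    rw [← Real.Gamma_add_one (by positivity)]
    ring_nf
  have h3 : 0 < Real.Gamma (a + b) := Real.Gamma_pos_of_pos (by positivity)
  rw [beta, beta, h1, h2]
  field_simp

/-- Matches the constant from the power-sum asymptotics with the arcsine moment: `(a + b) B(a, 1 +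
b) = b B(a, b)` is applied to numerator and denominator, the factors `α` cancel, and reflection
evaluates `B(1 - α, α)`. -/
theorem moment_constant_eq (hα : 0 < α) (hα1 : α < 1) (n : ℕ) :
    n.factorial * ((n + 2) * beta (n + 2 - α) (1 + α)) / beta (1 - α) (1 + α) =
      (n + 1).factorial * (Real.sin (Real.pi * α) / Real.pi * (beta (n + 2 - α) α / (n + 1))) := by
  have hc := sin_div_pi_pos hα hα1
  have h0 := beta_one_sub_mul_sin hα hα1
  have h1 := beta_add_one_right (a := 1 - α) (b := α) (by linarith) hα
  have hn : (0 : ℝ) ≤ n := n.cast_nonneg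
  have h2 := beta_add_one_right (a := n + 2 - α) (b := α) (by linarith) hα
  rw [sub_add_cancel, one_mul] at h1
  rw [sub_add_cancel] at h2
  set c := Real.sin (Real.pi * α) / Real.pi
  have hb : beta (1 - α) α = 1 / c := by field_simp; linarith
  rw [h1, h2, hb, Nat.factorial_succ]
  push_cast
  field_simp

theorem measurable_arcsine_density :
    Measurable fun s : ℝ => s ^ (-α) * (1 - s) ^ (α - 1) := by fun_prop

theorem arcsine_density_nonneg {s : ℝ} (hs : s ∈ Ioo (0 : ℝ) 1) :
    0 ≤ s ^ (-α) * (1 - s) ^ (α - 1) :=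
  mul_nonneg (Real.rpow_nonneg hs.1.le _) (Real.rpow_nonneg (by linarith [hs.2]) _)

theorem lintegral_arcsine_density (hα : 0 < α) (hα1 : α < 1) :
    ∫⁻ s in Ioo (0 : ℝ) 1, ENNReal.ofReal (s ^ (-α) * (1 - s) ^ (α - 1)) =
      ENNReal.ofReal (beta (1 - α) α) := by
  rw [← lintegral_Ioo_rpow_mul_one_sub_rpow (by linarith) hα]
  simp [sub_sub_cancel_left]

theorem integrableOn_arcsine_density (hα : 0 < α) (hα1 : α < 1) :
    IntegrableOn (fun s : ℝ => s ^ (-α) * (1 - s) ^ (α - 1)) (Icc 0 1) := by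
  rw [integrableOn_Icc_iff_integrableOn_Ioo]
  refine ⟨measurable_arcsine_density.aestronglyMeasurable, ?_⟩
  rw [hasFiniteIntegral_iff_ofReal, lintegral_arcsine_density hα hα1]
  · exact ENNReal.ofReal_lt_top
  · filter_upwards [self_mem_ae_restrict measurableSet_Ioo] with s hs
    exact arcsine_density_nonneg hs

theorem continuousOn_arcsineFn (hα : 0 < α) (hα1 : α < 1) :
    ContinuousOn (arcsineFn α) (Ici 0) := by
  have h1 : ContinuousOn (fun x => ∫ s in x..1, s ^ (-α) * (1 - s) ^ (α - 1)) (uIcc 0 1) :=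
    intervalIntegral.continuousOn_primitive_interval_left
      (by simpa [uIcc_of_le] using integrableOn_arcsine_density hα hα1)
  rw [uIcc_of_le zero_le_one] at h1
  refine ContinuousOn.mul continuousOn_const (h1.comp (t := Icc 0 1)
    (ContinuousOn.div (by fun_prop) (by fun_prop) fun θ (hθ : 0 ≤ θ) => by positivity)
    fun θ (hθ : 0 ≤ θ) => ⟨by positivity, (div_le_one (by positivity)).2 (by linarith)⟩)

/-- Writing the range of integration as an indicator on a fixed domain prepares the interchange of
integrals in `lintegral_pow_div_one_add_mul_arcsineFn`. -/
theorem ofReal_arcsineFn (hα : 0 < α) (hα1 : α < 1) {θ : ℝ} (hθ : 0 ≤ θ) :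
    ENNReal.ofReal (arcsineFn α θ) = ENNReal.ofReal (Real.sin (Real.pi * α) / Real.pi) *
      ∫⁻ s in Ioo (0 : ℝ) 1, if θ / (1 + θ) < s
        then ENNReal.ofReal (s ^ (-α) * (1 - s) ^ (α - 1)) else 0 := by
  have h0 : 0 ≤ θ / (1 + θ) := by positivity
  have h1 : θ / (1 + θ) ≤ 1 := (div_le_one (by positivity)).2 (by linarith)
  have hsub : Ioo (θ / (1 + θ)) 1 ⊆ Ioo 0 1 := Ioo_subset_Ioo_left h0
  rw [arcsineFn, ENNReal.ofReal_mul (sin_div_pi_pos hα hα1).le,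
    intervalIntegral.integral_of_le h1, integral_Ioc_eq_integral_Ioo,
    ofReal_integral_eq_lintegral_ofReal]
  · congr 1
    rw [← lintegral_indicator measurableSet_Ioo, ← lintegral_indicator measurableSet_Ioo]
    refine lintegral_congr fun s => ?_
    simp only [indicator_apply, mem_Ioo]
    by_cases hs : θ / (1 + θ) < s
    · simp [hs, h0.trans_lt hs]
    · simp [hs]
  · exact (integrableOn_arcsine_density hα hα1).mono_set (hsub.trans Ioo_subset_Icc_self)
  · filter_upwards [self_mem_ae_restrict measurableSet_Ioo] with s hs
    exact arcsine_density_nonneg (hsub hs)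

theorem arcsineFn_nonneg (hα : 0 < α) (hα1 : α < 1) {θ : ℝ} (hθ : 0 ≤ θ) :
    0 ≤ arcsineFn α θ := by
  have h0 : 0 ≤ θ / (1 + θ) := by positivity
  have h1 : θ / (1 + θ) ≤ 1 := (div_le_one (by positivity)).2 (by linarith)
  refine mul_nonneg (sin_div_pi_pos hα hα1).le ?_
  refine intervalIntegral.integral_nonneg h1 fun s hs =>
    mul_nonneg (Real.rpow_nonneg (h0.trans hs.1) _) (Real.rpow_nonneg (by linarith [hs.2]) _)

theorem arcsineFn_zero (hα : 0 < α) (hα1 : α < 1) : arcsineFn α 0 = 1 := by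
  have h : ENNReal.ofReal (arcsineFn α 0) = ENNReal.ofReal 1 := by
    conv_rhs => rw [← beta_one_sub_mul_sin hα hα1]
    rw [ofReal_arcsineFn hα hα1 le_rfl, ENNReal.ofReal_mul (sin_div_pi_pos hα hα1).le,
      ← lintegral_arcsine_density hα hα1]
    refine congrArg _ (setLIntegral_congr_fun measurableSet_Ioo fun s hs => ?_)
    rw [zero_div, if_pos hs.1]
  rwa [ENNReal.ofReal_eq_ofReal_iff (arcsineFn_nonneg hα hα1 le_rfl) zero_le_one] at h

theorem lintegral_Ioi_pow_div_one_add_ite {s : ℝ} (hs : s ∈ Ioo (0 : ℝ) 1) (n : ℕ) (C : ℝ≥0∞) :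
    ∫⁻ θ in Ioi (0 : ℝ), ENNReal.ofReal (θ ^ n / (1 + θ) ^ (n + 2)) *
        (if θ / (1 + θ) < s then C else 0) = ENNReal.ofReal (s ^ (n + 1) / (n + 1)) * C := by
  have hs1 : 0 < 1 - s := by linarith [hs.2]
  have hb : 0 ≤ s / (1 - s) := div_nonneg hs.1.le hs1.le
  have h1 : s / (1 - s) / (1 + s / (1 - s)) = s := by
    have : 1 + s / (1 - s) = 1 / (1 - s) := by field_simp; ring
    rw [this]
    field_simp
  have h2 := lintegral_Ioo_pow_div_one_add hb n
  rw [h1] at h2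
  rw [← h2, ← lintegral_mul_const _ (by fun_prop), ← lintegral_indicator measurableSet_Ioi,
    ← lintegral_indicator measurableSet_Ioo]
  refine lintegral_congr fun θ => ?_
  simp only [indicator_apply, mem_Ioo, mem_Ioi]
  by_cases hθ : 0 < θ
  · have h3 : θ / (1 + θ) < s ↔ θ < s / (1 - s) := by
      rw [div_lt_iff₀ (by positivity), lt_div_iff₀ hs1]
      constructor <;> intro h <;> linarith
    simp only [hθ, h3, if_true, true_and]
    split_ifs <;> simp
  · simp [hθ]

/-- By Tonelli the `θ`-integral comes first. It runs up to `s / (1 - s)` and gives `s ^ (n + 1) / (n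
+ 1)`, which leaves a beta integral in `s`. -/
theorem lintegral_pow_div_one_add_mul_arcsineFn (hα : 0 < α) (hα1 : α < 1) (n : ℕ) :
    ∫⁻ θ in Ioi (0 : ℝ), ENNReal.ofReal (θ ^ n / (1 + θ) ^ (n + 2)) *
        ENNReal.ofReal (arcsineFn α θ) =
      ENNReal.ofReal (Real.sin (Real.pi * α) / Real.pi * (beta (n + 2 - α) α / (n + 1))) := by
  have hm : Measurable fun q : ℝ × ℝ => ENNReal.ofReal (q.1 ^ n / (1 + q.1) ^ (n + 2)) *
      (if q.1 / (1 + q.1) < q.2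
        then ENNReal.ofReal (q.2 ^ (-α) * (1 - q.2) ^ (α - 1)) else 0) := by
    refine Measurable.mul (by fun_prop) (Measurable.ite ?_ (by fun_prop) measurable_const)
    exact measurableSet_lt (by fun_prop) measurable_snd
  have h1 : ∀ θ ∈ Ioi (0 : ℝ), ENNReal.ofReal (θ ^ n / (1 + θ) ^ (n + 2)) *
        ENNReal.ofReal (arcsineFn α θ) = ENNReal.ofReal (Real.sin (Real.pi * α) / Real.pi) *
      ∫⁻ s in Ioo (0 : ℝ) 1, ENNReal.ofReal (θ ^ n / (1 + θ) ^ (n + 2)) *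
        (if θ / (1 + θ) < s then ENNReal.ofReal (s ^ (-α) * (1 - s) ^ (α - 1)) else 0) := by
    intro θ hθ
    rw [ofReal_arcsineFn hα hα1 (le_of_lt hθ), mul_left_comm,
      lintegral_const_mul' _ _ ENNReal.ofReal_ne_top]
  have hn : (0 : ℝ) ≤ n := n.cast_nonneg
  rw [setLIntegral_congr_fun measurableSet_Ioi h1, lintegral_const_mul' _ _ ENNReal.ofReal_ne_top,
    lintegral_lintegral_swap hm.aemeasurable, ENNReal.ofReal_mul (sin_div_pi_pos hα hα1).le,
    div_eq_inv_mul (beta _ _), ENNReal.ofReal_mul (by positivity),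
    ← lintegral_Ioo_rpow_mul_one_sub_rpow (by linarith) hα,
    ← lintegral_const_mul' (ENNReal.ofReal ((n : ℝ) + 1)⁻¹) _ ENNReal.ofReal_ne_top]
  refine congrArg _ (setLIntegral_congr_fun measurableSet_Ioo fun s hs => ?_)
  refine (lintegral_Ioi_pow_div_one_add_ite hs n _).trans ?_
  have hs0 : 0 < s := hs.1
  rw [← ENNReal.ofReal_mul (by positivity), ← ENNReal.ofReal_mul (by positivity)]
  congr 1
  have h2 : s ^ ((n : ℝ) + 2 - α - 1) = s ^ (n + 1) * s ^ (-α) := by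
    rw [← Real.rpow_natCast, ← Real.rpow_add hs0]
    congr 1
    push_cast
    ring
  rw [h2]
  field_simp

end Arcsine

/-! ### Reduction to measurable variables; elementary properties of the aging function -/

/-- `HasLaw` yields almost everywhere measurability only. A countable family can be modified on one
null set, which leaves `agingFn` unchanged by `agingFn_congr`. -/
theorem IsDrivingFamily.exists_isMeasurableDriving {Ω : Type*} [MeasurableSpace Ω] {P : Measure Ω}
    {E T : ℕ+ → ℕ → Ω → ℝ} (h : IsDrivingFamily E T P) :
    ∃ E' T' : ℕ+ → ℕ → Ω → ℝ, IsMeasurableDriving E' T' P ∧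
      ∀ᵐ ω ∂P, (fun x j => E x j ω) = (fun x j => E' x j ω) ∧
        (fun x j => T x j ω) = fun x j => T' x j ω := by
  have hE : ∀ x j, E x j =ᵐ[P] (h.hasLaw_E x j).aemeasurable.mk (E x j) := fun x j =>
    (h.hasLaw_E x j).aemeasurable.ae_eq_mk
  have hT : ∀ x j, T x j =ᵐ[P] (h.hasLaw_T x j).aemeasurable.mk (T x j) := fun x j =>
    (h.hasLaw_T x j).aemeasurable.ae_eq_mk
  refine ⟨fun x j => (h.hasLaw_E x j).aemeasurable.mk (E x j),
    fun x j => (h.hasLaw_T x j).aemeasurable.mk (T x j), ⟨⟨?_, ?_, ?_⟩, ?_, ?_⟩, ?_⟩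
  · exact fun x j => (h.hasLaw_E x j).congr (hE x j).symm
  · exact fun x j => (h.hasLaw_T x j).congr (hT x j).symm
  · refine iIndepFun.congr (fun k => ?_) h.indep
    rcases k with k | k
    · exact hE k.1 k.2
    · exact hT k.1 k.2
  · exact fun x j => (h.hasLaw_E x j).aemeasurable.measurable_mk
  · exact fun x j => (h.hasLaw_T x j).aemeasurable.measurable_mk
  · filter_upwards [ae_all_iff.2 fun x => ae_all_iff.2 fun j => hE x j,
      ae_all_iff.2 fun x => ae_all_iff.2 fun j => hT x j] with ω h1 h2
    exact ⟨funext fun x => funext fun j => h1 x j, funext fun x => funext fun j => h2 x j⟩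

section AgingFn

variable {Ω : Type*} [MeasurableSpace Ω] {P : Measure Ω} {E T E' T' : ℕ+ → ℕ → Ω → ℝ}
  {γ : ℕ+ → ℝ}

theorem agingFn_congr (h : ∀ᵐ ω ∂P, (fun x j => E x j ω) = (fun x j => E' x j ω) ∧
    (fun x j => T x j ω) = fun x j => T' x j ω) (t θ : ℝ) :
    agingFn P E T γ t θ = agingFn P E' T' γ t θ := by
  refine measureReal_congr (eventuallyEq_set.2 ?_)
  filter_upwards [h] with ω hω
  simp only [hω.1, hω.2]

variable [IsProbabilityMeasure P]

theorem agingFn_zero (t : ℝ) : agingFn P E T γ t 0 = 1 := by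
  have h : {ω | ∀ s ∈ Icc t (t + 0 * t),
      kPath γ (fun x j => E x j ω) (fun x j => T x j ω) s =
        kPath γ (fun x j => E x j ω) (fun x j => T x j ω) t} = univ := by
    refine eq_univ_of_forall fun ω s hs => ?_
    simp only [zero_mul, add_zero, Icc_self, mem_singleton_iff] at hs
    rw [hs]
  rw [agingFn, h, probReal_univ]

theorem agingFn_anti {t θ₁ θ₂ : ℝ} (ht : 0 ≤ t) (h : θ₁ ≤ θ₂) :
    agingFn P E T γ t θ₂ ≤ agingFn P E T γ t θ₁ :=
  measureReal_mono fun ω hω s hs => hω s (Icc_subset_Icc_right (by gcongr) hs)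

end AgingFn

/-! ### Identification of the limit almost everywhere -/

section Limit

variable {Ω : Type*} [MeasurableSpace Ω] {P : Measure Ω} [IsProbabilityMeasure P]
  {E T : ℕ+ → ℕ → Ω → ℝ} {γ : ℕ+ → ℝ} {α : ℝ}

/-- Absorbing `l ^ (n + 2)` turns the sum into `n!` times the power sum of order `n + 2`. Both power
sums grow like `l ^ α`, so their ratio converges. -/
theorem tendsto_moment_ratio (hα : 0 < α) (hα1 : α < 1) (hγ : IsRegularEnv α γ) (n : ℕ) :
    Tendsto (fun l : ℝ => ENNReal.ofReal (l ^ (n + 2)) * ((powerSum γ 1 l)⁻¹ *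
        ∑' x, ENNReal.ofReal (n.factorial * (γ x / (1 + l * γ x)) ^ (n + 2)))) atTop
      (𝓝 (ENNReal.ofReal ((n + 1).factorial *
        (Real.sin (Real.pi * α) / Real.pi * (beta (n + 2 - α) α / (n + 1)))))) := by
  have hn : (0 : ℝ) ≤ n := n.cast_nonneg
  have h1 := hγ.tendsto_powerSum hα hα1 0
  have h2 := hγ.tendsto_powerSum hα hα1 (n + 1)
  simp only [zero_add, Nat.cast_zero, one_mul] at h1
  have h3 : ((n + 1 : ℕ) : ℝ) + 1 = n + 2 := by push_cast; ring
  rw [h3] at h2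
  have hb : 0 < beta (1 - α) (1 + α) := beta_pos (by linarith) (by linarith)
  have h4 := ENNReal.Tendsto.const_mul (a := ENNReal.ofReal n.factorial)
    (ENNReal.Tendsto.div h2 (Or.inr (ENNReal.ofReal_pos.2 hb).ne') h1
      (Or.inl ENNReal.ofReal_ne_top)) (Or.inr ENNReal.ofReal_ne_top)
  rw [← ENNReal.ofReal_div_of_pos hb, ← ENNReal.ofReal_mul (by positivity), mul_div_assoc',
    moment_constant_eq hα hα1] at h4
  refine h4.congr' ?_
  filter_upwards [eventually_gt_atTop 0] with l hl
  have h5 : ENNReal.ofReal (l ^ (-α)) ≠ 0 := (ENNReal.ofReal_pos.2 (Real.rpow_pos_of_pos hl _)).ne'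
  rw [ENNReal.mul_div_mul_left _ _ h5 ENNReal.ofReal_ne_top, div_eq_mul_inv,
    mul_comm (powerSum γ _ l), mul_left_comm, mul_left_comm (ENNReal.ofReal (l ^ (n + 2)))]
  congr 1
  rw [powerSum, ← ENNReal.tsum_mul_left, ← ENNReal.tsum_mul_left]
  refine tsum_congr fun x => ?_
  have hx := hγ.pos x
  rw [← ENNReal.ofReal_mul (by positivity), ← ENNReal.ofReal_mul (by positivity)]
  congr 1
  rw [div_pow, div_pow, mul_pow]
  ring

/-- The limit of the aging function, if it exists almost everywhere, is the arcsine function. -/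
theorem IsMeasurableDriving.ae_eq_arcsineFn (h : IsMeasurableDriving E T P) (hα : 0 < α)
    (hα1 : α < 1) (hγ : IsRegularEnv α γ) {Λ : ℝ → ℝ}
    (hΛ : ∀ᵐ θ ∂volume.restrict (Ioi (0 : ℝ)),
      Tendsto (fun t => agingFn P E T γ t θ) (𝓝[>] 0) (𝓝 (Λ θ))) :
    ∀ᵐ θ ∂volume.restrict (Ioi (0 : ℝ)), Λ θ = arcsineFn α θ := by
  have hpos := hγ.pos
  have hsum := hγ.tsum_ne_top hα hα1
  have hH := h.measurable_holdProb (γ := γ)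
  have hL : ∀ᵐ θ ∂volume.restrict (Ioi (0 : ℝ)),
      Tendsto (fun t => holdProb P E T γ t (θ * t)) (𝓝[>] 0) (𝓝 (ENNReal.ofReal (Λ θ))) := by
    filter_upwards [hΛ, self_mem_ae_restrict measurableSet_Ioi] with θ hθ (hθ0 : 0 < θ)
    refine (ENNReal.tendsto_ofReal hθ).congr' ?_
    filter_upwards [self_mem_nhdsWithin] with t (ht : 0 < t)
    rw [h.agingFn_eq_holdProb hpos hsum ht hθ0, ENNReal.ofReal_toReal]
    exact ne_top_of_le_ne_top ENNReal.one_ne_top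
      (h.holdProb_le_one hpos hsum ht.le (mul_pos hθ0 ht))
  -- No measurability of `Λ` is assumed; it is inherited from the almost everywhere limit.
  have hLm : AEMeasurable (fun θ => ENNReal.ofReal (Λ θ)) (volume.restrict (Ioi 0)) :=
    aemeasurable_of_tendsto_metrizable_ae (𝓝[>] (0 : ℝ))
      (f := fun t θ => holdProb P E T γ t (θ * t))
      (fun t => (hH.comp (by fun_prop : Measurable fun θ : ℝ => (t, θ * t))).aemeasurable) hL
  have hmom : ∀ n : ℕ, ∫⁻ θ in Ioi (0 : ℝ), ENNReal.ofReal (θ ^ n / (1 + θ) ^ (n + 2)) *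
      ENNReal.ofReal (Λ θ) = ∫⁻ θ in Ioi (0 : ℝ), ENNReal.ofReal (θ ^ n / (1 + θ) ^ (n + 2)) *
      ENNReal.ofReal (arcsineFn α θ) := by
    intro n
    have h1 := tendsto_lintegral_lintegral_scaling hH
      (fun t u ht hu => h.holdProb_le_one hpos hsum ht.le hu) hL n
    have h2 := (tendsto_moment_ratio hα hα1 hγ n).congr' (f₂ := _) <| by
      filter_upwards [eventually_gt_atTop 0] with l hl
      rw [← h.lintegral_lintegral_holdProb hpos hsum hl n]
    -- The same quantity has been given two limits: one by scaling, in terms of `Λ`, and one from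
    -- the explicit transform.
    have h3 := tendsto_nhds_unique h1 h2
    have hf : (0 : ℝ) ≤ (n + 1).factorial := Nat.cast_nonneg' _
    simp_rw [ENNReal.ofReal_mul hf, mul_assoc] at h3
    rw [lintegral_const_mul' _ _ ENNReal.ofReal_ne_top,
      ← lintegral_pow_div_one_add_mul_arcsineFn hα hα1 n] at h3
    refine (ENNReal.mul_right_inj ?_ ENNReal.ofReal_ne_top).1 h3
    exact (ENNReal.ofReal_pos.2 (by positivity)).ne'
  have hfin : ∫⁻ θ in Ioi (0 : ℝ), ENNReal.ofReal (1 / (1 + θ) ^ 2) * ENNReal.ofReal (Λ θ) ≠ ∞ := by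
    have h0 := hmom 0
    rw [lintegral_pow_div_one_add_mul_arcsineFn hα hα1 0] at h0
    simp only [pow_zero, zero_add] at h0
    rw [h0]
    exact ENNReal.ofReal_ne_top
  have hAm : AEMeasurable (fun θ => ENNReal.ofReal (arcsineFn α θ)) (volume.restrict (Ioi 0)) :=
    (((continuousOn_arcsineFn hα hα1).mono Ioi_subset_Ici_self).aemeasurable
      measurableSet_Ioi).ennreal_ofReal
  filter_upwards [ae_eq_of_moments_div_one_add hLm hAm hfin hmom, hΛ,
    self_mem_ae_restrict measurableSet_Ioi] with θ hθ hθΛ hθ0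
  refine (ENNReal.ofReal_eq_ofReal_iff (ge_of_tendsto' hθΛ fun t => measureReal_nonneg)
    (arcsineFn_nonneg hα hα1 (le_of_lt hθ0))).1 hθ

end Limit

/-! ### From almost every point to every point of convergence -/

section Pointwise

theorem exists_mem_Ioo_of_ae_restrict_Ioi {p : ℝ → Prop}
    (h : ∀ᵐ θ ∂volume.restrict (Ioi (0 : ℝ)), p θ) {a b : ℝ} (ha : 0 ≤ a) (hab : a < b) :
    ∃ θ ∈ Ioo a b, p θ := by
  have h1 : ∀ᵐ θ ∂volume.restrict (Ioo a b), p θ :=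
    ae_restrict_of_ae_restrict_of_subset (fun θ hθ => ha.trans_lt hθ.1) h
  have : NeBot (ae (volume.restrict (Ioo a b))) := by
    rw [ae_neBot, ne_eq, Measure.restrict_eq_zero, Real.volume_Ioo]
    simpa using hab
  obtain ⟨θ, hθ, hθ'⟩ := (h1.and (self_mem_ae_restrict measurableSet_Ioo)).exists
  exact ⟨θ, hθ', hθ⟩

/-- Monotone functions converging almost everywhere to a continuous limit have no other limit at
any point of convergence. -/
theorem eq_of_tendsto_of_antitone {F : ℝ → ℝ → ℝ} {g : ℝ → ℝ}
    (hF : ∀ t θ₁ θ₂ : ℝ, 0 < t → θ₁ ≤ θ₂ → F t θ₂ ≤ F t θ₁) (hg : ContinuousOn g (Ici 0))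
    (h : ∀ᵐ θ ∂volume.restrict (Ioi (0 : ℝ)), Tendsto (fun t => F t θ) (𝓝[>] 0) (𝓝 (g θ)))
    {θ c : ℝ} (hθ : 0 < θ) (hc : Tendsto (fun t => F t θ) (𝓝[>] 0) (𝓝 c)) : c = g θ := by
  have hgc : ContinuousAt g θ := hg.continuousAt (Ici_mem_nhds hθ)
  have hle : ∀ θ₁ θ₂ c₁ c₂ : ℝ, θ₁ ≤ θ₂ → Tendsto (fun t => F t θ₁) (𝓝[>] 0) (𝓝 c₁) →
      Tendsto (fun t => F t θ₂) (𝓝[>] 0) (𝓝 c₂) → c₂ ≤ c₁ := by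
    intro θ₁ θ₂ c₁ c₂ hθ₁₂ h₁ h₂
    refine le_of_tendsto_of_tendsto h₂ h₁ ?_
    filter_upwards [self_mem_nhdsWithin] with t ht
    exact hF t θ₁ θ₂ ht hθ₁₂
  refine eq_of_forall_dist_le fun ε hε => ?_
  obtain ⟨δ, hδ, hδε⟩ := Metric.continuousAt_iff.1 hgc ε hε
  -- Points of convergence `a < θ < b` within `δ` of `θ` trap `c` between `g b` and `g a`, both
  -- within `ε` of `g θ`.
  obtain ⟨a, ha, ha'⟩ := exists_mem_Ioo_of_ae_restrict_Ioi h
    (le_max_right (θ - δ) 0) (max_lt (sub_lt_self θ hδ) hθ)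
  obtain ⟨b, hb, hb'⟩ := exists_mem_Ioo_of_ae_restrict_Ioi h hθ.le (lt_add_of_pos_right θ hδ)
  have h1 := hle a θ _ _ ha.2.le ha' hc
  have h2 := hle θ b _ _ hb.1.le hc hb'
  have h3 := hδε (x := a) (by
    rw [Real.dist_eq, abs_lt]
    constructor <;> linarith [(le_max_left (θ - δ) 0).trans_lt ha.1, ha.2])
  have h4 := hδε (x := b) (by
    rw [Real.dist_eq, abs_lt]
    constructor <;> linarith [hb.1, hb.2])
  rw [Real.dist_eq, abs_lt] at h3 h4
  rw [Real.dist_eq, abs_le]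
  constructor <;> linarith [h3.1, h3.2, h4.1, h4.2]

end Pointwise

/-- In a regular environment the limit of the aging function is the arcsine function wherever it
exists, provided that it exists almost everywhere. -/
theorem IsRegularEnv.aging_limit {Ω : Type*} [MeasurableSpace Ω] {P : Measure Ω}
    [IsProbabilityMeasure P] {E T : ℕ+ → ℕ → Ω → ℝ} {γ : ℕ+ → ℝ} {α : ℝ}
    (hγ : IsRegularEnv α γ) (hα : 0 < α) (hα1 : α < 1) (h : IsDrivingFamily E T P) {Λ : ℝ → ℝ}
    (hΛ : ∀ᵐ θ ∂volume.restrict (Ici (0 : ℝ)),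
      Tendsto (fun t => agingFn P E T γ t θ) (𝓝[>] 0) (𝓝 (Λ θ))) :
    (∀ᵐ θ ∂volume.restrict (Ici (0 : ℝ)), Λ θ = arcsineFn α θ) ∧
      ∀ θ : ℝ, 0 ≤ θ → Tendsto (fun t => agingFn P E T γ t θ) (𝓝[>] 0) (𝓝 (Λ θ)) →
        Λ θ = arcsineFn α θ := by
  obtain ⟨E', T', h', hEq⟩ := h.exists_isMeasurableDriving
  rw [← Measure.restrict_congr_set Ioi_ae_eq_Ici] at hΛ ⊢
  have hae : ∀ᵐ θ ∂volume.restrict (Ioi (0 : ℝ)), Λ θ = arcsineFn α θ := by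
    refine h'.ae_eq_arcsineFn hα hα1 hγ ?_
    simpa only [agingFn_congr hEq] using hΛ
  refine ⟨hae, fun θ hθ hlim => ?_⟩
  -- At `θ = 0` the interval is a single point, so the aging function is identically `1`, as is
  -- `arcsineFn` there.
  rcases hθ.eq_or_lt with rfl | hθ
  · simp only [agingFn_zero] at hlim
    rw [arcsineFn_zero hα hα1]
    exact tendsto_nhds_unique hlim tendsto_const_nhds
  · refine eq_of_tendsto_of_antitone (F := agingFn P E T γ) (fun _ _ _ ht hle => agingFn_anti ht.le hle)
      (continuousOn_arcsineFn hα hα1) ?_ hθ hlim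
    filter_upwards [hΛ, hae] with θ hθ h1
    rwa [h1] at hθ

end KProc

/-- The exceptional null set consists of the realizations whose environment is not regular, so it
depends neither on `Λ` nor on the driving family. -/
theorem proposition5p22 {Ω Ω' : Type*} [MeasurableSpace Ω] [MeasurableSpace Ω']
    (P : Measure Ω) [IsProbabilityMeasure P] (P' : Measure Ω') [IsProbabilityMeasure P']
    (α : ℝ) (hα_pos : 0 < α) (hα_lt : α < 1)
    (p : ℕ → Ω → ℝ × ℝ) (hp : KProc.IsPoissonPointProcess p (KProc.stableIntensity α) P)
    (E T : ℕ+ → ℕ → Ω' → ℝ) (hET : KProc.IsDrivingFamily E T P') :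
    ∀ᵐ ω ∂P, ∀ Λ : ℝ → ℝ,
      (∀ᵐ θ ∂(volume.restrict (Ici (0 : ℝ))),
        Tendsto (fun t => KProc.agingFn P' E T (KProc.jumpWeight fun j => p j ω) t θ)
          (𝓝[>] 0) (𝓝 (Λ θ))) →
      (∀ᵐ θ ∂(volume.restrict (Ici (0 : ℝ))), Λ θ = KProc.arcsineFn α θ) ∧
      ∀ θ : ℝ, 0 ≤ θ →
        Tendsto (fun t => KProc.agingFn P' E T (KProc.jumpWeight fun j => p j ω) t θ)
          (𝓝[>] 0) (𝓝 (Λ θ)) →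
        Λ θ = KProc.arcsineFn α θ := by
  filter_upwards [KProc.ae_isRegularEnv_jumpWeight hα_pos hp] with ω hω Λ hΛ
  exact hω.aging_limit hα_pos hα_lt hET hΛ
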